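/- Let $G$ be a finite-dimensional real Lie group with Lie algebra $\mathfrak g$, let $M$ be a finite-dimensional smooth manifold, $\pi:P\to M$ a smooth principal $G$-bundle with a principal connection $A$ (locally a $\mathfrak g$-valued $1$-form) and curvature $F=dA+A\wedge A$, and let $B$ be a smooth $2$-form on $M$ with values in the adjoint bundle of $P$ (locally $B=\tfrac12B_{\mu\nu}dx^\mu\wedge dx^\nu$ is $\mathfrak g$-valued and transforms in the adjoint representation). Fix $x_0\in M$ and a point $p_0\in P$ above $x_0$, which identifies the fibre over $x_0$ with $G$. A *loop at* $x_0$ is a smooth $\gamma:[0,2\pi]\to M$ with $\gamma(0)=\gamma(2\pi)=x_0$; $\Omega(M,x_0)$ is the set of these. Along $\gamma$ let $W(\sigma)$ be the parallel transport of $A$ from $\gamma(0)$ to $\gamma(\sigma)$, $\frac{dW}{d\sigma}+A_\mu\frac{dx^\mu}{d\sigma}W=0$, $W(0)=1$, and for a field $X$ in the adjoint representation put $X^W(\sigma)=W(\sigma)^{-1}X(\gamma(\sigma))W(\sigma)\in\mathfrak g$. The connection $\mathcal A$ on $\Omega(M,x_0)$ is $$\mathcal A[\gamma](\delta x)=\int_0^{2\pi}B^W_{\mu\nu}(x(\sigma))\,\frac{dx^\mu}{d\sigma}\,\delta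 x^\nu(\sigma)\,d\sigma .$$ A *loop of loops* is a smooth map $x:[0,2\pi]^2\to M$, $(\sigma,\tau)\mapsto x(\sigma,\tau)$, with $x(0,\tau)=x(2\pi,\tau)=x_0$ for all $\tau$ and $x(\sigma,0)=x(\sigma,2\pi)$ for all $\sigma$. (Smooth on a closed interval or square means: restriction of a smooth map defined on the line or plane.) Write $x_\tau=x(\cdot,\tau)$. The holonomy of $x$ is $\mathcal W(2\pi)\in G$, where $\frac{d\mathcal W}{d\tau}+\mathcal A[x_\tau](\partial_\tau x)\,\mathcal W=0$ on $[0,2\pi]$ and $\mathcal W(0)=1$. The connection $\mathcal A$ is *$r$-flat* if for every loop of loops $x$ and every diffeomorphism $h$ of $[0,2\pi]^2$ that is the identity on the boundary and is smoothly isotopic to the identity through such diffeomorphisms, $x$ and $x\circ h$ have the same holonomy. **Theorem.** $\mathcal A$ is $r$-flat if and only if for every loop of loops $x$ and all $\sigma,\tau\in[0,2\pi]$, $$\begin{aligned}0=\int_0^{2\pi}d\sigma'\,\Bigl(&\theta(\sigma-\sigma')\bigl[F^W_{\kappa\mu}(x(\sigma',\tau))-B^W_{\kappa\mu}(x(\sigma',\tau)),\,B^W_{\lambda\nu}(x(\sigma,\tau))\bigr]\\&-\theta(\sigma'-\sigma)\bigl[F^W_{\lambda\nu}(x(\sigma,\tau))-B^W_{\lambda\nu}(x(\sigma,\tau)),\,B^W_{\kappa\mu}(x(\sigma',\tau))\bigr]\Bigr)\,\frac{\partial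 x^\kappa}{\partial\sigma'}(\sigma',\tau)\frac{\partial x^\mu}{\partial\tau}(\sigma',\tau)\frac{\partial x^\lambda}{\partial\sigma}(\sigma,\tau)\frac{\partial x^\nu}{\partial\tau}(\sigma,\tau),\end{aligned}$$ where $\theta(t)=1$ for $t>0$ and $\theta(t)=0$ for $t<0$, and $W$ at $(\sigma,\tau)$ is the parallel transport along the loop $x_\tau$. -/

import Mathlib

open Set MeasureTheory
open scoped Manifold ContDiff Topology

noncomputable section

section Forms

variable {E : Type*} [NormedAddCommGroup E] [NormedSpace ℝ E]
  {X : Type*} [TopologicalSpace X] [ChartedSpace E X]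
  {V : Type*} [NormedAddCommGroup V] [NormedSpace ℝ V]

/-- Differential `n`-forms (no smoothness yet) on a manifold `X` modelled on the vector space `E`,
with values in the vector space `V`. -/
abbrev VForm (E X V : Type*) [NormedAddCommGroup E] [NormedSpace ℝ E] [TopologicalSpace X]
    [ChartedSpace E X] [NormedAddCommGroup V] [NormedSpace ℝ V] (n : ℕ) : Type _ :=
  ∀ p : X, TangentSpace 𝓘(ℝ, E) p [⋀^Fin n]→L[ℝ] V

/-- The expression of a form in the chart around `p₀`, i.e. its pullback under the inverse of
that chart (meaningful on the target of the chart, an open subset of `E`). -/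
def VForm.inChart {n : ℕ} (α : VForm E X V n) (p₀ : X) (y : E) : E [⋀^Fin n]→L[ℝ] V :=
  (α ((extChartAt 𝓘(ℝ, E) p₀).symm y)).compContinuousLinearMap
    (mfderiv 𝓘(ℝ, E) 𝓘(ℝ, E) (extChartAt 𝓘(ℝ, E) p₀).symm y)

/-- A form is smooth if its expression in each chart is smooth. -/
def VForm.IsSmooth {n : ℕ} (α : VForm E X V n) : Prop :=
  ∀ p₀ : X, ContDiffOn ℝ ∞ (α.inChart p₀) (extChartAt 𝓘(ℝ, E) p₀).target

/-- The exterior derivative of a form on a manifold, computed in the chart around the point;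
for a `1`-form, `dα(X, Y) = X (α Y) - Y (α X) - α [X, Y]`. -/
def VForm.extDer {n : ℕ} (α : VForm E X V n) : VForm E X V (n + 1) := fun p =>
  (extDeriv (α.inChart p) (extChartAt 𝓘(ℝ, E) p p)).compContinuousLinearMap
    (mfderiv 𝓘(ℝ, E) 𝓘(ℝ, E) (extChartAt 𝓘(ℝ, E) p) p)

/-- The partial derivative `∂y/∂σ` of a map `y(σ, τ)` of the plane to a manifold. -/
def dSigma (E : Type*) [NormedAddCommGroup E] [NormedSpace ℝ E] {X : Type*} [TopologicalSpace X]
    [ChartedSpace E X] (y : ℝ × ℝ → X) (σ τ : ℝ) : TangentSpace 𝓘(ℝ, E) (y (σ, τ)) :=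
  mfderiv 𝓘(ℝ, ℝ × ℝ) 𝓘(ℝ, E) y (σ, τ) ((1, 0) : ℝ × ℝ)

/-- The partial derivative `∂y/∂τ` of a map `y(σ, τ)` of the plane to a manifold. -/
def dTau (E : Type*) [NormedAddCommGroup E] [NormedSpace ℝ E] {X : Type*} [TopologicalSpace X]
    [ChartedSpace E X] (y : ℝ × ℝ → X) (σ τ : ℝ) : TangentSpace 𝓘(ℝ, E) (y (σ, τ)) :=
  mfderiv 𝓘(ℝ, ℝ × ℝ) 𝓘(ℝ, E) y (σ, τ) ((0, 1) : ℝ × ℝ)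

end Forms

section LieGroupPart

variable {EG : Type*} [NormedAddCommGroup EG] [NormedSpace ℝ EG]
  (G : Type*) [TopologicalSpace G] [ChartedSpace EG G] [Group G]

/-! The Lie algebra `𝔤 = T₁G` of a Lie group modelled on `EG` is, as a vector space, `EG` itself
(`GroupLieAlgebra 𝓘(ℝ, EG) G` unfolds to `EG`).  Forms with values in `𝔤` are written as forms
with values in `EG`, which carries a norm. -/

/-- The bracket of the Lie algebra of `G` (through left invariant vector fields). -/
def lieBr (ξ η : EG) : EG :=
  (⁅(show GroupLieAlgebra 𝓘(ℝ, EG) G from ξ), (show GroupLieAlgebra 𝓘(ℝ, EG) G from η)⁆ :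
    GroupLieAlgebra 𝓘(ℝ, EG) G)

variable {G}

/-- The adjoint representation: `Ad g` is the derivative at `1` of `h ↦ g h g⁻¹`. -/
def adj (g : G) (ξ : EG) : EG :=
  mfderiv 𝓘(ℝ, EG) 𝓘(ℝ, EG) (fun h : G => g * h * g⁻¹) 1 ξ

end LieGroupPart

section Bundles

/-- A smooth principal `G`-bundle `P → M`. -/
structure PrincipalBundle (EG EM EP : Type*)
    [NormedAddCommGroup EG] [NormedSpace ℝ EG] [NormedAddCommGroup EM] [NormedSpace ℝ EM]
    [NormedAddCommGroup EP] [NormedSpace ℝ EP]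
    (G M P : Type*) [TopologicalSpace G] [ChartedSpace EG G] [Group G]
    [TopologicalSpace M] [ChartedSpace EM M] [TopologicalSpace P] [ChartedSpace EP P] where
  /-- the projection -/
  proj : P → M
  contMDiff_proj : ContMDiff 𝓘(ℝ, EP) 𝓘(ℝ, EM) ∞ proj
  /-- the right action `(p, g) ↦ p g` of the structure group -/
  act : P → G → P
  act_one : ∀ p, act p 1 = p
  act_mul : ∀ p g h, act p (g * h) = act (act p g) h
  contMDiff_act : ContMDiff (𝓘(ℝ, EP).prod 𝓘(ℝ, EG)) 𝓘(ℝ, EP) ∞ fun q : P × G => act q.1 q.2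
  proj_act : ∀ p g, proj (act p g) = proj p
  /-- every point of `M` has an open neighbourhood `U` with a `G`-equivariant diffeomorphism
  of the part of `P` above `U` onto `U × G` -/
  locTriv : ∀ m : M, ∃ U : Set M, IsOpen U ∧ m ∈ U ∧ ∃ φ : OpenPartialHomeomorph P (M × G),
    φ.source = proj ⁻¹' U ∧ φ.target = U ×ˢ univ ∧
    ContMDiffOn 𝓘(ℝ, EP) (𝓘(ℝ, EM).prod 𝓘(ℝ, EG)) ∞ φ φ.source ∧
    ContMDiffOn (𝓘(ℝ, EM).prod 𝓘(ℝ, EG)) 𝓘(ℝ, EP) ∞ φ.symm φ.target ∧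
    ∀ p ∈ φ.source, (φ p).1 = proj p ∧ ∀ g : G, (φ (act p g)).2 = (φ p).2 * g

variable {EG EM EP : Type*}
  [NormedAddCommGroup EG] [NormedSpace ℝ EG] [NormedAddCommGroup EM] [NormedSpace ℝ EM]
  [NormedAddCommGroup EP] [NormedSpace ℝ EP]
  {G M P : Type*} [TopologicalSpace G] [ChartedSpace EG G] [Group G]
  [TopologicalSpace M] [ChartedSpace EM M] [TopologicalSpace P] [ChartedSpace EP P]

/-- The derivative of the right translation `p ↦ p g` of the bundle. -/
def PrincipalBundle.translate (S : PrincipalBundle EG EM EP G M P) (g : G) {p : P}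
    (X : TangentSpace 𝓘(ℝ, EP) p) : TangentSpace 𝓘(ℝ, EP) (S.act p g) :=
  mfderiv 𝓘(ℝ, EP) 𝓘(ℝ, EP) (fun q => S.act q g) p X

/-- The value at `p` of the fundamental vertical vector field of `ξ ∈ 𝔤`. -/
def PrincipalBundle.fundamental (S : PrincipalBundle EG EM EP G M P) (ξ : EG) (p : P) :
    TangentSpace 𝓘(ℝ, EP) (S.act p 1) :=
  mfderiv 𝓘(ℝ, EG) 𝓘(ℝ, EP) (fun g : G => S.act p g) 1 ξ

/-- A principal connection: a smooth `𝔤`-valued `1`-form on `P` that transforms in the adjoint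
representation and reproduces the generators of the action on vertical vectors.  In a local
section `s` the gauge potential is the pullback of this form under `s`. -/
structure PrincipalConnection (S : PrincipalBundle EG EM EP G M P) where
  form : VForm EP P EG 1
  smooth : form.IsSmooth
  equivariant : ∀ (p : P) (g : G) (X : TangentSpace 𝓘(ℝ, EP) p),
    form (S.act p g) ![S.translate g X] = adj g⁻¹ (form p ![X])
  vertical : ∀ (p : P) (ξ : EG), form (S.act p 1) ![S.fundamental ξ p] = ξ

/-- The curvature `F = dω + ½ [ω, ω]` of a principal connection, as a `2`-form on `P`;
`½ [ω, ω] (X, Y) = [ω X, ω Y]`, so that in a local section `F = dA + A ∧ A`. -/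
def PrincipalConnection.curvature {S : PrincipalBundle EG EM EP G M P}
    (A : PrincipalConnection S) (p : P) (X Y : TangentSpace 𝓘(ℝ, EP) p) : EG :=
  A.form.extDer p ![X, Y] + lieBr G (A.form p ![X]) (A.form p ![Y])

/-- A `2`-form `B` on `M` with values in the adjoint bundle, i.e. a `𝔤`-valued `2`-form on `M`
that transforms in the adjoint representation under gauge transformations.  It is given as the
corresponding smooth, horizontal, equivariant `𝔤`-valued `2`-form on `P`: for `p` above `m`, the
value `B p ![X, Y]` is the value of `B` at `m` on the projections of `X` and `Y`, in the frame
`p`. -/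
structure AdjointTwoForm (S : PrincipalBundle EG EM EP G M P) where
  form : VForm EP P EG 2
  smooth : form.IsSmooth
  equivariant : ∀ (p : P) (g : G) (X Y : TangentSpace 𝓘(ℝ, EP) p),
    form (S.act p g) ![S.translate g X, S.translate g Y] = adj g⁻¹ (form p ![X, Y])
  horizontal : ∀ (p : P) (X Y : TangentSpace 𝓘(ℝ, EP) p),
    mfderiv 𝓘(ℝ, EP) 𝓘(ℝ, EM) S.proj p X = 0 → form p ![X, Y] = 0

end Bundles

section Reparametrizations

/-- The parameter square `[0, 2π]²`. -/
def paramSquare : Set (ℝ × ℝ) := Icc 0 (2 * Real.pi) ×ˢ Icc 0 (2 * Real.pi)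

/-- `h` restricts to a diffeomorphism of the square onto itself that is the identity on the
boundary.  A map on the square is smooth if it is the restriction of a smooth map on the plane. -/
def IsSquareDiffeo (h : ℝ × ℝ → ℝ × ℝ) : Prop :=
  ContDiff ℝ ∞ h ∧ MapsTo h paramSquare paramSquare ∧
  (∃ k : ℝ × ℝ → ℝ × ℝ, ContDiff ℝ ∞ k ∧ MapsTo k paramSquare paramSquare ∧
    InvOn k h paramSquare paramSquare) ∧
  ∀ q ∈ frontier paramSquare, h q = q

/-- `h` restricts to a diffeomorphism of the square that is the identity on the boundary and is
connected to the identity by a smooth family of such diffeomorphisms. -/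
def IsReparametrization (h : ℝ × ℝ → ℝ × ℝ) : Prop :=
  IsSquareDiffeo h ∧ ∃ H : ℝ × (ℝ × ℝ) → ℝ × ℝ, ContDiff ℝ ∞ H ∧
    (∀ s ∈ Icc (0 : ℝ) 1, IsSquareDiffeo fun q => H (s, q)) ∧
    (∀ q ∈ paramSquare, H (0, q) = q) ∧ ∀ q ∈ paramSquare, H (1, q) = h q

end Reparametrizations

section LoopSpace

variable {EG EM EP : Type*}
  [NormedAddCommGroup EG] [NormedSpace ℝ EG] [NormedAddCommGroup EM] [NormedSpace ℝ EM]
  [NormedAddCommGroup EP] [NormedSpace ℝ EP]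
  {G M P : Type*} [TopologicalSpace G] [ChartedSpace EG G] [Group G]
  [TopologicalSpace M] [ChartedSpace EM M] [TopologicalSpace P] [ChartedSpace EP P]

/-- `x` is a smooth map on the square that describes a loop `τ ↦ x(·, τ)` in the space
`Ω(M, x₀)` of loops at `x₀`: each `x(·, τ)` starts and ends at `x₀`, and the first and the last
loop agree.  (Only the values of `x` on the square matter.) -/
def IsLoopOfLoops (EM : Type*) [NormedAddCommGroup EM] [NormedSpace ℝ EM] {M : Type*}
    [TopologicalSpace M] [ChartedSpace EM M] (x₀ : M) (x : ℝ × ℝ → M) : Prop :=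
  ContMDiff 𝓘(ℝ, ℝ × ℝ) 𝓘(ℝ, EM) ∞ x ∧
  (∀ τ ∈ Icc 0 (2 * Real.pi), x (0, τ) = x₀ ∧ x (2 * Real.pi, τ) = x₀) ∧
  ∀ σ ∈ Icc 0 (2 * Real.pi), x (σ, 0) = x (σ, 2 * Real.pi)

/-- `y` is the (unique) lift of `x` to `P` whose curves `y(·, τ)` are the horizontal lifts of the
loops `x(·, τ)` that start at the point `p₀` above the basepoint.  In a local section `s` it is
`y(σ, τ) = s(x(σ, τ)) W(σ, τ)` with `∂W/∂σ + A(∂x/∂σ) W = 0`, so `W(·, τ)` is parallel transport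
along `x(·, τ)`. -/
def IsHorizontalLift {S : PrincipalBundle EG EM EP G M P} (A : PrincipalConnection S) (p₀ : P)
    (x : ℝ × ℝ → M) (y : ℝ × ℝ → P) : Prop :=
  ContMDiff 𝓘(ℝ, ℝ × ℝ) 𝓘(ℝ, EP) ∞ y ∧
  (∀ q ∈ paramSquare, S.proj (y q) = x q) ∧
  (∀ τ ∈ Icc 0 (2 * Real.pi), y (0, τ) = p₀) ∧
  ∀ σ ∈ Icc 0 (2 * Real.pi), ∀ τ ∈ Icc 0 (2 * Real.pi),
    A.form (y (σ, τ)) ![dSigma EP y σ τ] = 0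

/-- `F^W(∂x/∂σ, ∂x/∂τ)` at `(σ, τ)`: the curvature of `A`, evaluated on the tangent vectors of the
surface `x` and parallel transported back along `x(·, τ)` to the basepoint.  Here `y` is the
horizontal lift of `x`; as `F` is horizontal and equivariant, its value at `y(σ, τ)` on lifts of
the two tangent vectors is exactly `W⁻¹ F(∂x/∂σ, ∂x/∂τ) W`. -/
def curvW {S : PrincipalBundle EG EM EP G M P} (A : PrincipalConnection S) (y : ℝ × ℝ → P)
    (σ τ : ℝ) : EG :=
  A.curvature (y (σ, τ)) (dSigma EP y σ τ) (dTau EP y σ τ)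

/-- `B^W(∂x/∂σ, ∂x/∂τ)` at `(σ, τ)`, likewise. -/
def formW {S : PrincipalBundle EG EM EP G M P} (B : AdjointTwoForm S) (y : ℝ × ℝ → P)
    (σ τ : ℝ) : EG :=
  B.form (y (σ, τ)) ![dSigma EP y σ τ, dTau EP y σ τ]

/-- The connection `𝒜[γ] = ∫ dσ W(σ)⁻¹ B(dx/dσ, δx(σ)) W(σ)` on the loop space, at the loop `γ`
with horizontal lift `c` and on the tangent vector `δx` at `γ` (a vector field along `γ`), which
is given through any lift `Y` of it to a vector field along `c`. -/
def loopConnection {S : PrincipalBundle EG EM EP G M P} (B : AdjointTwoForm S) (c : ℝ → P)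
    (Y : ∀ σ, TangentSpace 𝓘(ℝ, EP) (c σ)) : EG :=
  ∫ σ in (0 : ℝ)..(2 * Real.pi),
    B.form (c σ) ![(mfderiv 𝓘(ℝ, ℝ) 𝓘(ℝ, EP) c σ (1 : ℝ) : TangentSpace 𝓘(ℝ, EP) (c σ)), Y σ]

/-- `g` is the holonomy of the loop of loops `x` for the connection `𝒜`: `g = W(2π)`, where
`dW/dτ + 𝒜(∂x/∂τ) W = 0` on `[0, 2π]` and `W(0) = 1`.  The product of a Lie algebra element with
`W` is its image under the derivative of right multiplication by `W`. -/
def HasHolonomy {S : PrincipalBundle EG EM EP G M P} (A : PrincipalConnection S)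
    (B : AdjointTwoForm S) (p₀ : P) (x : ℝ × ℝ → M) (g : G) : Prop :=
  ∃ y : ℝ × ℝ → P, IsHorizontalLift A p₀ x y ∧ ∃ W : ℝ → G, W 0 = 1 ∧ W (2 * Real.pi) = g ∧
    ∀ τ ∈ Icc 0 (2 * Real.pi),
      HasMFDerivWithinAt 𝓘(ℝ, ℝ) 𝓘(ℝ, EG) W (Icc 0 (2 * Real.pi)) τ
        (ContinuousLinearMap.toSpanSingleton ℝ
          (mfderiv 𝓘(ℝ, EG) 𝓘(ℝ, EG) (fun h : G => h * W τ) 1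
            (-loopConnection B (fun σ => y (σ, τ)) (fun σ => dTau EP y σ τ) : EG) : EG))

/-- The connection `𝒜` on `Ω(M, x₀)` (with `x₀` the projection of `p₀`) is `r`-flat: every loop of
loops has the same holonomy as each of its reparametrizations. -/
def IsRFlat {S : PrincipalBundle EG EM EP G M P} (A : PrincipalConnection S)
    (B : AdjointTwoForm S) (p₀ : P) : Prop :=
  ∀ x : ℝ × ℝ → M, IsLoopOfLoops EM (S.proj p₀) x →
    ∀ h : ℝ × ℝ → ℝ × ℝ, IsReparametrization h →
      ∃ g : G, HasHolonomy A B p₀ x g ∧ HasHolonomy A B p₀ (x ∘ h) g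

/-- The Heaviside step function (its value at `0` plays no role). -/
def stepFn (t : ℝ) : ℝ := if 0 < t then 1 else 0

end LoopSpace

end

/-! Let `y` be the lift of a loop of loops whose σ-curves are horizontal. Along `y` the geometry
becomes three 𝔤-valued functions on the square: b = B^W, f = F^W, and α = A(∂y/∂τ). Since A(∂y/∂σ) =
0 and y(0, τ) is fixed, ∂α/∂σ = f and α(0, τ) = 0, so α is the σ-primitive of f. The holonomy is the
endpoint of V' = -aV, where a(τ) = ∫ b dσ.

Deform the surface by maps H_s of the square, with velocity v = (v₁, v₂) at a parameter where H_s =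
id. The surface y∘H_s is no longer horizontal in σ. A gauge transformation g with ∂g/∂σ =
-A(∂(y∘H)/∂σ) g repairs this, and B on the corrected surface is Ad(g⁻¹)(det DH · b∘H). Its
s-derivative is ∂(v₁b)/∂σ + ∂(v₂b)/∂τ - [U, b] + v₂[α, b], where ∂U/∂σ = v₂f and U = 0 at σ = 0
(`hasDerivAt_gaugeVelocity`, `fderiv_formFamily`). Integration over σ removes v₁, turns the second
term into Y' with Y = ∫ v₂b dσ, and moves the derivative off U by parts
(`integral_fderiv_formFamily`).

By the Maurer-Cartan equation (`ContMDiffAt.fderiv_rd_sub`), ρ = (∂W/∂s)W⁻¹ satisfies ρ' = -∂a/∂s +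
[ρ, a]. Adding Y to ρ absorbs the total derivative, and Y vanishes at both ends. Hence, up to Ad,
the variation of the holonomy is -∬ v₂ Ad(V⁻¹)K, where K = [α, b] - [f, β(2π) - β] + [b, β(2π)] and
β is the σ-primitive of b (`variation_formula`, `IsHorizontalLift.exists_holonomy_family`).
Splitting the θ-integral of the theorem at σ' = σ and using antisymmetry of the bracket shows that
it equals K (`integral_stepFn_lieBr_eq_obstruction`).

If K vanishes for every loop of loops, the holonomy is stationary at each stage of an isotopy,
because every stage x∘H_s is itself a loop of loops and H_r = H_s∘(H_s⁻¹∘H_r); so it is constant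
(`isRFlat_of_obstruction_eq_zero`). Conversely, r-flatness makes the variation zero for every bump
function v₂ supported in the open square, and the fundamental lemma of the calculus of variations
gives K = 0 (`IsRFlat.obstruction_eq_zero`).

The rest is analytic groundwork: smooth dependence of flows on initial data (`hasLocalFlow`), linear
equations in a Lie group with parameters (`exists_group_solution`), and horizontal lifts of families
of curves (`PrincipalConnection.exists_lift`). -/

noncomputable section

/-! ### Local flows of smooth vector fields and their regularity in the initial point. -/

section Flow

lemma gronwallBound_mul_sq_le {δ K ε x : ℝ} (hK : 0 ≤ K) (hx0 : 0 ≤ x) (hx : x ≤ 1) (hδ : 0 ≤ δ)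
    (hε : 0 ≤ ε) : gronwallBound δ K ε x ≤ (δ + ε) * Real.exp (K + 1) := by
  -- Passing to K + 1 > 0 avoids the separate formula for the Gronwall bound at K = 0.
  have h1 : gronwallBound δ K ε x ≤ gronwallBound δ (K + 1) ε x := by
    have h := le_gronwallBound_of_liminf_deriv_right_le (f := gronwallBound δ K ε)
      (f' := fun x => K * gronwallBound δ K ε x + ε) (δ := δ) (K := K + 1) (ε := ε) (a := 0) (b := 1)
      (fun t _ => (hasDerivAt_gronwallBound δ K ε t).continuousAt.continuousWithinAt)
      (fun t _ r hr => (hasDerivAt_gronwallBound δ K ε t).hasDerivWithinAt.liminf_right_slope_le hr)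
      (by rw [gronwallBound_x0]) (fun t ht => by
        have : 0 ≤ gronwallBound δ K ε t := by
          have := gronwallBound_mono hδ hε hK (K := K) ht.1
          rw [gronwallBound_x0] at this
          exact hδ.trans this
        nlinarith) x ⟨hx0, hx⟩
    simpa using h
  refine h1.trans ?_
  rw [gronwallBound_of_K_ne_0 (by positivity)]
  have h2 : Real.exp ((K + 1) * x) ≤ Real.exp (K + 1) := by
    apply Real.exp_le_exp.2; nlinarith
  have h3 : (1 : ℝ) ≤ Real.exp ((K + 1) * x) := Real.one_le_exp (by positivity)
  have h4 : ε / (K + 1) ≤ ε := div_le_self hε (by linarith)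
  have h5 : ε / (K + 1) * (Real.exp ((K + 1) * x) - 1) ≤ ε * Real.exp (K + 1) := by
    apply mul_le_mul h4 (by linarith) (by linarith) hε
  nlinarith

variable {E : Type*} [NormedAddCommGroup E] [NormedSpace ℝ E]

/-- A two-sided Gronwall estimate. -/
lemma norm_le_of_norm_deriv_le {f f' : ℝ → E} {r K δ ε : ℝ} (hr : r ≤ 1) (hK : 0 ≤ K)
    (hδ : 0 ≤ δ) (hε : 0 ≤ ε)
    (hf : ∀ t ∈ Ioo (-r) r, HasDerivAt f (f' t) t) (h0 : ‖f 0‖ ≤ δ)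
    (hb : ∀ t ∈ Ioo (-r) r, ‖f' t‖ ≤ K * ‖f t‖ + ε) {t : ℝ} (ht : t ∈ Ioo (-r) r) :
    ‖f t‖ ≤ (δ + ε) * Real.exp (K + 1) := by
  have key : ∀ (g g' : ℝ → E), (∀ t ∈ Ioo (-r) r, HasDerivAt g (g' t) t) → ‖g 0‖ ≤ δ →
      (∀ t ∈ Ioo (-r) r, ‖g' t‖ ≤ K * ‖g t‖ + ε) → ∀ t ∈ Ioo (-r) r, 0 ≤ t →
      ‖g t‖ ≤ (δ + ε) * Real.exp (K + 1) := by
    intro g g' hg hg0 hgb t ht h0t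
    have hsub : ∀ s ∈ Icc 0 t, s ∈ Ioo (-r) r := fun s hs =>
      ⟨by linarith [hs.1, ht.1, ht.2], by linarith [hs.2, ht.2]⟩
    have := norm_le_gronwallBound_of_norm_deriv_right_le (f := g) (f' := g') (δ := δ) (K := K)
      (ε := ε) (a := 0) (b := t)
      (fun s hs => (hg s (hsub s hs)).continuousAt.continuousWithinAt)
      (fun s hs => (hg s (hsub s (Ico_subset_Icc_self hs))).hasDerivWithinAt) hg0
      (fun s hs => hgb s (hsub s (Ico_subset_Icc_self hs))) t ⟨h0t, le_rfl⟩
    rw [sub_zero] at this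
    exact this.trans (gronwallBound_mul_sq_le hK h0t (by linarith [ht.2]) hδ hε)
  rcases le_total 0 t with h | h
  · exact key f f' hf h0 hb t ht h
  · have hneg : ∀ s ∈ Ioo (-r) r, -s ∈ Ioo (-r) r := fun s hs =>
      ⟨by linarith [hs.2], by linarith [hs.1]⟩
    have := key (fun s => f (-s)) (fun s => -f' (-s)) (fun s hs => by
        simpa [Function.comp_def] using (hf (-s) (hneg s hs)).scomp s (hasDerivAt_neg s)) (by simpa using h0)
      (fun s hs => by simpa using hb (-s) (hneg s hs)) (-t) (hneg t ht) (by linarith)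
    simpa using this

/-- A local flow of the vector field `v`, of class `C^n`, near `z₀` and inside `U`. -/
def HasLocalFlow (n : ℕ∞ω) (v : E → E) (z₀ : E) (U : Set E) : Prop :=
  ∃ ε > 0, ∃ Φ : E × ℝ → E,
    (∀ z ∈ Metric.ball z₀ ε, Φ (z, 0) = z ∧ ∀ t ∈ Ioo (-ε) ε, Φ (z, t) ∈ U ∧
      HasDerivAt (fun s => Φ (z, s)) (v (Φ (z, t))) t) ∧
    ContDiffOn ℝ n Φ (Metric.ball z₀ ε ×ˢ Ioo (-ε) ε)

/-- Base case of the regularity induction: Picard-Lindelöf yields a jointly continuous flow, and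
continuity at (z₀, 0) allows shrinking until it stays in `U`. -/
lemma hasLocalFlow_zero [CompleteSpace E] {v : E → E} {z₀ : E} {U : Set E} (hU : IsOpen U) (hz : z₀ ∈ U)
    (hv : ContDiffOn ℝ ∞ v U) : HasLocalFlow 0 v z₀ U := by
  have hv1 : ContDiffAt ℝ 1 v z₀ := (hv.contDiffAt (hU.mem_nhds hz)).of_le (by exact_mod_cast le_top)
  obtain ⟨ε, hε, a, r, L, K, hr, hpl⟩ := IsPicardLindelof.of_contDiffAt_one hv1
  obtain ⟨Φ, hΦ, hc⟩ :=
    (hpl 0).exists_forall_mem_closedBall_eq_hasDerivWithinAt_continuousOn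
  have hr' : (0 : ℝ) < r := hr
  have hmem : Metric.ball z₀ r ×ˢ Ioo (-ε) ε ∈ 𝓝 (z₀, (0 : ℝ)) :=
    prod_mem_nhds (Metric.ball_mem_nhds _ hr') (Ioo_mem_nhds (by linarith) hε)
  have hc' : ContinuousOn Φ (Metric.ball z₀ r ×ˢ Ioo (-ε) ε) := hc.mono
    (prod_mono Metric.ball_subset_closedBall (by simpa using Ioo_subset_Icc_self))
  have hcat : ContinuousAt Φ (z₀, 0) := hc'.continuousAt hmem
  have h0 : Φ (z₀, 0) = z₀ := (hΦ z₀ (Metric.mem_closedBall_self r.2)).1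
  have hpre : Φ ⁻¹' U ∈ 𝓝 (z₀, (0 : ℝ)) := hcat (by rw [h0]; exact hU.mem_nhds hz)
  obtain ⟨δ, hδ, hsub⟩ := Metric.mem_nhds_iff.1 (Filter.inter_mem hpre hmem)
  have hsub' : ∀ z ∈ Metric.ball z₀ δ, ∀ t ∈ Ioo (-δ) δ,
      Φ (z, t) ∈ U ∧ z ∈ Metric.ball z₀ r ∧ t ∈ Ioo (-ε) ε := by
    intro z hz t ht
    have : (z, t) ∈ Metric.ball (z₀, (0 : ℝ)) δ := by
      rw [← ball_prod_same]
      exact ⟨hz, by rw [Real.ball_eq_Ioo]; simpa using ht⟩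
    exact ⟨(hsub this).1, (hsub this).2⟩
  refine ⟨δ, hδ, Φ, fun z hz => ⟨?_, fun t ht => ⟨(hsub' z hz t ht).1, ?_⟩⟩, ?_⟩
  · exact (hΦ z (Metric.ball_subset_closedBall (hsub' z hz 0 (by simp [hδ])).2.1)).1
  · obtain ⟨-, h2, h3⟩ := hsub' z hz t ht
    refine ((hΦ z (Metric.ball_subset_closedBall h2)).2 t ?_).hasDerivAt (Icc_mem_nhds ?_ ?_)
    · exact ⟨by linarith [h3.1], by linarith [h3.2]⟩
    · linarith [h3.1]
    · linarith [h3.2]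
  · rw [contDiffOn_zero]
    refine hc'.mono ?_
    rintro ⟨z, t⟩ ⟨hz, ht⟩
    exact ⟨(hsub' z hz t ht).2.1, (hsub' z hz t ht).2.2⟩

lemma HasLocalFlow.shrink {n : ℕ∞ω} {v : E → E} {z₀ : E} {U V : Set E}
    (h : HasLocalFlow n v z₀ U) (hV : IsOpen V) (hz : z₀ ∈ V) {r : ℝ} (hr : 0 < r) :
    ∃ ε > 0, ε ≤ r ∧ ∃ Φ : E × ℝ → E,
    (∀ z ∈ Metric.ball z₀ ε, Φ (z, 0) = z ∧ ∀ t ∈ Ioo (-ε) ε, Φ (z, t) ∈ U ∩ V ∧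
      HasDerivAt (fun s => Φ (z, s)) (v (Φ (z, t))) t) ∧
    ContDiffOn ℝ n Φ (Metric.ball z₀ ε ×ˢ Ioo (-ε) ε) := by
  obtain ⟨ε, hε, Φ, hΦ, hc⟩ := h
  have hmem : Metric.ball z₀ ε ×ˢ Ioo (-ε) ε ∈ 𝓝 (z₀, (0 : ℝ)) :=
    prod_mem_nhds (Metric.ball_mem_nhds _ hε) (Ioo_mem_nhds (by linarith) hε)
  have hpre : Φ ⁻¹' V ∈ 𝓝 (z₀, (0 : ℝ)) := (hc.continuousOn.continuousAt hmem) (by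
    rw [(hΦ z₀ (Metric.mem_ball_self hε)).1]; exact hV.mem_nhds hz)
  obtain ⟨δ, hδ, hsub⟩ := Metric.mem_nhds_iff.1 hpre
  have h1 : min (min δ ε) r ≤ ε := (min_le_left _ _).trans (min_le_right _ _)
  have h2 : min (min δ ε) r ≤ δ := (min_le_left _ _).trans (min_le_left _ _)
  have hIoo : ∀ t ∈ Ioo (-min (min δ ε) r) (min (min δ ε) r), t ∈ Ioo (-ε) ε ∧ t ∈ Ioo (-δ) δ :=
    fun t ht => ⟨⟨by linarith [ht.1], by linarith [ht.2]⟩, ⟨by linarith [ht.1], by linarith [ht.2]⟩⟩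
  refine ⟨min (min δ ε) r, lt_min (lt_min hδ hε) hr, min_le_right _ _, Φ, fun z hz => ?_,
    hc.mono (prod_mono (Metric.ball_subset_ball h1) fun t ht => (hIoo t ht).1)⟩
  obtain ⟨h3, h4⟩ := hΦ z (Metric.ball_subset_ball h1 hz)
  refine ⟨h3, fun t ht => ⟨⟨(h4 t (hIoo t ht).1).1, hsub ?_⟩, (h4 t (hIoo t ht).1).2⟩⟩
  rw [← ball_prod_same]
  exact ⟨Metric.ball_subset_ball h2 hz, by rw [Real.ball_eq_Ioo]; simpa using (hIoo t ht).2⟩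

/-- The flow of a smooth vector field and the flow of its linearization: if the pair is jointly
continuous, then the second is the derivative of the first. -/
lemma hasFDerivAt_flow {v : E → E} {ρ r K M : ℝ} {c : E} {B : Set E} (hB : IsOpen B) (hr1 : r ≤ 1)
    (hK : 0 ≤ K) (hM : 0 ≤ M) (hvd : ∀ z ∈ Metric.ball c ρ, DifferentiableAt ℝ v z)
    (hv1 : ∀ z ∈ Metric.ball c ρ, ‖fderiv ℝ v z‖ ≤ K)
    (hv2 : ∀ z ∈ Metric.ball c ρ, ∀ w ∈ Metric.ball c ρ, ‖fderiv ℝ v z - fderiv ℝ v w‖ ≤ M * ‖z - w‖)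
    {Φ : E → ℝ → E} {η : E → ℝ → E →L[ℝ] E}
    (hΦ0 : ∀ z ∈ B, Φ z 0 = z) (hΦm : ∀ z ∈ B, ∀ t ∈ Ioo (-r) r, Φ z t ∈ Metric.ball c ρ)
    (hΦ : ∀ z ∈ B, ∀ t ∈ Ioo (-r) r, HasDerivAt (Φ z) (v (Φ z t)) t)
    (hη0 : ∀ z ∈ B, η z 0 = ContinuousLinearMap.id ℝ E)
    (hη : ∀ z ∈ B, ∀ t ∈ Ioo (-r) r, HasDerivAt (η z) ((fderiv ℝ v (Φ z t)).comp (η z t)) t)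
    {z : E} (hz : z ∈ B) {t : ℝ} (ht : t ∈ Ioo (-r) r) :
    HasFDerivAt (fun w => Φ w t) (η z t) z := by
  set C := Real.exp (K + 1) with hC
  have hC0 : 0 < C := Real.exp_pos _
  have hlip : ∀ a ∈ Metric.ball c ρ, ∀ b ∈ Metric.ball c ρ, ‖v a - v b‖ ≤ K * ‖a - b‖ :=
    fun a ha b hb => (convex_ball c ρ).norm_image_sub_le_of_norm_fderiv_le (𝕜 := ℝ) hvd hv1 hb ha
  -- A Lipschitz derivative makes the first-order Taylor remainder quadratic; the sharp factor 1/2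
  -- is not needed.
  have htay : ∀ a ∈ Metric.ball c ρ, ∀ b ∈ Metric.ball c ρ,
      ‖v b - v a - fderiv ℝ v a (b - a)‖ ≤ M * ‖b - a‖ * ‖b - a‖ := by
    intro a ha b hb
    have hseg : segment ℝ a b ⊆ Metric.ball c ρ := (convex_ball c ρ).segment_subset ha hb
    refine (convex_segment a b).norm_image_sub_le_of_norm_fderiv_le' (𝕜 := ℝ)
      (fun x hx => hvd x (hseg hx)) (fun x hx => ?_) (left_mem_segment _ _ _)
      (right_mem_segment _ _ _)
    refine (hv2 x (hseg hx) a ha).trans (mul_le_mul_of_nonneg_left ?_ hM)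
    obtain ⟨θ, hθ, rfl⟩ := (segment_eq_image' ℝ a b) ▸ hx
    rw [add_sub_cancel_left, norm_smul, Real.norm_of_nonneg hθ.1]
    exact mul_le_of_le_one_left (norm_nonneg _) hθ.2
  have hD : ∀ w ∈ B, ∀ s ∈ Ioo (-r) r, ‖Φ w s - Φ z s‖ ≤ ‖w - z‖ * C := by
    intro w hw s hs
    have := norm_le_of_norm_deriv_le (f := fun s => Φ w s - Φ z s) (ε := 0) (δ := ‖w - z‖) hr1 hK
      (norm_nonneg _) le_rfl (fun s hs => (hΦ w hw s hs).sub (hΦ z hz s hs))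
      (by rw [hΦ0 w hw, hΦ0 z hz])
      (fun s hs => by
        rw [add_zero]; exact hlip _ (hΦm w hw s hs) _ (hΦm z hz s hs)) hs
    simpa using this
  -- The error of the linear approximation starts at 0 and solves the linearized equation up to the
  -- Taylor remainder, which is quadratic in w - z by `hD`. Gronwall then bounds the error
  -- quadratically.
  have hR : ∀ w ∈ B, ‖Φ w t - Φ z t - η z t (w - z)‖ ≤ (M * C * C * C) * ‖w - z‖ ^ 2 := by
    intro w hw
    have := norm_le_of_norm_deriv_le (f := fun s => Φ w s - Φ z s - η z s (w - z)) (δ := 0)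
      (ε := M * (‖w - z‖ * C) * (‖w - z‖ * C)) hr1 hK le_rfl (by positivity)
      (fun s hs => ((hΦ w hw s hs).sub (hΦ z hz s hs)).sub
        ((hη z hz s hs).clm_apply (hasDerivAt_const s (w - z))))
      (by rw [hΦ0 w hw, hΦ0 z hz, hη0 z hz]; simp)
      (fun s hs => by
        have e : v (Φ w s) - v (Φ z s) - ((fderiv ℝ v (Φ z s)).comp (η z s) (w - z) + η z s 0)
            = (v (Φ w s) - v (Φ z s) - fderiv ℝ v (Φ z s) (Φ w s - Φ z s)) +
              fderiv ℝ v (Φ z s) (Φ w s - Φ z s - η z s (w - z)) := by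
          simp [map_sub]
        rw [e, add_comm]
        refine (norm_add_le _ _).trans (add_le_add ?_ ?_)
        · refine (ContinuousLinearMap.le_opNorm _ _).trans ?_
          exact mul_le_mul_of_nonneg_right (hv1 _ (hΦm z hz s hs)) (norm_nonneg _)
        · refine (htay _ (hΦm z hz s hs) _ (hΦm w hw s hs)).trans ?_
          have h1 := hD w hw s hs
          gcongr) ht
    refine this.trans (le_of_eq ?_)
    rw [← hC]; ring
  rw [hasFDerivAt_iff_isLittleO]
  have hO : (fun w => Φ w t - Φ z t - η z t (w - z)) =O[𝓝 z] fun w => ‖w - z‖ ^ 2 := by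
    refine Asymptotics.IsBigO.of_bound (M * C * C * C) ?_
    filter_upwards [hB.mem_nhds hz] with w hw
    simpa using hR w hw
  refine hO.trans_isLittleO ?_
  have := (Asymptotics.isLittleO_pow_sub_sub z (one_lt_two (α := ℕ)))
  exact this

/-- The linearized system on E × End(E), started at (z, id), has the solution (Φ, D_zΦ). If this
pair is C^n, then both partial derivatives of Φ, namely D_zΦ and v∘Φ, are C^n, so Φ gains one order
of differentiability. -/
lemma HasLocalFlow.of_linearization {n : ℕ} {v : E → E} {z₀ : E} {U : Set E} (hU : IsOpen U)
    (hz₀ : z₀ ∈ U) (hv : ContDiffOn ℝ ∞ v U)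
    (h : HasLocalFlow n
      (fun p : E × (E →L[ℝ] E) => (v p.1, (fderiv ℝ v p.1).comp p.2))
      (z₀, ContinuousLinearMap.id ℝ E) (U ×ˢ univ)) :
    HasLocalFlow (n + 1 : ℕ) v z₀ U := by
  have hdv : ContDiffOn ℝ ∞ (fderiv ℝ v) U := hv.fderiv_of_isOpen hU (by simp)
  have hd2v : ContDiffOn ℝ ∞ (fderiv ℝ (fderiv ℝ v)) U := hdv.fderiv_of_isOpen hU (by simp)
  have hc1 : ContinuousAt (fun z => ‖fderiv ℝ v z‖) z₀ :=
    (hdv.continuousOn.continuousAt (hU.mem_nhds hz₀)).norm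
  have hc2 : ContinuousAt (fun z => ‖fderiv ℝ (fderiv ℝ v) z‖) z₀ :=
    (hd2v.continuousOn.continuousAt (hU.mem_nhds hz₀)).norm
  obtain ⟨ρ, hρ, hball⟩ := Metric.mem_nhds_iff.1 (Filter.inter_mem (hU.mem_nhds hz₀)
    (Filter.inter_mem (hc1.eventually (gt_mem_nhds (lt_add_one _)))
      (hc2.eventually (gt_mem_nhds (lt_add_one _)))))
  set K := ‖fderiv ℝ v z₀‖ + 1
  set M := ‖fderiv ℝ (fderiv ℝ v) z₀‖ + 1
  have hbU : ∀ z ∈ Metric.ball z₀ ρ, z ∈ U := fun z hz => (hball hz).1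
  obtain ⟨ε, hε, hε1, Ψ, hΨ, hc⟩ := h.shrink (Metric.isOpen_ball.prod isOpen_univ)
    (V := Metric.ball z₀ ρ ×ˢ (univ : Set (E →L[ℝ] E))) ⟨Metric.mem_ball_self hρ, mem_univ _⟩
    one_pos
  have hin : ∀ z ∈ Metric.ball z₀ ε, (z, ContinuousLinearMap.id ℝ E) ∈
      Metric.ball (z₀, ContinuousLinearMap.id ℝ E) ε := fun z hz => by
    rw [← ball_prod_same]; exact ⟨hz, Metric.mem_ball_self hε⟩
  set Φ : E → ℝ → E := fun z t => (Ψ ((z, ContinuousLinearMap.id ℝ E), t)).1 with hΦdef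
  set η : E → ℝ → E →L[ℝ] E := fun z t => (Ψ ((z, ContinuousLinearMap.id ℝ E), t)).2 with hηdef
  have hΦd : ∀ z ∈ Metric.ball z₀ ε, ∀ t ∈ Ioo (-ε) ε, HasDerivAt (Φ z) (v (Φ z t)) t :=
    fun z hz t ht => (((hΨ _ (hin z hz)).2 t ht).2).fst
  have hηd : ∀ z ∈ Metric.ball z₀ ε, ∀ t ∈ Ioo (-ε) ε,
      HasDerivAt (η z) ((fderiv ℝ v (Φ z t)).comp (η z t)) t :=
    fun z hz t ht => (((hΨ _ (hin z hz)).2 t ht).2).snd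
  have hΦm : ∀ z ∈ Metric.ball z₀ ε, ∀ t ∈ Ioo (-ε) ε, Φ z t ∈ Metric.ball z₀ ρ :=
    fun z hz t ht => ((hΨ _ (hin z hz)).2 t ht).1.2.1
  have hΦη : ContDiffOn ℝ n (fun p : E × ℝ => Ψ ((p.1, ContinuousLinearMap.id ℝ E), p.2))
      (Metric.ball z₀ ε ×ˢ Ioo (-ε) ε) := by
    refine hc.comp (by fun_prop) ?_
    rintro ⟨z, t⟩ ⟨hz, ht⟩
    exact ⟨hin z hz, ht⟩
  have hopen : IsOpen (Metric.ball z₀ ε ×ˢ Ioo (-ε) ε) := Metric.isOpen_ball.prod isOpen_Ioo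
  have hΦc : ContDiffOn ℝ n (fun p : E × ℝ => Φ p.1 p.2) (Metric.ball z₀ ε ×ˢ Ioo (-ε) ε) :=
    hΦη.fst
  have hηc : ContDiffOn ℝ n (fun p : E × ℝ => η p.1 p.2) (Metric.ball z₀ ε ×ˢ Ioo (-ε) ε) :=
    hΦη.snd
  have hvΦ : ContDiffOn ℝ n (fun p : E × ℝ => v (Φ p.1 p.2)) (Metric.ball z₀ ε ×ˢ Ioo (-ε) ε) := by
    refine (hv.of_le (by exact_mod_cast le_top)).comp hΦc ?_
    rintro ⟨z, t⟩ ⟨hz, ht⟩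
    exact hbU _ (hΦm z hz t ht)
  have hderiv : ∀ p ∈ Metric.ball z₀ ε ×ˢ Ioo (-ε) ε, HasFDerivAt (fun p : E × ℝ => Φ p.1 p.2)
      ((η p.1 p.2).coprod (ContinuousLinearMap.toSpanSingleton ℝ (v (Φ p.1 p.2)))) p := by
    intro p hp
    have hp' := hopen.mem_nhds hp
    -- Partial derivatives that exist nearby and are continuous at the point combine into a total
    -- derivative.
    have := hasStrictFDerivAt_uncurry_coprod (𝕜 := ℝ) (u := p) (f := Φ) (f₁ := η)
      (f₂ := fun z t => ContinuousLinearMap.toSpanSingleton ℝ (v (Φ z t)))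
      (by
        filter_upwards [hp'] with q hq
        exact hasFDerivAt_flow Metric.isOpen_ball (K := K) (M := M) hε1 (by positivity)
          (by positivity)
          (fun z hz => ((hv.contDiffAt (hU.mem_nhds (hbU z hz))).differentiableAt (by simp)))
          (fun z hz => (hball hz).2.1.le)
          (fun z hz w hw => (convex_ball z₀ ρ).norm_image_sub_le_of_norm_fderiv_le (𝕜 := ℝ)
            (fun x hx => (hdv.contDiffAt (hU.mem_nhds (hbU x hx))).differentiableAt (by simp))
            (fun x hx => (hball hx).2.2.le) hw hz)
          (fun z hz => by simp [hΦdef, (hΨ _ (hin z hz)).1]) hΦm hΦd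
          (fun z hz => by simp [hηdef, (hΨ _ (hin z hz)).1]) hηd hq.1 hq.2)
      (by
        filter_upwards [hp'] with q hq
        exact (hΦd q.1 hq.1 q.2 hq.2).hasFDerivAt)
      (hηc.continuousOn.continuousAt hp')
      ((ContinuousLinearMap.toSpanSingletonCLE (𝕜 := ℝ) (E := E)).continuous.continuousAt.comp
        (hvΦ.continuousOn.continuousAt hp'))
    exact this.hasFDerivAt
  refine ⟨ε, hε, fun p => Φ p.1 p.2, fun z hz => ⟨by simp [hΦdef, (hΨ _ (hin z hz)).1],
    fun t ht => ⟨hbU _ (hΦm z hz t ht), hΦd z hz t ht⟩⟩, ?_⟩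
  have : ((n + 1 : ℕ) : ℕ∞ω) = (n : ℕ∞ω) + 1 := by norm_cast
  rw [this, contDiffOn_succ_iff_fderiv_of_isOpen hopen]
  refine ⟨fun p hp => (hderiv p hp).differentiableAt.differentiableWithinAt, by simp, ?_⟩
  refine ContDiffOn.congr ?_ fun p hp => (hderiv p hp).fderiv
  have h1 := (ContinuousLinearMap.toSpanSingletonCLE (𝕜 := ℝ) (E := E)).contDiff.comp_contDiffOn hvΦ
  exact (ContinuousLinearMap.coprodEquivL ℝ).contDiff.comp_contDiffOn (hηc.prodMk h1)

/-- The local flow of a smooth vector field is of class `C^n` for each `n`. -/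
theorem hasLocalFlow (n : ℕ) : ∀ {E : Type*} [NormedAddCommGroup E] [NormedSpace ℝ E]
    [CompleteSpace E] {v : E → E} {z₀ : E} {U : Set E}, IsOpen U → z₀ ∈ U → ContDiffOn ℝ ∞ v U →
    HasLocalFlow n v z₀ U := by
  -- The space is quantified inside the claim, because the step for `E` uses the hypothesis on E ×
  -- End(E).
  induction n with
  | zero => intro E _ _ _ v z₀ U hU hz hv; exact hasLocalFlow_zero hU hz hv
  | succ n ih =>
    intro E _ _ _ v z₀ U hU hz hv
    refine HasLocalFlow.of_linearization hU hz hv (ih (hU.prod isOpen_univ) ⟨hz, mem_univ _⟩ ?_)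
    have h1 : ContDiffOn ℝ ∞ (fun p : E × (E →L[ℝ] E) => v p.1) (U ×ˢ univ) :=
      hv.comp contDiffOn_fst fun p hp => hp.1
    have h2 : ContDiffOn ℝ ∞ (fun p : E × (E →L[ℝ] E) => fderiv ℝ v p.1) (U ×ˢ univ) :=
      (hv.fderiv_of_isOpen hU (by simp)).comp contDiffOn_fst fun p hp => hp.1
    exact h1.prodMk (h2.clm_comp contDiffOn_snd)

end Flow

/-! ### Smooth dependence of integrals on parameters. -/

section ParametricIntegral

variable {F : Type} {E : Type*} [NormedAddCommGroup F] [NormedSpace ℝ F] [FiniteDimensional ℝ F]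
  [NormedAddCommGroup E] [NormedSpace ℝ E]

/-- Differentiation under the integral sign; the dominating constant comes from compactness of a
closed ball times the interval of integration. -/
lemma hasFDerivAt_intervalIntegral {f : F × ℝ → E} (hf : ContDiff ℝ 1 f) (a b : ℝ) (p : F) :
    HasFDerivAt (fun p => ∫ t in a..b, f (p, t))
      (∫ t in a..b, (fderiv ℝ f (p, t)).comp (ContinuousLinearMap.inl ℝ F ℝ)) p := by
  have : ProperSpace F := FiniteDimensional.proper_real F
  have hcd : Continuous fun q : F × ℝ => (fderiv ℝ f q).comp (ContinuousLinearMap.inl ℝ F ℝ) :=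
    (hf.continuous_fderiv one_ne_zero).clm_comp continuous_const
  obtain ⟨C, hC⟩ := ((isCompact_closedBall p 1).prod (isCompact_uIcc (a := a) (b := b))).exists_bound_of_continuousOn
    hcd.continuousOn
  refine (intervalIntegral.hasFDerivAt_integral_of_dominated_of_fderiv_le
    (F := fun p t => f (p, t)) (bound := fun _ => C)
    (F' := fun p t => (fderiv ℝ f (p, t)).comp (ContinuousLinearMap.inl ℝ F ℝ))
    (Metric.closedBall_mem_nhds p one_pos) ?_ ?_ ?_ ?_ ?_ ?_)
  · exact Filter.Eventually.of_forall fun q =>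
      (hf.continuous.comp (by fun_prop : Continuous fun t : ℝ => (q, t))).aestronglyMeasurable
  · exact (hf.continuous.comp (by fun_prop : Continuous fun t : ℝ => (p, t))).intervalIntegrable _ _
  · exact (hcd.comp (by fun_prop : Continuous fun t : ℝ => (p, t))).aestronglyMeasurable
  · exact Filter.Eventually.of_forall fun t ht q hq => hC (q, t) ⟨hq, uIoc_subset_uIcc ht⟩
  · exact intervalIntegrable_const
  · refine Filter.Eventually.of_forall fun t ht q hq => ?_
    exact ((hf.differentiable one_ne_zero (q, t)).hasFDerivAt).comp q
      (hasFDerivAt_prodMk_left q t)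

/-- The derivative is again an integral of a smooth integrand, with values in a space of linear
maps; hence the induction is over all target spaces. -/
lemma contDiff_intervalIntegral_nat (n : ℕ) (a b : ℝ) : ∀ {E : Type*} [NormedAddCommGroup E]
    [NormedSpace ℝ E] {f : F × ℝ → E}, ContDiff ℝ ∞ f →
    ContDiff ℝ n fun p => ∫ t in a..b, f (p, t) := by
  induction n with
  | zero =>
    intro E _ _ f hf
    exact contDiff_zero.2 (intervalIntegral.continuous_parametric_intervalIntegral_of_continuous'
      (by exact hf.continuous) a b)
  | succ n ih =>
    intro E _ _ f hf
    have hf1 : ContDiff ℝ 1 f := hf.of_le (by exact_mod_cast le_top)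
    have : ((n + 1 : ℕ) : ℕ∞ω) = (n : ℕ∞ω) + 1 := by norm_cast
    rw [this, contDiff_succ_iff_fderiv]
    refine ⟨fun p => (hasFDerivAt_intervalIntegral hf1 a b p).differentiableAt, by simp, ?_⟩
    rw [show (fderiv ℝ fun p => ∫ t in a..b, f (p, t)) = fun p => ∫ t in a..b,
      (fderiv ℝ f (p, t)).comp (ContinuousLinearMap.inl ℝ F ℝ) from
      funext fun p => (hasFDerivAt_intervalIntegral hf1 a b p).fderiv]
    exact ih (f := fun q => (fderiv ℝ f q).comp (ContinuousLinearMap.inl ℝ F ℝ))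
      ((hf.fderiv_right (by simp)).clm_comp contDiff_const)

lemma contDiff_intervalIntegral {f : F × ℝ → E} (hf : ContDiff ℝ ∞ f) (a b : ℝ) :
    ContDiff ℝ ∞ fun p => ∫ t in a..b, f (p, t) :=
  contDiff_infty.2 fun n => contDiff_intervalIntegral_nat n a b hf

end ParametricIntegral

/-! ### Calculus for group-valued maps through right-trivialized derivatives. -/

section LieCalculus

variable {EG : Type*} [NormedAddCommGroup EG] [NormedSpace ℝ EG]
  {G : Type*} [TopologicalSpace G] [ChartedSpace EG G] [Group G]
  {F : Type*} [NormedAddCommGroup F] [NormedSpace ℝ F]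
  {F' : Type*} [NormedAddCommGroup F'] [NormedSpace ℝ F']

variable (EG) in
/-- The chart of the group around the identity. -/
def lchart (g : G) : EG := extChartAt 𝓘(ℝ, EG) (1 : G) g

variable (G) in
/-- The inverse of the chart of the group around the identity. -/
def lparam (x : EG) : G := (extChartAt 𝓘(ℝ, EG) (1 : G)).symm x

variable (EG G) in
/-- The coordinates of the identity. -/
def lone : EG := lchart EG (1 : G)

@[simp] lemma lchart_one : lchart EG (1 : G) = lone EG G := rfl

@[simp] lemma lparam_lone : lparam G (lone EG G) = 1 :=
  extChartAt_to_inv (I := 𝓘(ℝ, EG)) (1 : G)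

lemma eventually_lparam_lchart : ∀ᶠ g in 𝓝 (1 : G), lparam G (lchart EG g) = g := by
  filter_upwards [extChartAt_source_mem_nhds (I := 𝓘(ℝ, EG)) (1 : G)] with g hg
  exact (extChartAt 𝓘(ℝ, EG) (1 : G)).left_inv hg

variable (EG) in
lemma ContinuousAt.eventually_lparam_lchart {X : Type*} [TopologicalSpace X] {f : X → G} {q : X}
    (h : ContinuousAt f q) (hq : f q = 1) : ∀ᶠ q' in 𝓝 q, lparam G (lchart EG (f q')) = f q' :=
  h.eventually (by rw [hq]; exact _root_.eventually_lparam_lchart (EG := EG))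

lemma eventually_lchart_lparam : ∀ᶠ x in 𝓝 (lone EG G), lchart EG (lparam G x) = x := by
  filter_upwards [extChartAt_target_mem_nhds (I := 𝓘(ℝ, EG)) (1 : G)] with x hx
  exact (extChartAt 𝓘(ℝ, EG) (1 : G)).right_inv hx

lemma continuousAt_lparam : ContinuousAt (lparam G) (lone EG G) :=
  continuousAt_extChartAt_symm (I := 𝓘(ℝ, EG)) (1 : G)

/-- `L` is the derivative of the `G`-valued map `W` at `q`, trivialized by right translations. -/
def HasRD (W : F → G) (L : F →L[ℝ] EG) (q : F) : Prop :=
  ContinuousAt W q ∧ HasFDerivAt (fun q' => lchart EG (W q' * (W q)⁻¹)) L q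

variable (EG) in
/-- The derivative of a `G`-valued map, trivialized by right translations. -/
def rd (W : F → G) (q : F) : F →L[ℝ] EG := fderiv ℝ (fun q' => lchart EG (W q' * (W q)⁻¹)) q

lemma HasRD.rd_eq {W : F → G} {L : F →L[ℝ] EG} {q : F} (h : HasRD W L q) : rd EG W q = L :=
  h.2.fderiv

lemma HasRD.unique {W : F → G} {L L' : F →L[ℝ] EG} {q : F} (h : HasRD W L q)
    (h' : HasRD W L' q) : L = L' := h.2.unique h'.2

lemma HasRD.congr {W V : F → G} {L : F →L[ℝ] EG} {q : F} (h : HasRD W L q) (hV : V =ᶠ[𝓝 q] W) :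
    HasRD V L q := by
  refine ⟨h.1.congr hV.symm, h.2.congr_of_eventuallyEq ?_⟩
  filter_upwards [hV] with q' hq'
  rw [hq', hV.self_of_nhds]

lemma hasRD_const (g : G) (q : F) : HasRD (fun _ : F => g) (0 : F →L[ℝ] EG) q :=
  ⟨continuousAt_const, hasFDerivAt_const _ _⟩

lemma HasRD.comp {W : F → G} {L : F →L[ℝ] EG} {c : F' → F} {c' : F' →L[ℝ] F} {q : F'}
    (h : HasRD W L (c q)) (hc : HasFDerivAt c c' q) : HasRD (fun q => W (c q)) (L.comp c') q :=
  ⟨h.1.comp hc.continuousAt, h.2.comp q hc⟩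

lemma HasRD.mul_const {W : F → G} {L : F →L[ℝ] EG} {q : F} [ContinuousMul G] (h : HasRD W L q)
    (g : G) : HasRD (fun q => W q * g) L q := by
  refine ⟨h.1.mul continuousAt_const, ?_⟩
  convert! h.2 using 3 with q'
  simp [mul_assoc]

/-- The group multiplication in the chart around the identity. -/
def lmul (G : Type*) [TopologicalSpace G] [ChartedSpace EG G] [Group G] (p : EG × EG) : EG :=
  lchart EG (lparam G p.1 * lparam G p.2)

lemma hasFDerivAt_lchart_of_hasMFDerivAt {EN : Type*} [NormedAddCommGroup EN] [NormedSpace ℝ EN]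
    {N : Type*} [TopologicalSpace N] [ChartedSpace EN N] {f : N → G} {x : N} (hx : f x = 1)
    {L : EN →L[ℝ] EG} (h : HasMFDerivAt 𝓘(ℝ, EN) 𝓘(ℝ, EG) f x L) :
    HasFDerivAt (fun z => lchart EG (f ((extChartAt 𝓘(ℝ, EN) x).symm z))) L
      (extChartAt 𝓘(ℝ, EN) x x) := by
  have h1 : HasFDerivWithinAt (𝕜 := ℝ) (E := EN) (F := EG)
    (writtenInExtChartAt 𝓘(ℝ, EN) 𝓘(ℝ, EG) x f) L (range 𝓘(ℝ, EN)) (extChartAt 𝓘(ℝ, EN) x x) := h.2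
  rw [ModelWithCorners.range_eq_univ, hasFDerivWithinAt_univ] at h1
  unfold writtenInExtChartAt at h1
  rw [hx] at h1
  exact h1

lemma hasMFDerivAt_of_hasFDerivAt_lchart {EN : Type*} [NormedAddCommGroup EN] [NormedSpace ℝ EN]
    {N : Type*} [TopologicalSpace N] [ChartedSpace EN N] {f : N → G} {x : N} (hx : f x = 1)
    {L : EN →L[ℝ] EG} (hc : ContinuousAt f x)
    (h : HasFDerivAt (fun z => lchart EG (f ((extChartAt 𝓘(ℝ, EN) x).symm z))) L
      (extChartAt 𝓘(ℝ, EN) x x)) :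
    HasMFDerivAt 𝓘(ℝ, EN) 𝓘(ℝ, EG) f x L := by
  refine ⟨hc, ?_⟩
  suffices h1 : HasFDerivWithinAt (𝕜 := ℝ) (E := EN) (F := EG)
      (writtenInExtChartAt 𝓘(ℝ, EN) 𝓘(ℝ, EG) x f) L (range 𝓘(ℝ, EN)) (extChartAt 𝓘(ℝ, EN) x x) from
    h1
  rw [ModelWithCorners.range_eq_univ, hasFDerivWithinAt_univ]
  unfold writtenInExtChartAt
  rw [hx]
  exact h

variable [LieGroup 𝓘(ℝ, EG) ∞ G]

omit [LieGroup 𝓘(ℝ, EG) ∞ G] in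
variable (EG G) in
lemma topologicalGroup_of_smooth (_h : LieGroup 𝓘(ℝ, EG) ∞ G) : IsTopologicalGroup G :=
  topologicalGroup_of_lieGroup 𝓘(ℝ, EG) ∞

omit [LieGroup 𝓘(ℝ, EG) ∞ G] in
lemma contMDiffAt_lchart : ContMDiffAt 𝓘(ℝ, EG) 𝓘(ℝ, EG) ∞ (lchart EG) (1 : G) :=
  contMDiffAt_extChartAt (I := 𝓘(ℝ, EG)) (x := (1 : G))

lemma contMDiffAt_lparam : ContMDiffAt 𝓘(ℝ, EG) 𝓘(ℝ, EG) ∞ (lparam G) (lone EG G) :=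
  haveI : IsManifold 𝓘(ℝ, EG) ∞ G := LieGroup.toContMDiffMul.toIsManifold
  (contMDiffOn_extChartAt_symm (I := 𝓘(ℝ, EG)) (1 : G)).contMDiffAt
    (extChartAt_target_mem_nhds (I := 𝓘(ℝ, EG)) (1 : G))

omit [LieGroup 𝓘(ℝ, EG) ∞ G] in
lemma ContMDiffAt.lchart_comp {n : ℕ∞ω} (hn : n ≤ ∞) {f : F → G} {q : F}
    (h : ContMDiffAt 𝓘(ℝ, F) 𝓘(ℝ, EG) n f q) (hq : f q = 1) :
    ContDiffAt ℝ n (fun q => lchart EG (f q)) q := by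
  rw [← contMDiffAt_iff_contDiffAt]
  have h1 : ContMDiffAt 𝓘(ℝ, EG) 𝓘(ℝ, EG) n (lchart EG) (f q) := by
    rw [hq]; exact contMDiffAt_lchart.of_le hn
  exact h1.comp q h

lemma ContDiffAt.lparam_comp {n : ℕ∞ω} (hn : n ≤ ∞) {f : F → EG} {q : F} (h : ContDiffAt ℝ n f q)
    (hq : f q = lone EG G) : ContMDiffAt 𝓘(ℝ, F) 𝓘(ℝ, EG) n (fun q => lparam G (f q)) q := by
  rw [← contMDiffAt_iff_contDiffAt] at h
  have h1 : ContMDiffAt 𝓘(ℝ, EG) 𝓘(ℝ, EG) n (lparam G) (f q) := by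
    rw [hq]; exact contMDiffAt_lparam.of_le hn
  exact h1.comp q h

lemma contDiffAt_lmul : ContDiffAt ℝ ∞ (lmul G) (lone EG G, lone EG G) := by
  refine ContMDiffAt.lchart_comp le_rfl ?_ (by simp)
  exact (contDiffAt_fst.lparam_comp le_rfl rfl).mul (contDiffAt_snd.lparam_comp le_rfl rfl)

omit [LieGroup 𝓘(ℝ, EG) ∞ G] in
lemma lmul_lone_right : ∀ᶠ x in 𝓝 (lone EG G), lmul G (x, lone EG G) = x := by
  filter_upwards [eventually_lchart_lparam] with x hx
  simp [lmul, hx]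

omit [LieGroup 𝓘(ℝ, EG) ∞ G] in
lemma lmul_lone_left : ∀ᶠ x in 𝓝 (lone EG G), lmul G (lone EG G, x) = x := by
  filter_upwards [eventually_lchart_lparam] with x hx
  simp [lmul, hx]

/-- The identity is a unit on either side, so both partial derivatives of the multiplication there
are the identity map. -/
lemma hasFDerivAt_lmul : HasFDerivAt (lmul G)
    (ContinuousLinearMap.fst ℝ EG EG + ContinuousLinearMap.snd ℝ EG EG) (lone EG G, lone EG G) := by
  have h := (contDiffAt_lmul (G := G) (EG := EG)).differentiableAt (by simp)
  have h1 : HasFDerivAt (fun x => lmul G (x, lone EG G)) (ContinuousLinearMap.id ℝ EG) (lone EG G) :=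
    (hasFDerivAt_id _).congr_of_eventuallyEq lmul_lone_right
  have h2 : HasFDerivAt (fun x => lmul G (lone EG G, x)) (ContinuousLinearMap.id ℝ EG) (lone EG G) :=
    (hasFDerivAt_id _).congr_of_eventuallyEq lmul_lone_left
  have e1 := (h.hasFDerivAt.comp (f := fun x => (x, lone EG G)) (lone EG G) (hasFDerivAt_prodMk_left (lone EG G) (lone EG G))).unique h1
  have e2 := (h.hasFDerivAt.comp (f := fun x => (lone EG G, x)) (lone EG G) (hasFDerivAt_prodMk_right (lone EG G) (lone EG G))).unique h2
  convert! h.hasFDerivAt using 1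
  ext x
  · simpa using congrArg (fun L => L x) e1.symm
  · simpa using congrArg (fun L => L x) e2.symm

/-- The adjoint representation, as a map to the continuous linear maps. -/
def Adj (g : G) : EG →L[ℝ] EG := mfderiv 𝓘(ℝ, EG) 𝓘(ℝ, EG) (fun h : G => g * h * g⁻¹) 1

lemma contMDiff_conj (g : G) : ContMDiff 𝓘(ℝ, EG) 𝓘(ℝ, EG) ∞ (fun h : G => g * h * g⁻¹) :=
  (contMDiff_const.mul contMDiff_id).mul contMDiff_const

lemma hasMFDerivAt_conj (g : G) :
    HasMFDerivAt 𝓘(ℝ, EG) 𝓘(ℝ, EG) (fun h : G => g * h * g⁻¹) 1 (Adj g : EG →L[ℝ] EG) :=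
  ((contMDiff_conj g).mdifferentiable (by simp) 1).hasMFDerivAt

lemma hasFDerivAt_Adj (g : G) : HasFDerivAt (fun x => lchart EG (g * lparam G x * g⁻¹)) (Adj g)
    (lone EG G) :=
  hasFDerivAt_lchart_of_hasMFDerivAt (by simp) (hasMFDerivAt_conj g)

lemma Adj_mul (g h : G) : (Adj (g * h) : EG →L[ℝ] EG) = (Adj g).comp (Adj h) := by
  have h1 := hasFDerivAt_Adj (EG := EG) h
  have h2 := hasFDerivAt_Adj (EG := EG) g
  rw [← show lchart EG (h * lparam G (lone EG G) * h⁻¹) = lone EG G by simp] at h2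
  have h3 := h2.comp (f := fun x => lchart EG (h * lparam G x * h⁻¹)) (lone EG G) h1
  refine (hasFDerivAt_Adj (EG := EG) (g * h)).unique (h3.congr_of_eventuallyEq ?_)
  have : ContinuousAt (fun x => h * lparam G x * h⁻¹) (lone EG G) := by
    have := topologicalGroup_of_smooth EG G inferInstance
    exact (continuousAt_const.mul continuousAt_lparam).mul continuousAt_const
  have h4 : ∀ᶠ x in 𝓝 (lone EG G), lparam G (lchart EG (h * lparam G x * h⁻¹)) = h * lparam G x * h⁻¹ :=
    this.eventually_lparam_lchart EG (by simp)
  filter_upwards [h4] with x hx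
  simp only [Function.comp, hx]
  simp [mul_assoc]

@[simp] lemma Adj_one : (Adj (1 : G) : EG →L[ℝ] EG) = ContinuousLinearMap.id ℝ EG := by
  refine (hasFDerivAt_Adj (EG := EG) (1 : G)).unique
    ((hasFDerivAt_id _).congr_of_eventuallyEq ?_)
  filter_upwards [eventually_lchart_lparam] with x hx
  simp [hx]

@[simp] lemma Adj_inv_apply_Adj (g : G) (ξ : EG) : Adj g⁻¹ (Adj g ξ) = ξ := by
  rw [← ContinuousLinearMap.comp_apply, ← Adj_mul]; simp

@[simp] lemma Adj_apply_Adj_inv (g : G) (ξ : EG) : Adj g (Adj g⁻¹ ξ) = ξ := by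
  rw [← ContinuousLinearMap.comp_apply, ← Adj_mul]; simp

/-- In the chart, Ad is the partial derivative of the jointly smooth map (z, x) ↦ z x z⁻¹ at x = 1.
-/
lemma contDiffAt_Adj_lparam :
    ContDiffAt ℝ ∞ (fun z => (Adj (lparam G z) : EG →L[ℝ] EG)) (lone EG G) := by
  have h : ContDiffAt ℝ ∞
      (fun p : EG × EG => lchart EG (lparam G p.1 * lparam G p.2 * (lparam G p.1)⁻¹))
      (lone EG G, lone EG G) := by
    refine ContMDiffAt.lchart_comp le_rfl ?_ (by simp)
    exact ((contDiffAt_fst.lparam_comp le_rfl rfl).mul (contDiffAt_snd.lparam_comp le_rfl rfl)).mul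
      (contDiffAt_fst.lparam_comp le_rfl rfl).inv
  have := ContDiffAt.fderiv (f := fun z x => lchart EG (lparam G z * lparam G x * (lparam G z)⁻¹))
    (g := fun _ => lone EG G) (x₀ := lone EG G) (m := ∞) (n := ∞) h contDiffAt_const (by simp)
  refine this.congr_of_eventuallyEq (Filter.Eventually.of_forall fun z => ?_)
  exact (hasFDerivAt_Adj (lparam G z)).fderiv.symm

variable (G) in
/-- The adjoint representation of the Lie algebra: the derivative of `Ad` at the identity. -/
def brk : EG →L[ℝ] EG →L[ℝ] EG := fderiv ℝ (fun z => (Adj (lparam G z) : EG →L[ℝ] EG)) (lone EG G)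

lemma hasFDerivAt_Adj_lparam :
    HasFDerivAt (fun z => (Adj (lparam G z) : EG →L[ℝ] EG)) (brk G) (lone EG G) :=
  (contDiffAt_Adj_lparam.differentiableAt (by simp)).hasFDerivAt

lemma HasRD.eventually {W : F → G} {L : F →L[ℝ] EG} {q : F} (h : HasRD W L q) :
    ∀ᶠ q' in 𝓝 q, lparam G (lchart EG (W q' * (W q)⁻¹)) = W q' * (W q)⁻¹ := by
  have := topologicalGroup_of_smooth EG G inferInstance
  exact (h.1.mul continuousAt_const).eventually_lparam_lchart EG (by simp)

/-- Ad(W q') = Ad(W q' (W q)⁻¹) Ad(W q) moves the differentiation to the identity, where the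
derivative of Ad is `brk`. -/
lemma HasRD.hasFDerivAt_Adj {W : F → G} {L : F →L[ℝ] EG} {q : F} (h : HasRD W L q) :
    HasFDerivAt (fun q => (Adj (W q) : EG →L[ℝ] EG))
      ((((ContinuousLinearMap.compL ℝ EG EG EG).flip (Adj (W q))).comp (brk G)).comp L) q := by
  have h1 := hasFDerivAt_Adj_lparam (G := G) (EG := EG)
  rw [← show lchart EG (W q * (W q)⁻¹) = lone EG G by simp] at h1
  have h2 := ((ContinuousLinearMap.compL ℝ EG EG EG).flip (Adj (W q))).hasFDerivAt.comp q
    (h1.comp q h.2)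
  refine h2.congr_of_eventuallyEq ?_
  filter_upwards [h.eventually] with q' hq'
  simp only [Function.comp, hq', ContinuousLinearMap.flip_apply, ContinuousLinearMap.compL_apply]
  rw [← Adj_mul]; simp

/-- The product rule. -/
lemma HasRD.mul {W V : F → G} {L M : F →L[ℝ] EG} {q : F} (hW : HasRD W L q) (hV : HasRD V M q) :
    HasRD (fun q => W q * V q) (L + (Adj (W q)).comp M) q := by
  have := topologicalGroup_of_smooth EG G inferInstance
  refine ⟨hW.1.mul hV.1, ?_⟩
  have h1 := _root_.hasFDerivAt_Adj (EG := EG) (W q)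
  rw [← show lchart EG (V q * (V q)⁻¹) = lone EG G by simp] at h1
  have h2 := h1.comp q hV.2
  have h3 := hasFDerivAt_lmul (EG := EG) (G := G)
  rw [show (lone EG G, lone EG G) = (lchart EG (W q * (W q)⁻¹),
    lchart EG (W q * lparam G (lchart EG (V q * (V q)⁻¹)) * (W q)⁻¹)) by simp] at h3
  have h4 := HasFDerivAt.comp q h3 (hW.2.prodMk h2)
  refine (h4.congr_of_eventuallyEq ?_).congr_fderiv ?_
  · have h6 : ∀ᶠ q' in 𝓝 q, lparam G (lchart EG (W q * (V q' * (V q)⁻¹) * (W q)⁻¹)) =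
        W q * (V q' * (V q)⁻¹) * (W q)⁻¹ :=
      ((continuousAt_const.mul (hV.1.mul continuousAt_const)).mul continuousAt_const).eventually_lparam_lchart
        EG (by simp)
    filter_upwards [hW.eventually, hV.eventually, h6] with q' h1 h2 h6
    simp only [lmul, Function.comp, h1, h2, h6]
    congr 1
    simp [mul_assoc]
  · ext v; simp

/-- Smoothness of inversion provides some derivative; the product rule applied to W W⁻¹ = 1
identifies it. -/
lemma HasRD.inv {W : F → G} {L : F →L[ℝ] EG} {q : F} (h : HasRD W L q) :
    HasRD (fun q => (W q)⁻¹) (-(Adj (W q)⁻¹).comp L) q := by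
  have := topologicalGroup_of_smooth EG G inferInstance
  have hn : ContDiffAt ℝ ∞ (fun x => lchart EG ((W q)⁻¹ * (lparam G x)⁻¹ * W q)) (lone EG G) := by
    refine ContMDiffAt.lchart_comp le_rfl ?_ (by simp)
    exact (contMDiffAt_const.mul (contDiffAt_id.lparam_comp le_rfl rfl).inv).mul contMDiffAt_const
  obtain ⟨N, hN⟩ : ∃ N, HasFDerivAt (fun x => lchart EG ((W q)⁻¹ * (lparam G x)⁻¹ * W q)) N
    (lone EG G) := ⟨_, (hn.differentiableAt (by simp)).hasFDerivAt⟩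
  rw [← show lchart EG (W q * (W q)⁻¹) = lone EG G by simp] at hN
  have h1 : HasRD (fun q => (W q)⁻¹) (N.comp L) q := by
    refine ⟨h.1.inv, (hN.comp q h.2).congr_of_eventuallyEq ?_⟩
    filter_upwards [h.eventually] with q' hq'
    simp [hq']
  have h2 := h.mul h1
  simp only [mul_inv_cancel] at h2
  have h3 := h2.unique (hasRD_const 1 q)
  convert! h1 using 1
  ext v
  have h4 := congrArg (fun M => Adj (W q)⁻¹ (M v)) h3
  simp only [add_apply, ContinuousLinearMap.comp_apply, map_add,
    Adj_inv_apply_Adj, zero_apply, map_zero] at h4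
  simpa using (neg_eq_of_add_eq_zero_right h4)

lemma ContMDiffAt.hasRD {n : ℕ∞ω} (hn : n ≠ 0) {W : F → G} {q : F}
    (h : ContMDiffAt 𝓘(ℝ, F) 𝓘(ℝ, EG) n W q) : HasRD W (rd EG W q) q := by
  refine ⟨h.continuousAt, ?_⟩
  have h1 : ContMDiffAt 𝓘(ℝ, F) 𝓘(ℝ, EG) 1 W q := h.of_le (ENat.one_le_iff_ne_zero_withTop.2 hn)
  have h2 : ContMDiffAt 𝓘(ℝ, F) 𝓘(ℝ, EG) 1 (fun q' => W q' * (W q)⁻¹) q :=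
    haveI : LieGroup 𝓘(ℝ, EG) 1 G := LieGroup.of_le (n := ∞) (by exact_mod_cast le_top)
    h1.mul contMDiffAt_const
  exact ((h2.lchart_comp (by exact_mod_cast le_top) (by simp)).differentiableAt one_ne_zero).hasFDerivAt

end LieCalculus

/-! ### The bracket as a second derivative of the multiplication, and the Maurer-Cartan equation. -/

section LieCalculus2

lemma minSmoothness_two_le : minSmoothness ℝ 2 ≤ ∞ := by
  rw [minSmoothness_of_isRCLikeNormedField]; exact WithTop.coe_le_coe.2 le_top

lemma ContDiffAt.eventually_differentiableAt {E F : Type*} [NormedAddCommGroup E]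
    [NormedSpace ℝ E] [NormedAddCommGroup F] [NormedSpace ℝ F] {f : E → F} {x : E}
    (h : ContDiffAt ℝ ∞ f x) : ∀ᶠ y in 𝓝 x, DifferentiableAt ℝ f y := by
  have h1 : ContDiffAt ℝ 1 f x := h.of_le (by exact_mod_cast le_top)
  filter_upwards [h1.eventually (by simp)] with y hy using hy.differentiableAt one_ne_zero

variable {EG : Type*} [NormedAddCommGroup EG] [NormedSpace ℝ EG]
  {G : Type*} [TopologicalSpace G] [ChartedSpace EG G] [Group G] [LieGroup 𝓘(ℝ, EG) ∞ G]
  {F : Type*} [NormedAddCommGroup F] [NormedSpace ℝ F]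

variable (G) in
/-- The mixed second derivative of the multiplication at the identity. -/
def lmixed (ξ η : EG) : EG :=
  fderiv ℝ (fderiv ℝ (lmul G)) (lone EG G, lone EG G) (ξ, 0) (0, η)

lemma contDiffAt_fderiv_lmul :
    ContDiffAt ℝ ∞ (fderiv ℝ (lmul G)) (lone EG G, lone EG G) :=
  contDiffAt_lmul.fderiv_right (by simp)

lemma fderiv_fderiv_lmul_symm (ξ η : EG) :
    fderiv ℝ (fderiv ℝ (lmul G)) (lone EG G, lone EG G) (0, ξ) (η, 0) = lmixed G η ξ :=
  (contDiffAt_lmul.isSymmSndFDerivAt minSmoothness_two_le) _ _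

lemma eventually_differentiableAt_lmul :
    ∀ᶠ p in 𝓝 (lone EG G, lone EG G), DifferentiableAt ℝ (lmul G) p :=
  contDiffAt_lmul.eventually_differentiableAt

lemma fderiv_lmul_lone : fderiv ℝ (lmul G) (lone EG G, lone EG G) =
    ContinuousLinearMap.fst ℝ EG EG + ContinuousLinearMap.snd ℝ EG EG :=
  hasFDerivAt_lmul.fderiv

/-- Differentiate z·x = (z x z⁻¹)·z in x at the identity, which gives `key`, and the result in z at
the identity. The term in which Ad is differentiated is the bracket; the others are mixed second
derivatives of the multiplication. -/
lemma brk_eq_lmixed (ξ η : EG) : brk G ξ η = lmixed G ξ η - lmixed G η ξ := by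
  have := topologicalGroup_of_smooth EG G inferInstance
  have hd := eventually_differentiableAt_lmul (G := G) (EG := EG)
  have hl : ContinuousAt (fun z : EG => (z, lone EG G)) (lone EG G) := by fun_prop
  have hr : ContinuousAt (fun z : EG => (lone EG G, z)) (lone EG G) := by fun_prop
  have key : ∀ᶠ z in 𝓝 (lone EG G), fderiv ℝ (lmul G) (z, lone EG G) (0, η) =
      fderiv ℝ (lmul G) (lone EG G, z) (Adj (lparam G z) η, 0) := by
    have h1 : ∀ᶠ z in 𝓝 (lone EG G), lparam G (lchart EG (lparam G z)) = lparam G z :=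
      continuousAt_lparam.eventually_lparam_lchart EG (by simp)
    filter_upwards [hl.eventually hd, hr.eventually hd, eventually_lchart_lparam] with z hz1 hz2 hz
    have e1 := hz1.hasFDerivAt.comp (f := fun x => (z, x)) (lone EG G)
      (hasFDerivAt_prodMk_right z (lone EG G))
    have e2 : HasFDerivAt (fun x => lmul G (lchart EG (lparam G z * lparam G x * (lparam G z)⁻¹), z))
        ((fderiv ℝ (lmul G) (lone EG G, z)).comp
          ((ContinuousLinearMap.inl ℝ EG EG).comp (Adj (lparam G z)))) (lone EG G) := by
      have h2 : HasFDerivAt (fun x => (lchart EG (lparam G z * lparam G x * (lparam G z)⁻¹), z))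
          ((ContinuousLinearMap.inl ℝ EG EG).comp (Adj (lparam G z))) (lone EG G) := by
        convert! (hasFDerivAt_Adj (EG := EG) (lparam G z)).prodMk (hasFDerivAt_const z (lone EG G)) using 1
      refine HasFDerivAt.comp (g := lmul G)
        (f := fun x => (lchart EG (lparam G z * lparam G x * (lparam G z)⁻¹), z)) (lone EG G) ?_ h2
      simpa using hz2.hasFDerivAt
    have e3 := e1.unique (e2.congr_of_eventuallyEq ?_)
    · simpa using congrArg (fun L => L η) e3
    · have h3 : ContinuousAt (fun x => lparam G z * lparam G x * (lparam G z)⁻¹) (lone EG G) :=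
        (continuousAt_const.mul continuousAt_lparam).mul continuousAt_const
      filter_upwards [h3.eventually_lparam_lchart EG (by simp)] with x hx
      simp [lmul, hx]
  have hD : HasFDerivAt (fderiv ℝ (lmul G)) (fderiv ℝ (fderiv ℝ (lmul G)) (lone EG G, lone EG G))
      (lone EG G, lone EG G) := (contDiffAt_fderiv_lmul.differentiableAt (by simp)).hasFDerivAt
  have d1 := (hD.comp (f := fun z => (z, lone EG G)) (lone EG G)
    (hasFDerivAt_prodMk_left (lone EG G) (lone EG G))).clm_apply
    (hasFDerivAt_const ((0 : EG), η) (lone EG G))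
  have d3 := (hasFDerivAt_Adj_lparam (G := G) (EG := EG)).clm_apply (hasFDerivAt_const η (lone EG G))
  have d2 := (hD.comp (f := fun z => (lone EG G, z)) (lone EG G)
    (hasFDerivAt_prodMk_right (lone EG G) (lone EG G))).clm_apply
    (d3.prodMk (hasFDerivAt_const (0 : EG) (lone EG G)))
  have d4 := congrArg (fun L => L ξ) (d1.unique (d2.congr_of_eventuallyEq key))
  simp [fderiv_lmul_lone, fderiv_fderiv_lmul_symm] at d4
  have d5 : lmixed G ξ η = brk G ξ η + lmixed G η ξ := d4
  rw [d5]; abel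

lemma brk_antisymm (ξ η : EG) : brk G ξ η = -brk G η ξ := by
  rw [brk_eq_lmixed, brk_eq_lmixed]; abel

/-- The coordinates of a `G`-valued map near a point, after a right translation to the identity. -/
def lcoord (EG : Type*) [NormedAddCommGroup EG] {G : Type*} [TopologicalSpace G] [ChartedSpace EG G]
    [Group G] [NormedSpace ℝ EG] (W : F → G) (q₀ q : F) : EG := lchart EG (W q * (W q₀)⁻¹)

lemma contDiffAt_lcoord {W : F → G} {q₀ : F} (h : ContMDiffAt 𝓘(ℝ, F) 𝓘(ℝ, EG) ∞ W q₀) :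
    ContDiffAt ℝ ∞ (lcoord EG W q₀) q₀ :=
  ContMDiffAt.lchart_comp le_rfl (h.mul contMDiffAt_const) (by simp)

omit [LieGroup 𝓘(ℝ, EG) ∞ G] [NormedAddCommGroup F] [NormedSpace ℝ F] in
lemma lcoord_self (W : F → G) (q₀ : F) : lcoord EG W q₀ q₀ = lone EG G := by simp [lcoord]

omit [NormedSpace ℝ F] in
lemma eventually_lparam_lcoord {W : F → G} {q₀ : F} (h : ContinuousAt W q₀) :
    ∀ᶠ q in 𝓝 q₀, lparam G (lcoord EG W q₀ q) = W q * (W q₀)⁻¹ := by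
  have := topologicalGroup_of_smooth EG G inferInstance
  exact (h.mul continuousAt_const).eventually_lparam_lchart EG (by simp)

/-- The translation defining `rd` moves with the point. With the fixed coordinate w = `lcoord EG W
q₀` and n(x, z) = x z⁻¹ in the chart, `rd` becomes D₁n(w, w)∘Dw, whose dependence on the point is
visibly smooth. -/
lemma ContMDiffAt.contDiffAt_rd {W : F → G} {q₀ : F}
    (h : ContMDiffAt 𝓘(ℝ, F) 𝓘(ℝ, EG) ∞ W q₀) : ContDiffAt ℝ ∞ (rd EG W) q₀ := by
  have hn : ContDiffAt ℝ ∞ (fun p : EG × EG => lchart EG (lparam G p.1 * (lparam G p.2)⁻¹))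
      (lone EG G, lone EG G) := by
    refine ContMDiffAt.lchart_comp le_rfl ?_ (by simp)
    exact (contDiffAt_fst.lparam_comp le_rfl rfl).mul (contDiffAt_snd.lparam_comp le_rfl rfl).inv
  set n := fun p : EG × EG => lchart EG (lparam G p.1 * (lparam G p.2)⁻¹) with hndef
  have hw := contDiffAt_lcoord h
  have hww : ContDiffAt ℝ ∞ (fun q => (lcoord EG W q₀ q, lcoord EG W q₀ q)) q₀ := hw.prodMk hw
  have hev : ∀ᶠ q in 𝓝 q₀, rd EG W q =
      (fderiv ℝ n (lcoord EG W q₀ q, lcoord EG W q₀ q)).comp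
        ((ContinuousLinearMap.inl ℝ EG EG).comp (fderiv ℝ (lcoord EG W q₀) q)) := by
    have e1 := (eventually_lparam_lcoord (EG := EG) h.continuousAt).eventually_nhds
    have e2 := hw.eventually_differentiableAt
    have e3 : ∀ᶠ q in 𝓝 q₀, DifferentiableAt ℝ n (lcoord EG W q₀ q, lcoord EG W q₀ q) :=
      hww.continuousAt.eventually (by
        simp only [lcoord_self]; exact hn.eventually_differentiableAt)
    filter_upwards [e1, e2, e3] with q h1 h2 h3
    have h4 : HasFDerivAt (fun q' => (lcoord EG W q₀ q', lcoord EG W q₀ q))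
        ((ContinuousLinearMap.inl ℝ EG EG).comp (fderiv ℝ (lcoord EG W q₀) q)) q := by
      convert! h2.hasFDerivAt.prodMk
        (hasFDerivAt_const (lcoord EG W q₀ q) q) using 1
    have h5 := h3.hasFDerivAt.comp
      (f := fun q' => (lcoord EG W q₀ q', lcoord EG W q₀ q)) q h4
    refine (h5.congr_of_eventuallyEq ?_).fderiv
    filter_upwards [h1] with q' hq'
    simp only [hndef, Function.comp, hq', h1.self_of_nhds]
    congr 1
    simp [mul_assoc]
  refine ContDiffAt.congr_of_eventuallyEq ?_ hev
  have hn' : ContDiffAt ℝ ∞ (fderiv ℝ n) (lcoord EG W q₀ q₀, lcoord EG W q₀ q₀) := by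
    rw [lcoord_self]; exact hn.fderiv_right (by simp)
  exact (hn'.comp q₀ hww).clm_comp (contDiffAt_const.clm_comp (hw.fderiv_right (by simp)))

lemma ContMDiff.contDiff_rd {W : F → G} (h : ContMDiff 𝓘(ℝ, F) 𝓘(ℝ, EG) ∞ W) :
    ContDiff ℝ ∞ (rd EG W) := contDiff_iff_contDiffAt.2 fun q => (h q).contDiffAt_rd

/-- The Maurer-Cartan equation. -/
lemma ContMDiffAt.fderiv_rd_sub {W : F → G} {q₀ : F} (h : ContMDiffAt 𝓘(ℝ, F) 𝓘(ℝ, EG) ∞ W q₀)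
    (u v : F) : fderiv ℝ (rd EG W) q₀ u v - fderiv ℝ (rd EG W) q₀ v u =
      brk G (rd EG W q₀ u) (rd EG W q₀ v) := by
  set w := lcoord EG W q₀ with hwdef
  have hw := contDiffAt_lcoord h
  have hl : ContinuousAt (fun q => (lone EG G, w q)) q₀ := continuousAt_const.prodMk hw.continuousAt
  -- From W q' (W q₀)⁻¹ = (W q' (W q)⁻¹)(W q (W q₀)⁻¹): the fixed coordinate has derivative D₁m(e,
  -- w) ∘ `rd`, where m is the multiplication in the chart.
  have hev : ∀ᶠ q in 𝓝 q₀, fderiv ℝ w q = (fderiv ℝ (lmul G) (lone EG G, w q)).comp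
      ((ContinuousLinearMap.inl ℝ EG EG).comp (rd EG W q)) := by
    have e1 := (eventually_lparam_lcoord (EG := EG) h.continuousAt)
    have : IsManifold 𝓘(ℝ, EG) 1 G := LieGroup.toContMDiffMul.toIsManifold.of_le (n := ∞)
      (by exact_mod_cast le_top)
    have e2 := (contMDiffAt_iff_contMDiffAt_nhds (n := 1) (by simp)).1
      (h.of_le (by exact_mod_cast le_top))
    have e3 : ∀ᶠ q in 𝓝 q₀, DifferentiableAt ℝ (lmul G) (lone EG G, w q) :=
      hl.eventually (by
        simp only [hwdef, lcoord_self]; exact eventually_differentiableAt_lmul)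
    filter_upwards [e1, e2, e3] with q h1 h2 h3
    have h4 := h2.hasRD (by simp)
    have h6 : HasFDerivAt (fun q' => (lchart EG (W q' * (W q)⁻¹), w q))
        ((ContinuousLinearMap.inl ℝ EG EG).comp (rd EG W q)) q := by
      convert! h4.2.prodMk (hasFDerivAt_const (w q) q) using 1
    have h3' : HasFDerivAt (lmul G) (fderiv ℝ (lmul G) (lone EG G, w q))
        (lchart EG (W q * (W q)⁻¹), w q) := by simpa using h3.hasFDerivAt
    have h5 := h3'.comp (f := fun q' => (lchart EG (W q' * (W q)⁻¹), w q)) q h6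
    refine (h5.congr_of_eventuallyEq ?_).fderiv
    filter_upwards [h4.eventually] with q' hq'
    simp only [lmul, hq', Function.comp]
    rw [show lparam G (w q) = _ from h1]
    simp [hwdef, lcoord, mul_assoc]
  have hR := (h.contDiffAt_rd.differentiableAt (by simp)).hasFDerivAt
  have hD : HasFDerivAt (fderiv ℝ (lmul G)) (fderiv ℝ (fderiv ℝ (lmul G)) (lone EG G, lone EG G))
      (lone EG G, w q₀) := by
    rw [hwdef, lcoord_self]; exact (contDiffAt_fderiv_lmul.differentiableAt (by simp)).hasFDerivAt
  have hw1 := (hw.differentiableAt (by simp)).hasFDerivAt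
  have hpair : HasFDerivAt (fun q => (lone EG G, w q))
      ((ContinuousLinearMap.inr ℝ EG EG).comp (fderiv ℝ w q₀)) q₀ := by
    convert! (hasFDerivAt_const (lone EG G) q₀).prodMk hw1 using 1
  have hD2 := hD.comp (f := fun q => (lone EG G, w q)) q₀ hpair
  have hw0 : fderiv ℝ w q₀ = rd EG W q₀ := rfl
  -- Differentiating this formula once more leaves a mixed derivative of m plus the derivative of
  -- `rd`. Symmetry of D²w then gives the equation, since the mixed terms antisymmetrize to the
  -- bracket.
  have main : ∀ a b, fderiv ℝ (fderiv ℝ w) q₀ a b =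
      lmixed G (rd EG W q₀ b) (rd EG W q₀ a) + fderiv ℝ (rd EG W) q₀ a b := by
    intro a b
    have d1 : HasFDerivAt (fun q => fderiv ℝ w q b) _ q₀ :=
      ((hw.fderiv_right (m := ∞) (by simp)).differentiableAt (by simp)).hasFDerivAt.clm_apply
        (hasFDerivAt_const b q₀)
    have d2 := hD2.clm_apply (((ContinuousLinearMap.inl ℝ EG EG).hasFDerivAt.comp q₀
      (hR.clm_apply (hasFDerivAt_const b q₀))))
    have d3 := congrArg (fun L => L a) (d1.unique (d2.congr_of_eventuallyEq (by
      filter_upwards [hev] with q hq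
      rw [hq]; rfl)))
    simp [hwdef, lcoord_self, fderiv_lmul_lone, fderiv_fderiv_lmul_symm] at d3
    rw [← hwdef] at d3
    rw [d3, hw0]; abel
  have hsymm := (hw.isSymmSndFDerivAt minSmoothness_two_le) u v
  rw [main, main] at hsymm
  rw [brk_eq_lmixed]
  rw [← sub_eq_zero] at hsymm ⊢
  rw [← hsymm]; abel

end LieCalculus2

/-! ### Comparison with left invariant vector fields and manifold derivatives; maps with zero
derivative. -/

section LieCalculus3

variable {EG : Type*} [NormedAddCommGroup EG] [NormedSpace ℝ EG]
  {G : Type*} [TopologicalSpace G] [ChartedSpace EG G] [Group G] [LieGroup 𝓘(ℝ, EG) ∞ G]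
  {F : Type*} [NormedAddCommGroup F] [NormedSpace ℝ F]

lemma hasFDerivAt_of_hasMFDerivAt {E EN : Type*} [NormedAddCommGroup E] [NormedSpace ℝ E]
    [NormedAddCommGroup EN] [NormedSpace ℝ EN]
    {N : Type*} [TopologicalSpace N] [ChartedSpace EN N] {f : N → E} {x : N}
    {L : EN →L[ℝ] E} (h : HasMFDerivAt 𝓘(ℝ, EN) 𝓘(ℝ, E) f x L) :
    HasFDerivAt (fun z => f ((extChartAt 𝓘(ℝ, EN) x).symm z)) L (extChartAt 𝓘(ℝ, EN) x x) := by
  have h1 : HasFDerivWithinAt (𝕜 := ℝ) (E := EN) (F := E)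
    (writtenInExtChartAt 𝓘(ℝ, EN) 𝓘(ℝ, E) x f) L (range 𝓘(ℝ, EN)) (extChartAt 𝓘(ℝ, EN) x x) := h.2
  rw [ModelWithCorners.range_eq_univ, hasFDerivWithinAt_univ] at h1
  simpa only [writtenInExtChartAt, Function.comp_def, extChartAt_model_space_eq_id,
    PartialEquiv.refl_coe, id] using h1

lemma HasMFDerivAt.of_eq {E EN : Type*} [NormedAddCommGroup E] [NormedSpace ℝ E]
    [NormedAddCommGroup EN] [NormedSpace ℝ EN]
    {N : Type*} [TopologicalSpace N] [ChartedSpace EN N]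
    {N' : Type*} [TopologicalSpace N'] [ChartedSpace E N'] {f : N → N'} {x y : N}
    {L : EN →L[ℝ] E} (h : HasMFDerivAt 𝓘(ℝ, EN) 𝓘(ℝ, E) f y L) (hxy : x = y) :
    HasMFDerivAt 𝓘(ℝ, EN) 𝓘(ℝ, E) f x L := by
  subst hxy; exact h

/-- Left translation by z is x ↦ m(z, x) in the chart, so the left invariant field generated by η is
the second partial derivative of m at (z, e) applied to η. -/
lemma mpullbackWithin_mulInvariantVectorField (η : EG) : ∀ᶠ z in 𝓝 (lone EG G),
    (VectorField.mpullbackWithin 𝓘(ℝ, EG) 𝓘(ℝ, EG) (extChartAt 𝓘(ℝ, EG) (1 : G)).symm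
      (mulInvariantVectorField (I := 𝓘(ℝ, EG)) (G := G) η) (range 𝓘(ℝ, EG)) z : EG) =
      fderiv ℝ (lmul G) (z, lone EG G) (0, η) := by
  have hM : IsManifold 𝓘(ℝ, EG) 1 G := LieGroup.toContMDiffMul.toIsManifold.of_le (n := ∞)
      (by exact_mod_cast le_top)
  have hl : ContinuousAt (fun z : EG => (z, lone EG G)) (lone EG G) := by fun_prop
  filter_upwards [extChartAt_target_mem_nhds (I := 𝓘(ℝ, EG)) (1 : G),
    hl.eventually (eventually_differentiableAt_lmul (G := G) (EG := EG))] with z hz hd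
  set g := (extChartAt 𝓘(ℝ, EG) (1 : G)).symm z with hg
  have hgs : g ∈ (extChartAt 𝓘(ℝ, EG) (1 : G)).source := (extChartAt 𝓘(ℝ, EG) (1 : G)).map_target hz
  have hzg : extChartAt 𝓘(ℝ, EG) (1 : G) g = z := (extChartAt 𝓘(ℝ, EG) (1 : G)).right_inv hz
  have e1 := mfderiv_extChartAt_comp_mfderivWithin_extChartAt_symm (I := 𝓘(ℝ, EG)) hz
  have e2 := mfderivWithin_extChartAt_symm_comp_mfderiv_extChartAt (I := 𝓘(ℝ, EG)) hz
  have e3 : (mfderivWithin 𝓘(ℝ, EG) 𝓘(ℝ, EG) (extChartAt 𝓘(ℝ, EG) (1 : G)).symm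
      (range 𝓘(ℝ, EG)) z).inverse = mfderiv 𝓘(ℝ, EG) 𝓘(ℝ, EG) (extChartAt 𝓘(ℝ, EG) (1 : G)) g :=
    ContinuousLinearMap.inverse_eq e2 e1
  have e4 : (VectorField.mpullbackWithin 𝓘(ℝ, EG) 𝓘(ℝ, EG) (extChartAt 𝓘(ℝ, EG) (1 : G)).symm
      (mulInvariantVectorField (I := 𝓘(ℝ, EG)) (G := G) η) (range 𝓘(ℝ, EG)) z : EG) =
      (mfderiv 𝓘(ℝ, EG) 𝓘(ℝ, EG) (extChartAt 𝓘(ℝ, EG) (1 : G)) g : EG →L[ℝ] EG)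
        ((mfderiv 𝓘(ℝ, EG) 𝓘(ℝ, EG) (fun h => g * h) (1 : G) : EG →L[ℝ] EG) η) := by
    rw [VectorField.mpullbackWithin_apply, e3]; rfl
  rw [e4]
  have h1 : HasMFDerivAt 𝓘(ℝ, EG) 𝓘(ℝ, EG) (fun h => g * h) (1 : G)
      (mfderiv 𝓘(ℝ, EG) 𝓘(ℝ, EG) (fun h => g * h) (1 : G)) :=
    ((contMDiff_mul_left (I := 𝓘(ℝ, EG)) (n := ∞)).mdifferentiable (by simp) 1).hasMFDerivAt
  have h2 := (mdifferentiableAt_extChartAt (I := 𝓘(ℝ, EG)) (by simpa using hgs)).hasMFDerivAt.of_eq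
    (mul_one g)
  have h3 := hasFDerivAt_of_hasMFDerivAt (HasMFDerivAt.comp (1 : G) h2 h1)
  have h4 : HasFDerivAt (fun x => lmul G (z, x)) ((fderiv ℝ (lmul G) (z, lone EG G)).comp
      (ContinuousLinearMap.inr ℝ EG EG)) (lone EG G) :=
    hd.hasFDerivAt.comp (f := fun x => (z, x)) _ (hasFDerivAt_prodMk_right z (lone EG G))
  exact congrArg (fun L : EG →L[ℝ] EG => L η) (h3.unique h4)

/-- In the chart, the bracket of the fields V_ξ(z) = ∂₂m(z, e)ξ and V_η at the identity is DV_η(ξ) -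
DV_ξ(η), the antisymmetrized mixed derivative that also computes `brk`. -/
lemma lieBr_eq_brk (ξ η : EG) : lieBr G ξ η = brk G ξ η := by
  have hfd : ∀ ζ : EG, HasFDerivAt (fun z => fderiv ℝ (lmul G) (z, lone EG G) (0, ζ))
      (((fderiv ℝ (fderiv ℝ (lmul G)) (lone EG G, lone EG G)).comp
        (ContinuousLinearMap.inl ℝ EG EG)).flip (0, ζ)) (lone EG G) := by
    intro ζ
    have hD : HasFDerivAt (fderiv ℝ (lmul G)) (fderiv ℝ (fderiv ℝ (lmul G)) (lone EG G, lone EG G))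
      (lone EG G, lone EG G) := (contDiffAt_fderiv_lmul.differentiableAt (by simp)).hasFDerivAt
    have := (hD.comp (f := fun z => (z, lone EG G)) (lone EG G)
      (hasFDerivAt_prodMk_left (lone EG G) (lone EG G))).clm_apply
      (hasFDerivAt_const ((0 : EG), ζ) (lone EG G))
    refine this.congr_fderiv ?_
    ext v; simp
  have hV : ∀ ζ : EG, HasFDerivAt (E := EG) (F := EG)
      (VectorField.mpullbackWithin 𝓘(ℝ, EG) 𝓘(ℝ, EG) (extChartAt 𝓘(ℝ, EG) (1 : G)).symm
      (mulInvariantVectorField (I := 𝓘(ℝ, EG)) (G := G) ζ) (range 𝓘(ℝ, EG)))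
      (((fderiv ℝ (fderiv ℝ (lmul G)) (lone EG G, lone EG G)).comp
        (ContinuousLinearMap.inl ℝ EG EG)).flip (0, ζ)) (lone EG G) := fun ζ =>
    (hfd ζ).congr_of_eventuallyEq (mpullbackWithin_mulInvariantVectorField ζ)
  have hV0 : ∀ ζ : EG, (VectorField.mpullbackWithin 𝓘(ℝ, EG) 𝓘(ℝ, EG) (extChartAt 𝓘(ℝ, EG) (1 : G)).symm
      (mulInvariantVectorField (I := 𝓘(ℝ, EG)) (G := G) ζ) (range 𝓘(ℝ, EG)) (lone EG G) : EG) = ζ := by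
    intro ζ
    refine (mpullbackWithin_mulInvariantVectorField ζ).self_of_nhds.trans ?_
    rw [fderiv_lmul_lone]
    simp only [add_apply, ContinuousLinearMap.coe_fst', ContinuousLinearMap.coe_snd', zero_add]
    rfl
  have h0 : lieBr G ξ η = (mfderiv 𝓘(ℝ, EG) 𝓘(ℝ, EG) (extChartAt 𝓘(ℝ, EG) (1 : G)) 1).inverse
      (VectorField.lieBracketWithin ℝ
        (VectorField.mpullbackWithin 𝓘(ℝ, EG) 𝓘(ℝ, EG) (extChartAt 𝓘(ℝ, EG) (1 : G)).symm
        (mulInvariantVectorField (I := 𝓘(ℝ, EG)) (G := G) ξ) (range 𝓘(ℝ, EG)))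
        (VectorField.mpullbackWithin 𝓘(ℝ, EG) 𝓘(ℝ, EG) (extChartAt 𝓘(ℝ, EG) (1 : G)).symm
        (mulInvariantVectorField (I := 𝓘(ℝ, EG)) (G := G) η) (range 𝓘(ℝ, EG)))
        ((extChartAt 𝓘(ℝ, EG) (1 : G)).symm ⁻¹' univ ∩ range 𝓘(ℝ, EG)) (lone EG G) : EG) := rfl
  have h1 : (mfderiv 𝓘(ℝ, EG) 𝓘(ℝ, EG) (extChartAt 𝓘(ℝ, EG) (1 : G)) 1) =
      ContinuousLinearMap.id ℝ EG := by
    have hM : IsManifold 𝓘(ℝ, EG) 1 G := LieGroup.toContMDiffMul.toIsManifold.of_le (n := ∞)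
      (by exact_mod_cast le_top)
    have := hasFDerivAt_of_hasMFDerivAt (mdifferentiableAt_extChartAt (I := 𝓘(ℝ, EG))
      (mem_chart_source EG (1 : G))).hasMFDerivAt
    exact this.unique ((hasFDerivAt_id _).congr_of_eventuallyEq eventually_lchart_lparam)
  have h2 : (ContinuousLinearMap.id ℝ EG).inverse = ContinuousLinearMap.id ℝ EG :=
    ContinuousLinearMap.inverse_id
  rw [h0, h1]
  refine (congrArg (fun L : EG →L[ℝ] EG => L _) h2).trans ?_
  have huniv : (extChartAt 𝓘(ℝ, EG) (1 : G)).symm ⁻¹' univ ∩ range 𝓘(ℝ, EG) = univ := by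
    simp
  rw [huniv]
  have key : ∀ V V' : EG → EG, ∀ L L' : EG →L[ℝ] EG, HasFDerivAt V L (lone EG G) →
      HasFDerivAt V' L' (lone EG G) →
      VectorField.lieBracketWithin ℝ V V' univ (lone EG G) =
        L' (V (lone EG G)) - L (V' (lone EG G)) := by
    intro V V' L L' hV hV'
    rw [VectorField.lieBracketWithin_univ, VectorField.lieBracket_eq]
    simp only [hV.fderiv, hV'.fderiv]
  refine (key _ _ _ _ (hV ξ) (hV η)).trans ?_
  rw [brk_eq_lmixed]
  exact congrArg₂ (fun a b : EG => lmixed G a η - lmixed G b ξ) (hV0 ξ) (hV0 η)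

lemma hasMFDerivAt_mul_const (g h : G) : HasMFDerivAt 𝓘(ℝ, EG) 𝓘(ℝ, EG) (fun x => x * g) h
    (mfderiv 𝓘(ℝ, EG) 𝓘(ℝ, EG) (fun x => x * g) h) :=
  ((contMDiff_mul_right (I := 𝓘(ℝ, EG)) (n := ∞) (a := g)).mdifferentiable (by simp) h).hasMFDerivAt

lemma HasRD.hasMFDerivAt {W : F → G} {L : F →L[ℝ] EG} {q : F} (h : HasRD W L q) :
    HasMFDerivAt 𝓘(ℝ, F) 𝓘(ℝ, EG) W q
      ((mfderiv 𝓘(ℝ, EG) 𝓘(ℝ, EG) (fun x => x * W q) (1 : G) : EG →L[ℝ] EG).comp L) := by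
  have := topologicalGroup_of_smooth EG G inferInstance
  have h1 : HasMFDerivAt 𝓘(ℝ, F) 𝓘(ℝ, EG) (fun q' => W q' * (W q)⁻¹) q L :=
    hasMFDerivAt_of_hasFDerivAt_lchart (by simp) (h.1.mul continuousAt_const)
      (by simpa only [extChartAt_model_space_eq_id, PartialEquiv.refl_coe, PartialEquiv.refl_symm, id]
        using h.2)
  have h2 := (hasMFDerivAt_mul_const (EG := EG) (W q) 1).of_eq (mul_inv_cancel (W q))
  have h3 := HasMFDerivAt.comp q h2 h1
  have h4 : (fun x => x * W q) ∘ (fun q' => W q' * (W q)⁻¹) = W := by ext; simp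
  rw [h4] at h3
  exact h3

/-- Right translation by (W q)⁻¹ inverts the right translation by W q, so composing with its
derivative cancels `C`. -/
lemma hasRD_of_hasMFDerivAt {W : F → G} {L : F →L[ℝ] EG} {q : F} {C : EG →L[ℝ] EG}
    (hC : HasMFDerivAt 𝓘(ℝ, EG) 𝓘(ℝ, EG) (fun x => x * W q) (1 : G) C)
    (h : HasMFDerivAt 𝓘(ℝ, F) 𝓘(ℝ, EG) W q (C.comp L)) : HasRD W L q := by
  obtain ⟨A, hA⟩ : ∃ A : EG →L[ℝ] EG, HasMFDerivAt 𝓘(ℝ, EG) 𝓘(ℝ, EG) (fun x => x * (W q)⁻¹) (W q) A :=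
    ⟨_, hasMFDerivAt_mul_const _ _⟩
  refine ⟨h.continuousAt, ?_⟩
  have h3 := hasFDerivAt_lchart_of_hasMFDerivAt (L := A.comp (C.comp L)) (by simp)
    (HasMFDerivAt.comp q hA h)
  have h6 := HasMFDerivAt.comp (1 : G) (hA.of_eq (one_mul (W q))) hC
  have h7 : (fun x => x * (W q)⁻¹) ∘ (fun x => x * W q) = id := by ext; simp
  rw [h7] at h6
  have h8 : A.comp C = ContinuousLinearMap.id ℝ EG := hasMFDerivAt_unique h6 (hasMFDerivAt_id (1 : G))
  rw [← ContinuousLinearMap.comp_assoc, h8, ContinuousLinearMap.id_comp] at h3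
  simpa only [Function.comp_def, extChartAt_model_space_eq_id, PartialEquiv.refl_coe,
      PartialEquiv.refl_symm, id] using h3

/-- Near each time the coordinate of W s (W t)⁻¹ has zero derivative, so W is locally constant.
Connectedness makes it constant on the open interval, and continuity with the Hausdorff property
reaches the endpoints. -/
lemma HasRD.eq_of_zero [T2Space G] {W : ℝ → G} {a b : ℝ} (hab : a ≤ b)
    (hc : ContinuousOn W (Icc a b)) (h : ∀ t ∈ Ioo a b, HasRD W (0 : ℝ →L[ℝ] EG) t) :
    W a = W b := by
  rcases hab.eq_or_lt with rfl | hab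
  · rfl
  have hT := topologicalGroup_of_smooth EG G inferInstance
  have hloc : ∀ t ∈ Ioo a b, ∀ᶠ s in 𝓝[Ioo a b] t, W t = W s := by
    intro t ht
    have hr : ContinuousAt (fun s => (lone EG G, lchart EG (W s * (W t)⁻¹))) t :=
      continuousAt_const.prodMk (h t ht).2.continuousAt
    have h1 : ∀ᶠ s in 𝓝 t, DifferentiableAt ℝ (lmul G) (lone EG G, lchart EG (W s * (W t)⁻¹)) :=
      hr.eventually (by simpa using eventually_differentiableAt_lmul (G := G) (EG := EG))
    have h2 := (h t ht).eventually
    obtain ⟨ε, hε, hball⟩ := Metric.eventually_nhds_iff_ball.1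
      ((h1.and h2).and (Ioo_mem_nhds ht.1 ht.2))
    have h3 : ∀ s ∈ Metric.ball t ε, HasFDerivAt (fun s => lchart EG (W s * (W t)⁻¹)) (0 : ℝ →L[ℝ] EG) s := by
      intro s hs
      obtain ⟨⟨h4, h5⟩, h6⟩ := hball s hs
      have h7 := h s h6
      -- The hypothesis at s concerns W s' (W s)⁻¹; multiplying by the fixed element W s (W t)⁻¹
      -- re-anchors it at t.
      have h8 : HasFDerivAt (fun s' => (lchart EG (W s' * (W s)⁻¹), lchart EG (W s * (W t)⁻¹)))
          (0 : ℝ →L[ℝ] EG × EG) s := by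
        convert! h7.2.prodMk (hasFDerivAt_const (lchart EG (W s * (W t)⁻¹)) s) using 1
      have h4' : HasFDerivAt (lmul G) (fderiv ℝ (lmul G) (lone EG G, lchart EG (W s * (W t)⁻¹)))
        (lchart EG (W s * (W s)⁻¹), lchart EG (W s * (W t)⁻¹)) := by simpa using h4.hasFDerivAt
      have h9 := h4'.comp (f := fun s' => (lchart EG (W s' * (W s)⁻¹), lchart EG (W s * (W t)⁻¹))) s h8
      rw [ContinuousLinearMap.comp_zero] at h9
      refine h9.congr_of_eventuallyEq ?_
      filter_upwards [h7.eventually] with s' hs'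
      simp [lmul, hs', h5]
    refine Filter.Eventually.filter_mono nhdsWithin_le_nhds ?_
    filter_upwards [Metric.ball_mem_nhds t hε] with s hs
    have h10 := (convex_ball t ε).is_const_of_fderivWithin_eq_zero (𝕜 := ℝ)
      (fun x hx => (h3 x hx).differentiableAt.differentiableWithinAt)
      (fun x hx => (h3 x hx).hasFDerivWithinAt.fderivWithin
        (Metric.isOpen_ball.uniqueDiffWithinAt hx)) hs (Metric.mem_ball_self hε)
    have h11 := congrArg (lparam G) h10
    rw [(hball s hs).1.2, (hball t (Metric.mem_ball_self hε)).1.2] at h11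
    exact (mul_right_cancel h11).symm
  have hconst : ∀ s ∈ Ioo a b, ∀ t ∈ Ioo a b, W s = W t := fun s hs t ht =>
    isPreconnected_Ioo.induction₂ (fun s t => W s = W t) hloc
      (fun _ _ _ _ _ _ h1 h2 => h1.trans h2) (fun _ _ _ _ h => h.symm) hs ht
  have hm : (a + b) / 2 ∈ Ioo a b := ⟨by linarith, by linarith⟩
  have hcl : ∀ s ∈ Icc a b, W s = W ((a + b) / 2) := by
    intro s hs
    have h1 : s ∈ closure (Ioo a b) := by rwa [closure_Ioo hab.ne]
    have h2 : Filter.NeBot (𝓝[Ioo a b] s) := mem_closure_iff_nhdsWithin_neBot.1 h1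
    refine tendsto_nhds_unique ((hc s hs).mono Ioo_subset_Icc_self) ?_
    refine tendsto_const_nhds.congr' ?_
    filter_upwards [self_mem_nhdsWithin] with t ht
    exact hconst _ hm _ ht
  rw [hcl a (left_mem_Icc.2 hab.le), hcl b (right_mem_Icc.2 hab.le)]

end LieCalculus3

/-! ### From local to global solutions of differential equations with parameters. -/

section Gluing

variable {F : Type*} [NormedAddCommGroup F] [NormedSpace ℝ F]
  {EY : Type*} [NormedAddCommGroup EY] [NormedSpace ℝ EY]
  {Y : Type*} [TopologicalSpace Y] [ChartedSpace EY Y]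

/-- Local solvability, with `C^n` dependence on parameters, from time `s` to time `t`. -/
def SolvableBetween (n : ℕ∞ω) (Q : ℝ → F → (ℝ → Y) → Prop) (Adm : ℝ → F → Y → Prop) (p₁ : F)
    (s t : ℝ) : Prop :=
  ∀ (d : F → Y) (U₀ : Set F), IsOpen U₀ → p₁ ∈ U₀ → ContMDiffOn 𝓘(ℝ, F) 𝓘(ℝ, EY) n d U₀ →
    (∀ p ∈ U₀, Adm s p (d p)) →
    ∃ J : Set ℝ, IsOpen J ∧ J.OrdConnected ∧ s ∈ J ∧ t ∈ J ∧ ∃ U : Set F, IsOpen U ∧ p₁ ∈ U ∧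
      ∃ y : ℝ × F → Y, ContMDiffOn 𝓘(ℝ, ℝ × F) 𝓘(ℝ, EY) n y (J ×ˢ U) ∧
        ∀ p ∈ U, y (s, p) = d p ∧ ∀ t ∈ J, Q t p fun τ => y (τ, p)

/-- The value at time s of the solution starting at r is the datum for the solution starting at s.
Uniqueness makes the two agree on the overlap of their time intervals, so they glue. -/
lemma SolvableBetween.trans {n : ℕ∞ω} {Q : ℝ → F → (ℝ → Y) → Prop} {Adm : ℝ → F → Y → Prop} {p₁ : F}
    (hgerm : ∀ t p c c', c =ᶠ[𝓝 t] c' → Q t p c → Q t p c')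
    (huniq : ∀ p (J : Set ℝ), IsOpen J → J.OrdConnected → ∀ c c', (∀ t ∈ J, Q t p c) →
      (∀ t ∈ J, Q t p c') → ∀ t₀ ∈ J, c t₀ = c' t₀ → EqOn c c' J)
    (hAdm : ∀ t p c, Q t p c → Adm t p (c t)) {r s t : ℝ}
    (h1 : SolvableBetween (EY := EY) n Q Adm p₁ r s)
    (h2 : SolvableBetween (EY := EY) n Q Adm p₁ s t) :
    SolvableBetween (EY := EY) n Q Adm p₁ r t := by
  classical
  intro d U₀ hU₀ hp₁ hd hda
  obtain ⟨J₁, hJ₁, hJ₁c, hr, hs, U₁, hU₁, hpU₁, y₁, hy₁, hs₁⟩ := h1 d U₀ hU₀ hp₁ hd hda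
  obtain ⟨J₂, hJ₂, hJ₂c, hs', ht, U₂, hU₂, hpU₂, y₂, hy₂, hs₂⟩ := h2 (fun p => y₁ (s, p)) U₁ hU₁ hpU₁
    (hy₁.comp ((contMDiff_const.prodMk_space contMDiff_id).contMDiffOn) fun p hp => ⟨hs, hp⟩)
    (fun p hp => hAdm s p (fun τ => y₁ (τ, p)) ((hs₁ p hp).2 s hs))
  set y : ℝ × F → Y := fun q => if q.1 ∈ J₁ then y₁ q else y₂ q with hydef
  have e1 : ∀ τ ∈ J₁, ∀ p, y (τ, p) = y₁ (τ, p) := fun τ hτ p => by simp [hydef, hτ]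
  have e2 : ∀ τ ∈ J₂, ∀ p ∈ U₁ ∩ U₂, y (τ, p) = y₂ (τ, p) := by
    intro τ hτ p hp
    by_cases h : τ ∈ J₁
    · rw [e1 τ h p]
      exact huniq p (J₁ ∩ J₂) (hJ₁.inter hJ₂) (hJ₁c.inter hJ₂c) (fun τ => y₁ (τ, p))
        (fun τ => y₂ (τ, p))
        (fun t ht => (hs₁ p hp.1).2 t ht.1) (fun t ht => (hs₂ p hp.2).2 t ht.2) s ⟨hs, hs'⟩
        (hs₂ p hp.2).1.symm ⟨h, hτ⟩
    · simp [hydef, h]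
  have hUo : IsOpen (U₁ ∩ U₂) := hU₁.inter hU₂
  refine ⟨J₁ ∪ J₂, hJ₁.union hJ₂, ?_, Or.inl hr, Or.inr ht, U₁ ∩ U₂, hUo, ⟨hpU₁, hpU₂⟩, y, ?_, ?_⟩
  · exact (hJ₁c.isPreconnected.union s hs hs' hJ₂c.isPreconnected).ordConnected
  · rintro ⟨τ, p⟩ ⟨hτ, hp⟩
    refine ContMDiffAt.contMDiffWithinAt ?_
    rcases hτ with hτ | hτ
    · refine (hy₁.contMDiffAt ((hJ₁.prod hU₁).mem_nhds ⟨hτ, hp.1⟩)).congr_of_eventuallyEq ?_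
      filter_upwards [(hJ₁.prod hU₁).mem_nhds (show (τ, p) ∈ _ from ⟨hτ, hp.1⟩)] with q hq
      exact e1 q.1 hq.1 q.2
    · refine (hy₂.contMDiffAt ((hJ₂.prod hU₂).mem_nhds ⟨hτ, hp.2⟩)).congr_of_eventuallyEq ?_
      filter_upwards [(hJ₂.prod hUo).mem_nhds (show (τ, p) ∈ _ from ⟨hτ, hp⟩)] with q hq
      exact e2 q.1 hq.1 q.2 hq.2
  · intro p hp
    refine ⟨by rw [e1 r hr]; exact (hs₁ p hp.1).1, fun τ hτ => ?_⟩
    rcases hτ with hτ | hτ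
    · refine hgerm τ p _ _ ?_ ((hs₁ p hp.1).2 τ hτ)
      filter_upwards [hJ₁.mem_nhds hτ] with τ' hτ' using (e1 τ' hτ' p).symm
    · refine hgerm τ p _ _ ?_ ((hs₂ p hp.2).2 τ hτ)
      filter_upwards [hJ₂.mem_nhds hτ] with τ' hτ' using (e2 τ' hτ' p hp).symm

/-- Global solutions from local ones, for differential equations with parameters. -/
theorem exists_global_solution {n : ℕ∞ω} {Q : ℝ → F → (ℝ → Y) → Prop} {Adm : ℝ → F → Y → Prop}
    (hgerm : ∀ t p c c', c =ᶠ[𝓝 t] c' → Q t p c → Q t p c')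
    (huniq : ∀ p (J : Set ℝ), IsOpen J → J.OrdConnected → ∀ c c', (∀ t ∈ J, Q t p c) →
      (∀ t ∈ J, Q t p c') → ∀ t₀ ∈ J, c t₀ = c' t₀ → EqOn c c' J)
    (hAdm : ∀ t p c, Q t p c → Adm t p (c t))
    (hloc : ∀ t₁ p₁, ∀ᶠ t in 𝓝 t₁, SolvableBetween (EY := EY) n Q Adm p₁ t₁ t ∧
      SolvableBetween (EY := EY) n Q Adm p₁ t t₁)
    {d : F → Y} (hd : ContMDiff 𝓘(ℝ, F) 𝓘(ℝ, EY) n d) (hda : ∀ p, Adm 0 p (d p)) :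
    ∃ y : ℝ × F → Y, ContMDiff 𝓘(ℝ, ℝ × F) 𝓘(ℝ, EY) n y ∧
      ∀ p, y (0, p) = d p ∧ ∀ t, Q t p fun τ => y (τ, p) := by
  -- Solvability between two times is transitive and holds in both directions between nearby times,
  -- so connectedness of the line gives it for all pairs.
  have hR : ∀ p₁ t, SolvableBetween (EY := EY) n Q Adm p₁ 0 t := fun p₁ t =>
    PreconnectedSpace.induction₂' (SolvableBetween (EY := EY) n Q Adm p₁) (fun t₁ => hloc t₁ p₁)
      ⟨fun _ _ _ h1 h2 => h1.trans hgerm huniq hAdm h2⟩ 0 t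
  have hsol := fun (q : ℝ × F) => hR q.2 q.1 d univ isOpen_univ (mem_univ _) hd.contMDiffOn
    fun p _ => hda p
  choose J hJ hJc h0 ht U hU hpU y hy hs using hsol
  -- By uniqueness, the value at q of the solution chosen for q equals that of the solution chosen
  -- for any q₁ whose domain contains q; the diagonal is therefore a well-defined global solution.
  have key : ∀ q₁ : ℝ × F, ∀ q ∈ J q₁ ×ˢ U q₁, y q q = y q₁ q := by
    rintro q₁ ⟨t, p⟩ ⟨htJ, hp⟩
    exact huniq p (J (t, p) ∩ J q₁) ((hJ _).inter (hJ _)) ((hJc _).inter (hJc _))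
      (fun τ => y (t, p) (τ, p)) (fun τ => y q₁ (τ, p))
      (fun τ hτ => (hs (t, p) p (hpU (t, p))).2 τ hτ.1) (fun τ hτ => (hs q₁ p hp).2 τ hτ.2) 0
      ⟨h0 _, h0 _⟩ (((hs (t, p) p (hpU (t, p))).1).trans (hs q₁ p hp).1.symm) ⟨ht (t, p), htJ⟩
  refine ⟨fun q => y q q, fun q₁ => ?_, fun p => ⟨(hs (0, p) p (hpU (0, p))).1, fun t => ?_⟩⟩
  · have hmem := ((hJ q₁).prod (hU q₁)).mem_nhds (show q₁ ∈ _ from ⟨ht q₁, hpU q₁⟩)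
    refine ((hy q₁).contMDiffAt hmem).congr_of_eventuallyEq ?_
    filter_upwards [hmem] with q hq using key q₁ q hq
  · refine hgerm t p _ _ ?_ ((hs (t, p) p (hpU (t, p))).2 t (ht (t, p)))
    filter_upwards [(hJ (t, p)).mem_nhds (ht (t, p))] with τ hτ
    exact (key (t, p) (τ, p) ⟨hτ, hpU (t, p)⟩).symm

end Gluing

/-! ### The equation W' = aW in a Lie group, with parameters. -/

section GroupODE

variable {EG : Type*} [NormedAddCommGroup EG] [NormedSpace ℝ EG]
  {G : Type*} [TopologicalSpace G] [ChartedSpace EG G] [Group G] [LieGroup 𝓘(ℝ, EG) ∞ G]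
  {F : Type*} [NormedAddCommGroup F] [NormedSpace ℝ F]

omit [LieGroup 𝓘(ℝ, EG) ∞ G] in
lemma contMDiffAt_lchart' [LieGroup 𝓘(ℝ, EG) ∞ G] {g : G}
    (hg : g ∈ (extChartAt 𝓘(ℝ, EG) (1 : G)).source) :
    ContMDiffAt 𝓘(ℝ, EG) 𝓘(ℝ, EG) ∞ (lchart EG) g :=
  haveI : IsManifold 𝓘(ℝ, EG) ∞ G := LieGroup.toContMDiffMul.toIsManifold
  contMDiffAt_extChartAt' (I := 𝓘(ℝ, EG)) (by simpa using hg)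

lemma contMDiffAt_lparam' {x : EG} (hx : x ∈ (extChartAt 𝓘(ℝ, EG) (1 : G)).target) :
    ContMDiffAt 𝓘(ℝ, EG) 𝓘(ℝ, EG) ∞ (lparam G) x :=
  haveI : IsManifold 𝓘(ℝ, EG) ∞ G := LieGroup.toContMDiffMul.toIsManifold
  (contMDiffOn_extChartAt_symm (I := 𝓘(ℝ, EG)) (1 : G)).contMDiffAt
    ((isOpen_extChartAt_target (I := 𝓘(ℝ, EG)) (1 : G)).mem_nhds hx)

lemma contDiffAt_lmul_lone {x : EG} (hx : x ∈ (extChartAt 𝓘(ℝ, EG) (1 : G)).target) :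
    ContDiffAt ℝ ∞ (lmul G) (lone EG G, x) := by
  rw [← contMDiffAt_iff_contDiffAt]
  have h1 : ContMDiffAt 𝓘(ℝ, EG × EG) 𝓘(ℝ, EG) ∞ (fun p : EG × EG => lparam G p.2) (lone EG G, x) :=
    ContMDiffAt.comp (g := lparam G) (f := Prod.snd) (I' := 𝓘(ℝ, EG)) (lone EG G, x) (contMDiffAt_lparam' hx)
      contDiffAt_snd.contMDiffAt
  have h2 : ContMDiffAt 𝓘(ℝ, EG × EG) 𝓘(ℝ, EG) ∞
      (fun p : EG × EG => lparam G p.1 * lparam G p.2) (lone EG G, x) :=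
    (contDiffAt_fst.lparam_comp le_rfl rfl).mul h1
  refine ContMDiffAt.comp (g := lchart EG) (I' := 𝓘(ℝ, EG)) (lone EG G, x) ?_ h2
  refine contMDiffAt_lchart' ?_
  simp only [lparam_lone, one_mul]
  exact (extChartAt 𝓘(ℝ, EG) (1 : G)).map_target hx

/-- A solution in the chart of the group gives a solution in the group. -/
lemma hasRD_lparam {ξ : ℝ → EG} {a : EG} {t : ℝ}
    (ht : ξ t ∈ (extChartAt 𝓘(ℝ, EG) (1 : G)).target)
    (hξ : HasDerivAt ξ (fderiv ℝ (lmul G) (lone EG G, ξ t) (a, 0)) t) :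
    HasRD (fun s => lparam G (ξ s)) (ContinuousLinearMap.toSpanSingleton ℝ a) t := by
  have hT := topologicalGroup_of_smooth EG G inferInstance
  have hψ : ContDiffAt ℝ ∞ (fun x => lchart EG (lparam G x * (lparam G (ξ t))⁻¹)) (ξ t) :=
    ContMDiffAt.lchart_comp le_rfl ((contMDiffAt_lparam' ht).mul contMDiffAt_const) (by simp)
  have hψ' := (hψ.differentiableAt (by simp)).hasFDerivAt
  set ψ : EG → EG := fun x => lchart EG (lparam G x * (lparam G (ξ t))⁻¹) with hψdef
  refine ⟨ContinuousAt.comp (g := lparam G) (f := ξ) (contMDiffAt_lparam' (EG := EG) (G := G) ht).continuousAt hξ.continuousAt, ?_⟩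
  have h1 : HasFDerivAt (fun s => ψ (ξ s)) _ t := hψ'.comp t hξ.hasFDerivAt
  refine h1.congr_fderiv ?_
  have hone : lmul G (lone EG G, ξ t) = ξ t := by
    simp only [lmul, lparam_lone, one_mul]
    exact (extChartAt 𝓘(ℝ, EG) (1 : G)).right_inv ht
  have hm := (contDiffAt_lmul_lone (G := G) ht).differentiableAt (by simp)
  have h2 : HasFDerivAt (fun x => lmul G (x, ξ t)) ((fderiv ℝ (lmul G) (lone EG G, ξ t)).comp
      (ContinuousLinearMap.inl ℝ EG EG)) (lone EG G) :=
    hm.hasFDerivAt.comp (f := fun x => (x, ξ t)) _ (hasFDerivAt_prodMk_left (lone EG G) (ξ t))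
  have h3 : HasFDerivAt (fun x => ψ (lmul G (x, ξ t))) _ (lone EG G) :=
    HasFDerivAt.comp (g := ψ) (lone EG G) (by rw [hone]; exact hψ') h2
  -- ψ undoes right multiplication by the point with coordinate ξ t, so Dψ cancels the first partial
  -- derivative of the multiplication and leaves `a`.
  have h4 : (fun x => ψ (lmul G (x, ξ t))) =ᶠ[𝓝 (lone EG G)] id := by
    have hc : ContinuousAt (fun x => lparam G x * lparam G (ξ t)) (lone EG G) :=
      continuousAt_lparam.mul continuousAt_const
    have hs : (extChartAt 𝓘(ℝ, EG) (1 : G)).source ∈ 𝓝 (lparam G (lone EG G) * lparam G (ξ t)) := by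
      refine (isOpen_extChartAt_source (I := 𝓘(ℝ, EG)) (1 : G)).mem_nhds ?_
      simp only [lparam_lone, one_mul]
      exact (extChartAt 𝓘(ℝ, EG) (1 : G)).map_target ht
    filter_upwards [hc.eventually hs, eventually_lchart_lparam] with x hx hx'
    have : lparam G (lmul G (x, ξ t)) = lparam G x * lparam G (ξ t) :=
      (extChartAt 𝓘(ℝ, EG) (1 : G)).left_inv hx
    simp only [hψdef, this, mul_inv_cancel_right, hx', id]
  have h5 := h3.unique ((hasFDerivAt_id _).congr_of_eventuallyEq h4)
  ext
  simpa using congrArg (fun L => L a) h5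

omit [LieGroup 𝓘(ℝ, EG) ∞ G] in
lemma eq_of_hasDerivAt_zero {E : Type*} [NormedAddCommGroup E] [NormedSpace ℝ E] {f : ℝ → E}
    {s : Set ℝ} (hs : IsOpen s) (hs' : s.OrdConnected) (h : ∀ t ∈ s, HasDerivAt f 0 t) {a b : ℝ}
    (ha : a ∈ s) (hb : b ∈ s) : f a = f b :=
  hs'.convex.is_const_of_fderivWithin_eq_zero (𝕜 := ℝ)
    (fun x hx => (h x hx).differentiableAt.differentiableWithinAt)
    (fun x hx => by
      rw [fderivWithin_of_isOpen hs hx, (h x hx).hasFDerivAt.fderiv]; ext; simp) ha hb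

/-- Time and parameters are added to the state with velocity (1, 0), which makes the equation
autonomous in the chart of the group; its local flow then depends on the parameters to order n. -/
lemma exists_local_group_solution [CompleteSpace EG] [CompleteSpace F] (n : ℕ) {a : ℝ × F → EG}
    (ha : ContDiff ℝ ∞ a)
    (t₁ : ℝ) (p₁ : F) : ∃ ε > 0, ∃ W : ℝ × F → G,
      ContMDiffOn 𝓘(ℝ, ℝ × F) 𝓘(ℝ, EG) n W (Ioo (t₁ - ε) (t₁ + ε) ×ˢ Metric.ball p₁ ε) ∧
      ∀ p ∈ Metric.ball p₁ ε, ∀ t ∈ Ioo (t₁ - ε) (t₁ + ε),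
        HasRD (fun t => W (t, p)) (ContinuousLinearMap.toSpanSingleton ℝ (a (t, p))) t := by
  set T := (extChartAt 𝓘(ℝ, EG) (1 : G)).target with hT
  have hTo : IsOpen T := isOpen_extChartAt_target (I := 𝓘(ℝ, EG)) (1 : G)
  have hT1 : lone EG G ∈ T := mem_extChartAt_target (I := 𝓘(ℝ, EG)) (1 : G)
  set v : (ℝ × F) × EG → (ℝ × F) × EG := fun z =>
    ((1, 0), fderiv ℝ (lmul G) (lone EG G, z.2) (a z.1, 0)) with hv
  have hvs : ContDiffOn ℝ ∞ v (univ ×ˢ T) := by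
    rintro ⟨q, ξ⟩ ⟨-, hξ⟩
    refine ContDiffAt.contDiffWithinAt (contDiffAt_const.prodMk (ContDiffAt.clm_apply ?_ ?_))
    · exact ((contDiffAt_lmul_lone hξ).fderiv_right (m := ∞) (by simp)).comp
        (f := fun z : (ℝ × F) × EG => (lone EG G, z.2)) (q, ξ) (contDiffAt_const.prodMk contDiffAt_snd)
    · exact (ha.contDiffAt.comp (q, ξ) contDiffAt_fst).prodMk contDiffAt_const
  obtain ⟨ε, hε, Φ, hΦ, hc⟩ := hasLocalFlow n (z₀ := ((t₁, p₁), lone EG G))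
    (isOpen_univ.prod hTo) ⟨mem_univ _, hT1⟩ hvs
  have hin : ∀ p ∈ Metric.ball p₁ ε, ((t₁, p), lone EG G) ∈ Metric.ball ((t₁, p₁), lone EG G) ε := by
    intro p hp
    rw [← ball_prod_same, ← ball_prod_same]
    exact ⟨⟨Metric.mem_ball_self hε, hp⟩, Metric.mem_ball_self hε⟩
  set ξ : ℝ × F → EG := fun q => (Φ (((t₁, q.2), lone EG G), q.1 - t₁)).2 with hξ
  have hsub : ∀ t ∈ Ioo (t₁ - ε) (t₁ + ε), t - t₁ ∈ Ioo (-ε) ε := fun t ht =>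
    ⟨by linarith [ht.1], by linarith [ht.2]⟩
  have hξT : ∀ p ∈ Metric.ball p₁ ε, ∀ t ∈ Ioo (t₁ - ε) (t₁ + ε), ξ (t, p) ∈ T := fun p hp t ht =>
    ((hΦ _ (hin p hp)).2 _ (hsub t ht)).1.2
  refine ⟨ε, hε, fun q => lparam G (ξ q), ?_, fun p hp t ht => ?_⟩
  · have h1 : ContMDiffOn 𝓘(ℝ, ℝ × F) 𝓘(ℝ, EG) n ξ (Ioo (t₁ - ε) (t₁ + ε) ×ˢ Metric.ball p₁ ε) := by
      refine ContDiffOn.contMDiffOn (ContDiffOn.snd (hc.comp (ContDiff.contDiffOn ?_) ?_))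
      · fun_prop
      · rintro ⟨t, p⟩ ⟨ht, hp⟩
        exact ⟨hin p hp, hsub t ht⟩
    have h2 : ContMDiffOn 𝓘(ℝ, EG) 𝓘(ℝ, EG) n (lparam G) T := fun x hx =>
      ((contMDiffAt_lparam' hx).of_le (by exact_mod_cast le_top)).contMDiffWithinAt
    exact h2.comp h1 fun q hq => hξT q.2 hq.2 q.1 hq.1
  · have hd : ∀ t ∈ Ioo (t₁ - ε) (t₁ + ε), HasDerivAt (fun t => Φ (((t₁, p), lone EG G), t - t₁))
        (v (Φ (((t₁, p), lone EG G), t - t₁))) t := fun t ht => by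
      simpa using (((hΦ _ (hin p hp)).2 _ (hsub t ht)).2).comp_sub_const t t₁
    have hfst : (Φ (((t₁, p), lone EG G), t - t₁)).1 = (t, p) := by
      have h1 := eq_of_hasDerivAt_zero isOpen_Ioo ordConnected_Ioo
        (f := fun t => (Φ (((t₁, p), lone EG G), t - t₁)).1 - (t, p))
        (fun s hs => by
          have h0 := HasFDerivAt.comp_hasDerivAt (f := fun t => Φ (((t₁, p), lone EG G), t - t₁)) s
            (hasFDerivAt_fst (𝕜 := ℝ)) (hd s hs)
          have := HasDerivAt.fun_sub h0 ((hasDerivAt_id s).prodMk (hasDerivAt_const s p))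
          refine HasDerivAt.congr_deriv this ?_
          simp [hv]) ht (show t₁ ∈ Ioo (t₁ - ε) (t₁ + ε) from ⟨by linarith, by linarith⟩)
      simpa [(hΦ _ (hin p hp)).1, sub_eq_zero] using h1
    have h2 := (hd t ht).snd
    refine hasRD_lparam (hξT p hp t ht) ?_
    convert! h2 using 1
    simp only [hv, hfst]
    rfl

/-- Two solutions of W' = aW differ by a right factor: c⁻¹c' has zero derivative, hence is constant.
-/
lemma HasRD.eqOn_of_eq [T2Space G] {a : ℝ → EG} {c c' : ℝ → G} {J : Set ℝ} (hJ : J.OrdConnected)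
    (hc : ∀ t ∈ J, HasRD c (ContinuousLinearMap.toSpanSingleton ℝ (a t)) t)
    (hc' : ∀ t ∈ J, HasRD c' (ContinuousLinearMap.toSpanSingleton ℝ (a t)) t) {t₀ : ℝ} (ht₀ : t₀ ∈ J)
    (h : c t₀ = c' t₀) : EqOn c c' J := by
  have h1 : ∀ t ∈ J, HasRD (fun t => (c t)⁻¹ * c' t) (0 : ℝ →L[ℝ] EG) t := by
    intro t ht
    have := (hc t ht).inv.mul (hc' t ht)
    simpa using this
  have h2 : ∀ s ∈ J, ∀ t ∈ J, s ≤ t → (c s)⁻¹ * c' s = (c t)⁻¹ * c' t := by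
    intro s hs t ht hst
    exact HasRD.eq_of_zero (W := fun t => (c t)⁻¹ * c' t) hst
      (fun r hr => (h1 r (hJ.out hs ht hr)).1.continuousWithinAt)
      fun r hr => h1 r (hJ.out hs ht (Ioo_subset_Icc_self hr))
  intro t ht
  have h3 : (c t)⁻¹ * c' t = (c t₀)⁻¹ * c' t₀ := by
    rcases le_total t t₀ with h' | h'
    · exact h2 t ht t₀ ht₀ h'
    · exact (h2 t₀ ht₀ t ht h').symm
  rw [h, inv_mul_cancel] at h3
  exact (inv_mul_eq_one.1 h3)

/-- The equation `dW/dt = a W` in a Lie group, with parameters. -/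
theorem exists_group_solution [CompleteSpace EG] [CompleteSpace F] [T2Space G] {a : ℝ × F → EG}
    (ha : ContDiff ℝ ∞ a) :
    ∃ W : ℝ × F → G, ContMDiff 𝓘(ℝ, ℝ × F) 𝓘(ℝ, EG) ∞ W ∧ (∀ p, W (0, p) = 1) ∧
      ∀ p t, HasRD (fun t => W (t, p)) (ContinuousLinearMap.toSpanSingleton ℝ (a (t, p))) t := by
  -- The domain of the local flow may shrink with n, so a global C^n solution is built for each n
  -- separately.
  have hn : ∀ n : ℕ, ∃ W : ℝ × F → G, ContMDiff 𝓘(ℝ, ℝ × F) 𝓘(ℝ, EG) n W ∧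
      ∀ p, W (0, p) = 1 ∧
      ∀ t, HasRD (fun t => W (t, p)) (ContinuousLinearMap.toSpanSingleton ℝ (a (t, p))) t := by
    intro n
    have hG : LieGroup 𝓘(ℝ, EG) n G := LieGroup.of_le (n := ∞) (by exact_mod_cast le_top)
    refine exists_global_solution (d := fun _ => (1 : G)) (Adm := fun _ _ _ => True)
      (Q := fun t p c => HasRD c (ContinuousLinearMap.toSpanSingleton ℝ (a (t, p))) t)
      (fun t p c c' h h' => h'.congr h.symm)
      (fun p J _ hJ c c' hc hc' t₀ ht₀ h => HasRD.eqOn_of_eq hJ hc hc' ht₀ h)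
      (fun _ _ _ _ => trivial) ?_ contMDiff_const (fun _ => trivial)
    intro t₁ p₁
    obtain ⟨ε, hε, W, hW, hW'⟩ := exists_local_group_solution (G := G) n ha t₁ p₁
    have hloc : ∀ s ∈ Ioo (t₁ - ε) (t₁ + ε), ∀ t ∈ Ioo (t₁ - ε) (t₁ + ε),
        SolvableBetween (EY := EG) n
          (fun t p (c : ℝ → G) => HasRD c (ContinuousLinearMap.toSpanSingleton ℝ (a (t, p))) t)
          (fun _ _ _ => True) p₁ s t := by
      intro s hs t ht d U₀ hU₀ hp₁ hd _
      -- Right multiplication by a factor independent of time preserves the equation; this factor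
      -- adjusts the value at time s to the prescribed datum.
      refine ⟨Ioo (t₁ - ε) (t₁ + ε), isOpen_Ioo, ordConnected_Ioo, hs, ht, U₀ ∩ Metric.ball p₁ ε,
        hU₀.inter Metric.isOpen_ball, ⟨hp₁, Metric.mem_ball_self hε⟩,
        fun q => W q * ((W (s, q.2))⁻¹ * d q.2), ?_, fun p hp => ⟨by simp, fun τ hτ => ?_⟩⟩
      · have h1 : ContMDiffOn 𝓘(ℝ, ℝ × F) 𝓘(ℝ, ℝ × F) n (fun q : ℝ × F => (s, q.2))
            (Ioo (t₁ - ε) (t₁ + ε) ×ˢ (U₀ ∩ Metric.ball p₁ ε)) :=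
          (ContDiff.contMDiff (by fun_prop)).contMDiffOn
        have h2 : ContMDiffOn 𝓘(ℝ, ℝ × F) 𝓘(ℝ, F) n (fun q : ℝ × F => q.2)
            (Ioo (t₁ - ε) (t₁ + ε) ×ˢ (U₀ ∩ Metric.ball p₁ ε)) :=
          (ContDiff.contMDiff (by fun_prop)).contMDiffOn
        exact (hW.mono (prod_mono subset_rfl inter_subset_right)).mul
          ((hW.comp h1 fun q hq => ⟨hs, hq.2.2⟩).inv.mul (hd.comp h2 fun q hq => hq.2.1))
      · have hT := topologicalGroup_of_smooth EG G inferInstance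
        exact (hW' p hp.2 τ hτ).mul_const _
    have ht₁ : t₁ ∈ Ioo (t₁ - ε) (t₁ + ε) := ⟨by linarith, by linarith⟩
    filter_upwards [Ioo_mem_nhds ht₁.1 ht₁.2] with t ht
    exact ⟨hloc t₁ ht₁ t ht, hloc t ht t₁ ht₁⟩
  choose W hW hW' using hn
  -- Uniqueness identifies the solutions for all n, so a single one is of class C^n for every n.
  have heq : ∀ n, W n = W 0 := by
    intro n
    ext ⟨t, p⟩
    exact HasRD.eqOn_of_eq ordConnected_univ (fun t _ => (hW' n p).2 t) (fun t _ => (hW' 0 p).2 t)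
      (mem_univ 0) ((hW' n p).1.trans (hW' 0 p).1.symm) (mem_univ t)
  refine ⟨W 0, contMDiff_infty.2 fun n => ?_, fun p => (hW' 0 p).1, fun p => (hW' 0 p).2⟩
  rw [← heq n]; exact hW n

end GroupODE

/-! ### Pullbacks of differential forms under maps from a vector space. -/

section Pullback

variable {E : Type*} [NormedAddCommGroup E] [NormedSpace ℝ E]
  {X : Type*} [TopologicalSpace X] [ChartedSpace E X]
  {V : Type*} [NormedAddCommGroup V] [NormedSpace ℝ V]
  {F : Type*} [NormedAddCommGroup F] [NormedSpace ℝ F]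
  {F' : Type*} [NormedAddCommGroup F'] [NormedSpace ℝ F']

/-- The pullback of a form under a map from a vector space. -/
def VForm.pull {n : ℕ} (α : VForm E X V n) (y : F → X) (q : F) : F [⋀^Fin n]→L[ℝ] V :=
  (α (y q) : E [⋀^Fin n]→L[ℝ] V).compContinuousLinearMap
    (mfderiv 𝓘(ℝ, F) 𝓘(ℝ, E) y q : F →L[ℝ] E)

lemma VForm.pull_one (α : VForm E X V 1) (y : F → X) (q v : F) :
    α.pull y q ![v] = α (y q) ![mfderiv 𝓘(ℝ, F) 𝓘(ℝ, E) y q v] :=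
  congrArg (α (y q) : E [⋀^Fin 1]→L[ℝ] V) (by ext i; fin_cases i; rfl)

lemma VForm.pull_two (α : VForm E X V 2) (y : F → X) (q v w : F) :
    α.pull y q ![v, w] =
      α (y q) ![mfderiv 𝓘(ℝ, F) 𝓘(ℝ, E) y q v, mfderiv 𝓘(ℝ, F) 𝓘(ℝ, E) y q w] :=
  congrArg (α (y q) : E [⋀^Fin 2]→L[ℝ] V) (by ext i; fin_cases i <;> rfl)

lemma VForm.congr_point {n : ℕ} (α : VForm E X V n) {p p' : X} (h : p = p') :
    (α p : E [⋀^Fin n]→L[ℝ] V) = α p' := by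
  subst h; rfl

lemma VForm.pull_congr {n : ℕ} (α : VForm E X V n) {y y' : F → X} {q : F} (h : y =ᶠ[𝓝 q] y') :
    α.pull y q = α.pull y' q := by
  have h1 : (α (y q) : E [⋀^Fin n]→L[ℝ] V) = α (y' q) :=
    α.congr_point h.eq_of_nhds
  have h2 : (mfderiv 𝓘(ℝ, F) 𝓘(ℝ, E) y q : F →L[ℝ] E) = mfderiv 𝓘(ℝ, F) 𝓘(ℝ, E) y' q :=
    h.mfderiv_eq
  exact congrArg₂ ContinuousAlternatingMap.compContinuousLinearMap h1 h2

lemma VForm.pull_eq_of_hasMFDerivAt {n : ℕ} (α : VForm E X V n) {y : F → X} {q : F} {Y : F →L[ℝ] E}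
    (h : HasMFDerivAt 𝓘(ℝ, F) 𝓘(ℝ, E) y q Y) :
    α.pull y q = (α (y q) : E [⋀^Fin n]→L[ℝ] V).compContinuousLinearMap Y :=
  congrArg (ContinuousAlternatingMap.compContinuousLinearMap (α (y q) : E [⋀^Fin n]→L[ℝ] V)) h.mfderiv

lemma VForm.pull_one_of_hasMFDerivAt (α : VForm E X V 1) {y : F → X} {q : F} {Y : F →L[ℝ] E}
    (h : HasMFDerivAt 𝓘(ℝ, F) 𝓘(ℝ, E) y q Y) (v : F) :
    α.pull y q ![v] = (α (y q) : E [⋀^Fin 1]→L[ℝ] V) ![Y v] :=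
  (congrArg (fun f : F [⋀^Fin 1]→L[ℝ] V => f ![v]) (α.pull_eq_of_hasMFDerivAt h)).trans
    (congrArg (α (y q) : E [⋀^Fin 1]→L[ℝ] V) (by ext i; fin_cases i; rfl))

lemma VForm.pull_two_of_hasMFDerivAt (α : VForm E X V 2) {y : F → X} {q : F} {Y : F →L[ℝ] E}
    (h : HasMFDerivAt 𝓘(ℝ, F) 𝓘(ℝ, E) y q Y) (v w : F) :
    α.pull y q ![v, w] = (α (y q) : E [⋀^Fin 2]→L[ℝ] V) ![Y v, Y w] :=
  (congrArg (fun f : F [⋀^Fin 2]→L[ℝ] V => f ![v, w]) (α.pull_eq_of_hasMFDerivAt h)).trans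
    (congrArg (α (y q) : E [⋀^Fin 2]→L[ℝ] V) (by ext i; fin_cases i <;> rfl))

lemma VForm.pull_comp {n : ℕ} (α : VForm E X V n) {y : F → X} {h : F' → F} {q : F'} {H : F' →L[ℝ] F}
    (hy : MDifferentiableAt 𝓘(ℝ, F) 𝓘(ℝ, E) y (h q)) (hh : HasFDerivAt h H q) :
    α.pull (fun q => y (h q)) q = (α.pull y (h q)).compContinuousLinearMap H := by
  have := HasMFDerivAt.comp q hy.hasMFDerivAt hh.hasMFDerivAt
  rw [α.pull_eq_of_hasMFDerivAt (y := fun q => y (h q)) this]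
  rfl

variable [IsManifold 𝓘(ℝ, E) ∞ X]

lemma contDiffAt_extChartAt_comp {n : ℕ∞ω} (hn : n ≤ ∞) {y : F → X} {q : F} {p₀ : X} (hp : y q ∈ (extChartAt 𝓘(ℝ, E) p₀).source)
    (hy : ContMDiffAt 𝓘(ℝ, F) 𝓘(ℝ, E) n y q) :
    ContDiffAt ℝ n (fun q => extChartAt 𝓘(ℝ, E) p₀ (y q)) q := by
  rw [← contMDiffAt_iff_contDiffAt]
  exact ((contMDiffAt_extChartAt' (I := 𝓘(ℝ, E)) (n := ∞) (by simpa using hp)).of_le hn).comp q hy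

/-- Writing y as φ⁻¹∘(φ∘y) turns the pullback into one between vector spaces, where smoothness and
exterior derivatives are available. -/
lemma VForm.pull_eq_inChart {n : ℕ} (α : VForm E X V n) {y : F → X} {q : F} (p₀ : X)
    (hp : y q ∈ (extChartAt 𝓘(ℝ, E) p₀).source) (hy : MDifferentiableAt 𝓘(ℝ, F) 𝓘(ℝ, E) y q) :
    α.pull y q = (α.inChart p₀ (extChartAt 𝓘(ℝ, E) p₀ (y q))).compContinuousLinearMap
      (fderiv ℝ (fun q => extChartAt 𝓘(ℝ, E) p₀ (y q)) q) := by
  set φ := extChartAt 𝓘(ℝ, E) p₀ with hφ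
  have h1 : HasMFDerivAt 𝓘(ℝ, E) 𝓘(ℝ, E) φ (y q) (mfderiv 𝓘(ℝ, E) 𝓘(ℝ, E) φ (y q)) :=
    ((contMDiffAt_extChartAt' (I := 𝓘(ℝ, E)) (n := ∞) (by simpa [hφ] using hp)).mdifferentiableAt
      (by simp)).hasMFDerivAt
  have h2 := h1.comp q hy.hasMFDerivAt
  have h3 : DifferentiableAt ℝ (fun q => φ (y q)) q := h2.mdifferentiableAt.differentiableAt
  obtain ⟨S, hS⟩ : ∃ S : E →L[ℝ] E, HasMFDerivAt 𝓘(ℝ, E) 𝓘(ℝ, E) φ.symm (φ (y q)) S :=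
    ⟨_, (((contMDiffOn_extChartAt_symm (I := 𝓘(ℝ, E)) (n := ∞) p₀).contMDiffAt
      ((isOpen_extChartAt_target (I := 𝓘(ℝ, E)) p₀).mem_nhds (φ.map_source hp))).mdifferentiableAt
      (by simp)).hasMFDerivAt⟩
  have h4 : HasMFDerivAt 𝓘(ℝ, F) 𝓘(ℝ, E) (fun q => φ.symm (φ (y q))) q
      (S.comp (fderiv ℝ (fun q => φ (y q)) q)) :=
    HasMFDerivAt.comp (g := φ.symm) (f := fun q => φ (y q)) q hS h3.hasFDerivAt.hasMFDerivAt
  have h5 : HasMFDerivAt 𝓘(ℝ, F) 𝓘(ℝ, E) y q (S.comp (fderiv ℝ (fun q => φ (y q)) q)) := by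
    refine (HasMFDerivAt.congr_of_eventuallyEq h4 ?_)
    filter_upwards [hy.continuousAt.eventually
      ((isOpen_extChartAt_source (I := 𝓘(ℝ, E)) p₀).mem_nhds hp)] with q' hq'
    exact (φ.left_inv hq').symm
  rw [α.pull_eq_of_hasMFDerivAt h5]
  have h6 : (α (y q) : E [⋀^Fin n]→L[ℝ] V) = α (φ.symm (φ (y q))) :=
    α.congr_point (φ.left_inv hp).symm
  have h7 : (mfderiv 𝓘(ℝ, E) 𝓘(ℝ, E) φ.symm (φ (y q)) : E →L[ℝ] E) = S := hS.mfderiv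
  have h8 : α.inChart p₀ (φ (y q)) =
      (α (φ.symm (φ (y q))) : E [⋀^Fin n]→L[ℝ] V).compContinuousLinearMap S :=
    congrArg (ContinuousAlternatingMap.compContinuousLinearMap _) h7
  rw [h6, h8]
  rfl

lemma ContMDiffAt.eventually_mdifferentiableAt {n : ℕ∞ω} (hn : 1 ≤ n) {y : F → X} {q : F}
    (hy : ContMDiffAt 𝓘(ℝ, F) 𝓘(ℝ, E) n y q) :
    ∀ᶠ q' in 𝓝 q, MDifferentiableAt 𝓘(ℝ, F) 𝓘(ℝ, E) y q' := by
  have : IsManifold 𝓘(ℝ, E) 1 X := IsManifold.of_le (n := ∞) (by exact_mod_cast le_top)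
  filter_upwards [(contMDiffAt_iff_contMDiffAt_nhds (n := 1) (by simp)).1 (hy.of_le hn)] with q' hq'
  exact hq'.mdifferentiableAt one_ne_zero

lemma VForm.eventually_pull_eq {n : ℕ} (α : VForm E X V n) {y : F → X} {q : F}
    (hy : ContMDiffAt 𝓘(ℝ, F) 𝓘(ℝ, E) ∞ y q) : ∀ᶠ q' in 𝓝 q,
    α.pull y q' = (α.inChart (y q) (extChartAt 𝓘(ℝ, E) (y q) (y q'))).compContinuousLinearMap
      (fderiv ℝ (fun q'' => extChartAt 𝓘(ℝ, E) (y q) (y q'')) q') := by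
  filter_upwards [hy.eventually_mdifferentiableAt (by exact_mod_cast le_top),
    hy.continuousAt.eventually ((isOpen_extChartAt_source (I := 𝓘(ℝ, E)) (y q)).mem_nhds
      (mem_extChartAt_source (I := 𝓘(ℝ, E)) (y q)))] with q' h1 h2
  exact α.pull_eq_inChart (y q) h2 h1

lemma contDiffAt_continuousAlternatingMap_apply [CompleteSpace V] {n : ℕ} {f : F → E [⋀^Fin n]→L[ℝ] V}
    {v : F → Fin n → E} {q : F} {k : ℕ∞ω} (hf : ContDiffAt ℝ k f q) (hv : ContDiffAt ℝ k v q) :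
    ContDiffAt ℝ k (fun q => f q (v q)) q := by
  have h := ContinuousLinearMap.analyticAt_uncurry_of_multilinear (x := (f q, v q))
    (ContinuousAlternatingMap.toContinuousMultilinearMapCLM ℝ :
      (E [⋀^Fin n]→L[ℝ] V) →L[ℝ] _)
  exact (h.contDiffAt (n := k)).comp q (hf.prodMk hv)

omit [IsManifold 𝓘(ℝ, E) ∞ X] in
lemma VForm.IsSmooth.contDiffAt_inChart {n : ℕ} {α : VForm E X V n} (hα : α.IsSmooth) (p : X) :
    ContDiffAt ℝ ∞ (α.inChart p) (extChartAt 𝓘(ℝ, E) p p) :=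
  (hα p).contDiffAt ((isOpen_extChartAt_target (I := 𝓘(ℝ, E)) p).mem_nhds
    (mem_extChartAt_target (I := 𝓘(ℝ, E)) p))

lemma VForm.IsSmooth.contDiffAt_pull [CompleteSpace V] {n : ℕ} {α : VForm E X V n} (hα : α.IsSmooth) {y : F → X}
    {q : F} (hy : ContMDiffAt 𝓘(ℝ, F) 𝓘(ℝ, E) ∞ y q) (v : Fin n → F) :
    ContDiffAt ℝ ∞ (fun q => α.pull y q v) q := by
  have hu := contDiffAt_extChartAt_comp le_rfl (mem_extChartAt_source (I := 𝓘(ℝ, E)) (y q)) hy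
  refine ContDiffAt.congr_of_eventuallyEq (f := fun q' =>
    (α.inChart (y q) (extChartAt 𝓘(ℝ, E) (y q) (y q'))) fun i =>
      fderiv ℝ (fun q'' => extChartAt 𝓘(ℝ, E) (y q) (y q'')) q' (v i)) ?_ ?_
  · exact contDiffAt_continuousAlternatingMap_apply
      (ContDiffAt.comp (g := α.inChart (y q)) q (hα.contDiffAt_inChart (y q)) hu)
      (contDiffAt_pi.2 fun i => (hu.fderiv_right (m := ∞) (by simp)).clm_apply contDiffAt_const)
  · filter_upwards [α.eventually_pull_eq hy] with q' hq'
    rw [hq']; rfl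

lemma VForm.IsSmooth.contDiff_pull [CompleteSpace V] {n : ℕ} {α : VForm E X V n} (hα : α.IsSmooth) {y : F → X}
    (hy : ContMDiff 𝓘(ℝ, F) 𝓘(ℝ, E) ∞ y) (v : Fin n → F) :
    ContDiff ℝ ∞ (fun q => α.pull y q v) :=
  contDiff_iff_contDiffAt.2 fun q => hα.contDiffAt_pull (hy q) v

/-- The exterior derivative of the pullback of a smooth form. -/
lemma VForm.IsSmooth.extDer_pull {α : VForm E X V 1} (hα : α.IsSmooth) {y : F → X}
    {q : F} (hy : ContMDiffAt 𝓘(ℝ, F) 𝓘(ℝ, E) ∞ y q) (v w : F) :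
    α.extDer (y q) ![mfderiv 𝓘(ℝ, F) 𝓘(ℝ, E) y q v, mfderiv 𝓘(ℝ, F) 𝓘(ℝ, E) y q w] =
      fderiv ℝ (fun q => α.pull y q ![w]) q v - fderiv ℝ (fun q => α.pull y q ![v]) q w := by
  set φ := extChartAt 𝓘(ℝ, E) (y q) with hφ
  have hu := contDiffAt_extChartAt_comp le_rfl (mem_extChartAt_source (I := 𝓘(ℝ, E)) (y q)) hy
  have hω := (hα.contDiffAt_inChart (y q)).differentiableAt (by simp)
  set u := fun q' => φ (y q') with hudef
  have hpull : α.pull y =ᶠ[𝓝 q] fun q' => (α.inChart (y q) (u q')).compContinuousLinearMap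
      (fderiv ℝ u q') := α.eventually_pull_eq hy
  -- Naturality of the exterior derivative is applied to the coordinate expression u = φ∘y of the
  -- map.
  have h1 := extDeriv_pullback (f := u) (x := q) hω hu
    minSmoothness_two_le
  rw [← hpull.extDeriv_eq] at h1
  have hd : DifferentiableAt ℝ (α.pull y) q := by
    refine DifferentiableAt.congr_of_eventuallyEq ?_ hpull
    have h2 : DifferentiableAt ℝ (fun q' => α.inChart (y q) (u q')) q :=
      DifferentiableAt.comp (g := α.inChart (y q)) (f := u) q hω (hu.differentiableAt (by simp))
    have h3 : DifferentiableAt ℝ (fderiv ℝ u) q :=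
      (hu.fderiv_right (m := ∞) (by simp)).differentiableAt (by simp)
    exact (h2.hasFDerivAt.continuousAlternatingMapCompContinuousLinearMap
      h3.hasFDerivAt).differentiableAt
  have h4 : extDeriv (α.pull y) q ![v, w] =
      fderiv ℝ (fun q => α.pull y q ![w]) q v - fderiv ℝ (fun q => α.pull y q ![v]) q w := by
    rw [extDeriv_apply hd, Fin.sum_univ_two]
    have e0 : (0 : Fin 2).removeNth ![v, w] = ![w] := by ext i; fin_cases i; rfl
    have e1 : (1 : Fin 2).removeNth ![v, w] = ![v] := by ext i; fin_cases i; rfl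
    rw [e0, e1]
    simp [sub_eq_add_neg]
  rw [← h4, h1]
  have h5 : HasMFDerivAt 𝓘(ℝ, E) 𝓘(ℝ, E) φ (y q) (mfderiv 𝓘(ℝ, E) 𝓘(ℝ, E) φ (y q)) :=
    ((contMDiffAt_extChartAt (I := 𝓘(ℝ, E)) (n := ∞)).mdifferentiableAt
      (by simp)).hasMFDerivAt
  have h6 := (h5.comp q (hy.mdifferentiableAt (by simp)).hasMFDerivAt).mfderiv
  have h7 : ∀ z, (mfderiv 𝓘(ℝ, E) 𝓘(ℝ, E) φ (y q) (mfderiv 𝓘(ℝ, F) 𝓘(ℝ, E) y q z) : E) =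
      fderiv ℝ u q z := fun z =>
    (congrArg (fun L : F →L[ℝ] E => L z) h6).symm.trans
      (congrArg (fun L : F →L[ℝ] E => L z) mfderiv_eq_fderiv)
  refine congrArg (extDeriv (α.inChart (y q)) (u q)) ?_
  ext i
  fin_cases i
  · exact h7 v
  · exact h7 w

end Pullback

/-! ### Infinitesimal action on the bundle and the gauge transformation laws. -/

section BundleCalculus

variable {EG EM EP : Type*}
  [NormedAddCommGroup EG] [NormedSpace ℝ EG] [NormedAddCommGroup EM] [NormedSpace ℝ EM]
  [NormedAddCommGroup EP] [NormedSpace ℝ EP]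
  {G M P : Type*} [TopologicalSpace G] [ChartedSpace EG G] [Group G]
  [TopologicalSpace M] [ChartedSpace EM M] [TopologicalSpace P] [ChartedSpace EP P]
  {F : Type*} [NormedAddCommGroup F] [NormedSpace ℝ F]

lemma alternating_one_add {E V : Type*} [NormedAddCommGroup E] [NormedSpace ℝ E]
    [NormedAddCommGroup V] [NormedSpace ℝ V] (f : E [⋀^Fin 1]→L[ℝ] V) (x y : E) :
    f ![x + y] = f ![x] + f ![y] :=
  f.vecCons_add ![] x y

lemma alternating_two_add {E V : Type*} [NormedAddCommGroup E] [NormedSpace ℝ E]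
    [NormedAddCommGroup V] [NormedSpace ℝ V] (f : E [⋀^Fin 2]→L[ℝ] V) (x y z : E) :
    f ![x + y, z] = f ![x, z] + f ![y, z] :=
  f.vecCons_add ![z] x y

lemma alternating_one_smul {E V : Type*} [NormedAddCommGroup E] [NormedSpace ℝ E]
    [NormedAddCommGroup V] [NormedSpace ℝ V] (f : E [⋀^Fin 1]→L[ℝ] V) (c : ℝ) (x : E) :
    f ![c • x] = c • f ![x] :=
  f.vecCons_smul ![] c x

lemma alternating_two_smul {E V : Type*} [NormedAddCommGroup E] [NormedSpace ℝ E]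
    [NormedAddCommGroup V] [NormedSpace ℝ V] (f : E [⋀^Fin 2]→L[ℝ] V) (c : ℝ) (x y : E) :
    f ![c • x, y] = c • f ![x, y] :=
  f.vecCons_smul ![y] c x

lemma alternating_two_swap {E V : Type*} [NormedAddCommGroup E] [NormedSpace ℝ E]
    [NormedAddCommGroup V] [NormedSpace ℝ V] (f : E [⋀^Fin 2]→L[ℝ] V) (x y : E) :
    f ![x, y] = - f ![y, x] := by
  have : f (![y, x] ∘ Equiv.swap 0 1) = - f ![y, x] :=
    f.map_swap ![y, x] (show (0 : Fin 2) ≠ 1 by simp)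
  rw [← this]
  congr 1
  ext i; fin_cases i <;> simp

lemma alternating_two_self {E V : Type*} [NormedAddCommGroup E] [NormedSpace ℝ E]
    [NormedAddCommGroup V] [NormedSpace ℝ V] (f : E [⋀^Fin 2]→L[ℝ] V) (x : E) :
    f ![x, x] = 0 :=
  f.map_eq_zero_of_eq ![x, x] (i := 0) (j := 1) rfl (by simp)

lemma HasMFDerivAt.of_eq' {E H E' H' : Type*} [NormedAddCommGroup E] [NormedSpace ℝ E]
    [TopologicalSpace H] {I : ModelWithCorners ℝ E H} [NormedAddCommGroup E'] [NormedSpace ℝ E']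
    [TopologicalSpace H'] {I' : ModelWithCorners ℝ E' H'}
    {N : Type*} [TopologicalSpace N] [ChartedSpace H N]
    {N' : Type*} [TopologicalSpace N'] [ChartedSpace H' N'] {f : N → N'} {x y : N}
    {L : E →L[ℝ] E'} (h : HasMFDerivAt I I' f y L) (hxy : x = y) :
    HasMFDerivAt I I' f x L := by
  subst hxy; exact h

lemma HasRD.hasMFDerivAt_mul_inv [LieGroup 𝓘(ℝ, EG) ∞ G] {W : F → G} {L : F →L[ℝ] EG} {q : F}
    (h : HasRD W L q) : HasMFDerivAt 𝓘(ℝ, F) 𝓘(ℝ, EG) (fun q' => W q' * (W q)⁻¹) q L := by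
  have := topologicalGroup_of_smooth EG G inferInstance
  exact hasMFDerivAt_of_hasFDerivAt_lchart (by simp) (h.1.mul continuousAt_const)
      (by simpa only [extChartAt_model_space_eq_id, PartialEquiv.refl_coe, PartialEquiv.refl_symm, id]
        using h.2)

namespace PrincipalBundle

variable (S : PrincipalBundle EG EM EP G M P)

/-- The derivative of the right translation, as a linear map. -/
def translateL (g : G) (p : P) : EP →L[ℝ] EP := mfderiv 𝓘(ℝ, EP) 𝓘(ℝ, EP) (fun q => S.act q g) p

/-- The fundamental vector fields, as a linear map. -/
def fundamentalL (p : P) : EG →L[ℝ] EP := mfderiv 𝓘(ℝ, EG) 𝓘(ℝ, EP) (fun g : G => S.act p g) 1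

lemma contMDiff_act_left (g : G) : ContMDiff 𝓘(ℝ, EP) 𝓘(ℝ, EP) ∞ fun p => S.act p g :=
  S.contMDiff_act.comp (contMDiff_id.prodMk contMDiff_const)

lemma hasMFDerivAt_translateL (g : G) (p : P) :
    HasMFDerivAt 𝓘(ℝ, EP) 𝓘(ℝ, EP) (fun q => S.act q g) p (S.translateL g p) :=
  ((S.contMDiff_act_left g).mdifferentiable (by simp) p).hasMFDerivAt

lemma hasMFDerivAt_fundamentalL (p : P) :
    HasMFDerivAt 𝓘(ℝ, EG) 𝓘(ℝ, EP) (fun g : G => S.act p g) 1 (S.fundamentalL p) :=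
  (((S.contMDiff_act.comp (contMDiff_const.prodMk contMDiff_id)).mdifferentiable (by simp)
    (1 : G)) : MDifferentiableAt 𝓘(ℝ, EG) 𝓘(ℝ, EP) (fun g : G => S.act p g) 1).hasMFDerivAt

/-- Factor the action of g(q') as that of g(q')g(q)⁻¹ followed by translation by g(q). The first
factor passes through 1, where the action has derivative the identity along P and the fundamental
fields along G. -/
lemma hasMFDerivAt_act [LieGroup 𝓘(ℝ, EG) ∞ G] {y : F → P} {g : F → G} {q : F} {Y : F →L[ℝ] EP}
    {L : F →L[ℝ] EG} (hy : HasMFDerivAt 𝓘(ℝ, F) 𝓘(ℝ, EP) y q Y) (hg : HasRD g L q) :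
    HasMFDerivAt 𝓘(ℝ, F) 𝓘(ℝ, EP) (fun q => S.act (y q) (g q)) q
      ((S.translateL (g q) (y q)).comp (Y + (S.fundamentalL (y q)).comp L)) := by
  have hk := hg.hasMFDerivAt_mul_inv
  obtain ⟨D, hD⟩ : ∃ D : EP × EG →L[ℝ] EP, HasMFDerivAt (𝓘(ℝ, EP).prod 𝓘(ℝ, EG)) 𝓘(ℝ, EP)
      (fun q : P × G => S.act q.1 q.2) (y q, 1) D :=
    ⟨_, (S.contMDiff_act.mdifferentiable (by simp) (y q, 1)).hasMFDerivAt⟩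
  have h1 : HasMFDerivAt 𝓘(ℝ, F) 𝓘(ℝ, EP) (fun q' => S.act (y q') (g q' * (g q)⁻¹)) q
      (D.comp (Y.prod L)) :=
    HasMFDerivAt.comp (g := fun q : P × G => S.act q.1 q.2)
      (f := fun q' => (y q', g q' * (g q)⁻¹)) q (hD.of_eq' (by simp)) (hy.prodMk hk)
  have hid : D.comp (ContinuousLinearMap.inl ℝ EP EG) = ContinuousLinearMap.id ℝ EP := by
    have h2 : HasMFDerivAt 𝓘(ℝ, EP) 𝓘(ℝ, EP) (fun p => S.act p 1) (y q)
        (D.comp (ContinuousLinearMap.inl ℝ EP EG)) :=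
      HasMFDerivAt.comp (g := fun q : P × G => S.act q.1 q.2) (f := fun p => (p, (1 : G))) (y q) hD
        ((hasMFDerivAt_id (I := 𝓘(ℝ, EP)) (y q)).prodMk (hasMFDerivAt_const (1 : G) (y q)))
    have h3 : (fun p => S.act p 1) = id := funext S.act_one
    rw [h3] at h2
    exact hasMFDerivAt_unique h2 (hasMFDerivAt_id (y q))
  have hv : D.comp (ContinuousLinearMap.inr ℝ EP EG) = S.fundamentalL (y q) := by
    have h2 : HasMFDerivAt 𝓘(ℝ, EG) 𝓘(ℝ, EP) (fun g => S.act (y q) g) (1 : G)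
        (D.comp (ContinuousLinearMap.inr ℝ EP EG)) :=
      HasMFDerivAt.comp (g := fun q : P × G => S.act q.1 q.2) (f := fun g => (y q, g)) (1 : G) hD
        ((hasMFDerivAt_const (y q) (1 : G)).prodMk (hasMFDerivAt_id (I := 𝓘(ℝ, EG)) (1 : G)))
    exact hasMFDerivAt_unique h2 (S.hasMFDerivAt_fundamentalL (y q))
  have h4 : D.comp (Y.prod L) = Y + (S.fundamentalL (y q)).comp L := by
    ext v
    have : (Y v, L v) = ContinuousLinearMap.inl ℝ EP EG (Y v) + ContinuousLinearMap.inr ℝ EP EG (L v) := by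
      simp
    have h5 := congrArg (fun A : EP →L[ℝ] EP => A (Y v)) hid
    have h6 := congrArg (fun A : EG →L[ℝ] EP => A (L v)) hv
    simp only [ContinuousLinearMap.comp_apply, ContinuousLinearMap.prod_apply, this, map_add,
      add_apply] at h5 h6 ⊢
    rw [h5, h6]; rfl
  have h7 : HasMFDerivAt 𝓘(ℝ, F) 𝓘(ℝ, EP) (fun q' => S.act (S.act (y q') (g q' * (g q)⁻¹)) (g q)) q
      ((S.translateL (g q) (y q)).comp (Y + (S.fundamentalL (y q)).comp L)) :=
    HasMFDerivAt.comp (g := fun p => S.act p (g q)) (f := fun q' => S.act (y q') (g q' * (g q)⁻¹)) q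
      ((S.hasMFDerivAt_translateL (g q) (y q)).of_eq (by simp [S.act_one])) (h1.congr_mfderiv h4)
  have h8 : (fun q' => S.act (S.act (y q') (g q' * (g q)⁻¹)) (g q)) = fun q' => S.act (y q') (g q') :=
    funext fun q' => by rw [← S.act_mul, inv_mul_cancel_right]
  exact h8 ▸ h7

lemma proj_fundamentalL (p : P) (ξ : EG) :
    (mfderiv 𝓘(ℝ, EP) 𝓘(ℝ, EM) S.proj p : EP →L[ℝ] EM) (S.fundamentalL p ξ) = 0 := by
  obtain ⟨D, hD⟩ : ∃ D : EP →L[ℝ] EM, HasMFDerivAt 𝓘(ℝ, EP) 𝓘(ℝ, EM) S.proj p D :=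
    ⟨_, (S.contMDiff_proj.mdifferentiable (by simp) p).hasMFDerivAt⟩
  have h1 : HasMFDerivAt 𝓘(ℝ, EG) 𝓘(ℝ, EM) (fun g => S.proj (S.act p g)) (1 : G)
      (D.comp (S.fundamentalL p)) :=
    HasMFDerivAt.comp (g := S.proj) (f := fun g => S.act p g) (1 : G)
      (hD.of_eq (S.act_one p)) (S.hasMFDerivAt_fundamentalL p)
  have h2 : (fun g => S.proj (S.act p g)) = fun _ => S.proj p := funext (S.proj_act p)
  rw [h2] at h1
  have h3 := hasMFDerivAt_unique h1 (hasMFDerivAt_const (S.proj p) (1 : G))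
  have h4 : (mfderiv 𝓘(ℝ, EP) 𝓘(ℝ, EM) S.proj p : EP →L[ℝ] EM) = D := hD.mfderiv
  rw [h4]
  exact congrArg (fun A : EG →L[ℝ] EM => A ξ) h3

end PrincipalBundle

variable {S : PrincipalBundle EG EM EP G M P}

lemma PrincipalConnection.form_fundamentalL (A : PrincipalConnection S) (p : P) (ξ : EG) :
    (A.form p : EP [⋀^Fin 1]→L[ℝ] EG) ![S.fundamentalL p ξ] = ξ :=
  (congrArg (fun f : EP [⋀^Fin 1]→L[ℝ] EG => f ![S.fundamentalL p ξ])
    (A.form.congr_point (S.act_one p))).symm.trans (A.vertical p ξ)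

/-- The gauge law A ↦ Ad(g⁻¹)(A + dg g⁻¹): equivariance gives the outer Ad, and the reproduction of
generators gives the inhomogeneous term. -/
lemma PrincipalConnection.pull_act [LieGroup 𝓘(ℝ, EG) ∞ G] (A : PrincipalConnection S) {y : F → P}
    {g : F → G} {q : F} {L : F →L[ℝ] EG} (hy : MDifferentiableAt 𝓘(ℝ, F) 𝓘(ℝ, EP) y q)
    (hg : HasRD g L q) (v : F) :
    A.form.pull (fun q => S.act (y q) (g q)) q ![v] = Adj (g q)⁻¹ (A.form.pull y q ![v] + L v) := by
  obtain ⟨Y, hY⟩ : ∃ Y : F →L[ℝ] EP, HasMFDerivAt 𝓘(ℝ, F) 𝓘(ℝ, EP) y q Y := ⟨_, hy.hasMFDerivAt⟩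
  rw [A.form.pull_one_of_hasMFDerivAt hY, A.form.pull_one_of_hasMFDerivAt (S.hasMFDerivAt_act hY hg)]
  refine (A.equivariant (y q) (g q) (Y v + S.fundamentalL (y q) (L v))).trans ?_
  refine congrArg (Adj (g q)⁻¹) ?_
  exact (alternating_one_add (E := EP) (A.form (y q)) _ _).trans
    (congrArg _ (A.form_fundamentalL (y q) (L v)))

lemma AdjointTwoForm.form_fundamentalL (B : AdjointTwoForm S) (p : P) (ξ : EG) (X : EP) :
    (B.form p : EP [⋀^Fin 2]→L[ℝ] EG) ![S.fundamentalL p ξ, X] = 0 :=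
  B.horizontal p _ _ (S.proj_fundamentalL p ξ)

/-- The derivative of g contributes only vertical vectors, which a horizontal form kills, so no
inhomogeneous term appears. -/
lemma AdjointTwoForm.pull_act [LieGroup 𝓘(ℝ, EG) ∞ G] (B : AdjointTwoForm S) {y : F → P}
    {g : F → G} {q : F} {L : F →L[ℝ] EG} (hy : MDifferentiableAt 𝓘(ℝ, F) 𝓘(ℝ, EP) y q)
    (hg : HasRD g L q) (v w : F) :
    B.form.pull (fun q => S.act (y q) (g q)) q ![v, w] =
      Adj (g q)⁻¹ (B.form.pull y q ![v, w]) := by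
  obtain ⟨Y, hY⟩ : ∃ Y : F →L[ℝ] EP, HasMFDerivAt 𝓘(ℝ, F) 𝓘(ℝ, EP) y q Y := ⟨_, hy.hasMFDerivAt⟩
  rw [B.form.pull_two_of_hasMFDerivAt hY, B.form.pull_two_of_hasMFDerivAt (S.hasMFDerivAt_act hY hg)]
  refine (B.equivariant (y q) (g q) (Y v + S.fundamentalL (y q) (L v))
    (Y w + S.fundamentalL (y q) (L w))).trans ?_
  refine congrArg (Adj (g q)⁻¹) ?_
  set f : EP [⋀^Fin 2]→L[ℝ] EG := B.form (y q) with hf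
  have h0 : ∀ ξ X, f ![S.fundamentalL (y q) ξ, X] = 0 := B.form_fundamentalL (y q)
  change f ![Y v + S.fundamentalL (y q) (L v), Y w + S.fundamentalL (y q) (L w)] = f ![Y v, Y w]
  rw [alternating_two_add, h0, add_zero, alternating_two_swap, alternating_two_add, h0, add_zero,
    ← alternating_two_swap]

end BundleCalculus

/-! ### Existence and uniqueness of horizontal lifts. -/

section HorizontalLifts

variable {EG EM EP : Type*}
  [NormedAddCommGroup EG] [NormedSpace ℝ EG] [NormedAddCommGroup EM] [NormedSpace ℝ EM]
  [NormedAddCommGroup EP] [NormedSpace ℝ EP]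
  {G M P : Type*} [TopologicalSpace G] [ChartedSpace EG G] [Group G]
  [TopologicalSpace M] [ChartedSpace EM M] [TopologicalSpace P] [ChartedSpace EP P]

namespace PrincipalBundle

variable (S : PrincipalBundle EG EM EP G M P)

/-- Local trivializations, through a local section `s` and the coordinate `t` along the fibres. -/
lemma exists_trivialization [LieGroup 𝓘(ℝ, EG) ∞ G] (m : M) : ∃ U : Set M, IsOpen U ∧ m ∈ U ∧ ∃ (s : M → P) (t : P → G),
    ContMDiffOn 𝓘(ℝ, EM) 𝓘(ℝ, EP) ∞ s U ∧ (∀ x ∈ U, S.proj (s x) = x) ∧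
    ContMDiffOn 𝓘(ℝ, EP) 𝓘(ℝ, EG) ∞ t (S.proj ⁻¹' U) ∧
    (∀ p, S.proj p ∈ U → S.act (s (S.proj p)) (t p) = p) ∧
    ∀ p, S.proj p ∈ U → ∀ g, t (S.act p g) = t p * g := by
  obtain ⟨U, hU, hm, φ, hs, ht, hφ, hφ', h⟩ := S.locTriv m
  have hs' : ∀ x ∈ U, φ.symm (x, (1 : G)) ∈ φ.source := fun x hx =>
    φ.map_target (by rw [ht]; exact ⟨hx, mem_univ _⟩)
  have hr : ∀ x ∈ U, φ (φ.symm (x, (1 : G))) = (x, 1) := fun x hx =>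
    φ.right_inv (by rw [ht]; exact ⟨hx, mem_univ _⟩)
  have hp : ∀ x ∈ U, S.proj (φ.symm (x, (1 : G))) = x := fun x hx => by
    rw [← (h _ (hs' x hx)).1, hr x hx]
  refine ⟨U, hU, hm, fun x => φ.symm (x, 1), fun p => (φ p).2, ?_, hp, ?_, fun p hpU => ?_,
    fun p hpU g => (h p (by rw [hs]; exact hpU)).2 g⟩
  · refine hφ'.comp (contMDiffOn_id.prodMk contMDiffOn_const) fun x hx => ?_
    rw [ht]; exact ⟨hx, mem_univ _⟩
  · rw [← hs]
    exact contMDiff_snd.comp_contMDiffOn hφ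
  · have hps : p ∈ φ.source := by rw [hs]; exact hpU
    have h1 : S.act (φ.symm (S.proj p, 1)) (φ p).2 ∈ φ.source := by
      rw [hs, mem_preimage, S.proj_act, hp _ hpU]; exact hpU
    refine φ.injOn h1 hps (Prod.ext ?_ ?_)
    · rw [(h _ h1).1, S.proj_act, hp _ hpU, (h p hps).1]
    · rw [(h _ (hs' _ hpU)).2, hr _ hpU, one_mul]

variable {S}

lemma act_injective [LieGroup 𝓘(ℝ, EG) ∞ G] (p : P) {g h : G} (hgh : S.act p g = S.act p h) : g = h := by
  obtain ⟨U, -, hm, -, t, -, -, -, -, ht⟩ := S.exists_trivialization (S.proj p)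
  exact mul_left_cancel ((ht p hm g).symm.trans ((congrArg t hgh).trans (ht p hm h)))

lemma exists_act_eq [LieGroup 𝓘(ℝ, EG) ∞ G] {p q : P} (h : S.proj p = S.proj q) : ∃ g, S.act p g = q := by
  obtain ⟨U, -, hm, s, t, -, -, -, ht, -⟩ := S.exists_trivialization (S.proj p)
  refine ⟨(t p)⁻¹ * t q, ?_⟩
  rw [← ht p hm, ← S.act_mul, ht p hm, mul_inv_cancel_left, h, ht q (h ▸ hm)]

end PrincipalBundle

lemma MDifferentiableAt.exists_hasRD [LieGroup 𝓘(ℝ, EG) ∞ G] {F : Type*} [NormedAddCommGroup F]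
    [NormedSpace ℝ F] {W : F → G} {q : F} (h : MDifferentiableAt 𝓘(ℝ, F) 𝓘(ℝ, EG) W q) :
    ∃ L : F →L[ℝ] EG, HasRD W L q := by
  obtain ⟨A, hA⟩ : ∃ A : EG →L[ℝ] EG, HasMFDerivAt 𝓘(ℝ, EG) 𝓘(ℝ, EG) (fun x => x * (W q)⁻¹) (W q) A :=
    ⟨_, hasMFDerivAt_mul_const _ _⟩
  obtain ⟨D, hD⟩ : ∃ D : F →L[ℝ] EG, HasMFDerivAt 𝓘(ℝ, F) 𝓘(ℝ, EG) W q D := ⟨_, h.hasMFDerivAt⟩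
  have h3 := hasFDerivAt_lchart_of_hasMFDerivAt (L := A.comp D) (by simp)
    (HasMFDerivAt.comp q hA hD)
  refine ⟨A.comp D, h.continuousAt, ?_⟩
  simpa only [Function.comp_def, extChartAt_model_space_eq_id, PartialEquiv.refl_coe,
      PartialEquiv.refl_symm, id] using h3

variable {S : PrincipalBundle EG EM EP G M P}

lemma Adj_eq_zero_iff [LieGroup 𝓘(ℝ, EG) ∞ G] (g : G) {ξ : EG} : Adj g ξ = 0 ↔ ξ = 0 :=
  ⟨fun h => by rw [← Adj_inv_apply_Adj g ξ, h, map_zero], fun h => by rw [h, map_zero]⟩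

/-- A curve in the bundle is horizontal at `t`. -/
def PrincipalConnection.HorizontalAt (A : PrincipalConnection S) (c : ℝ → P) (t : ℝ) : Prop :=
  MDifferentiableAt 𝓘(ℝ, ℝ) 𝓘(ℝ, EP) c t ∧ A.form.pull c t ![1] = 0

lemma PrincipalConnection.HorizontalAt.congr {A : PrincipalConnection S} {c c' : ℝ → P} {t : ℝ}
    (h : A.HorizontalAt c t) (hc : c =ᶠ[𝓝 t] c') : A.HorizontalAt c' t :=
  ⟨h.1.congr_of_eventuallyEq hc.symm, by rw [← A.form.pull_congr hc]; exact h.2⟩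

/-- Uniqueness of horizontal lifts. -/
lemma PrincipalConnection.HorizontalAt.eq_iff [LieGroup 𝓘(ℝ, EG) ∞ G] [T2Space G]
    {A : PrincipalConnection S} {c c' : ℝ → P} {a b : ℝ} (hab : a ≤ b)
    (hc : ContinuousOn c (Icc a b)) (hc' : ContinuousOn c' (Icc a b))
    (hp : ∀ t ∈ Icc a b, S.proj (c t) = S.proj (c' t))
    (hh : ∀ t ∈ Ioo a b, A.HorizontalAt c t) (hh' : ∀ t ∈ Ioo a b, A.HorizontalAt c' t) :
    c a = c' a ↔ c b = c' b := by
  classical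
  have hT := topologicalGroup_of_smooth EG G inferInstance
  -- Curves over the same base curve differ by a group-valued curve g; if both are horizontal, the
  -- gauge law forces g to have zero derivative, so the curves agree at one end exactly when they
  -- agree at the other.
  choose! g hg using fun t ht => PrincipalBundle.exists_act_eq (S := S) (hp t ht)
  have hloc : ∀ t ∈ Icc a b, ∃ (U : Set M) (τ : P → G), IsOpen U ∧ S.proj (c t) ∈ U ∧
      ContMDiffOn 𝓘(ℝ, EP) 𝓘(ℝ, EG) ∞ τ (S.proj ⁻¹' U) ∧
      ∀ r ∈ Icc a b, S.proj (c r) ∈ U → g r = (τ (c r))⁻¹ * τ (c' r) := by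
    intro t ht
    obtain ⟨U, hU, hm, -, τ, -, -, hτ, -, hτ'⟩ := S.exists_trivialization (S.proj (c t))
    refine ⟨U, τ, hU, hm, hτ, fun r hr hrU => ?_⟩
    have := hτ' (c r) hrU (g r)
    rw [hg r hr] at this
    rw [this, inv_mul_cancel_left]
  have hgc : ContinuousOn g (Icc a b) := by
    intro t ht
    obtain ⟨U, τ, hU, hm, hτ, hgτ⟩ := hloc t ht
    have hV : IsOpen (S.proj ⁻¹' U) := hU.preimage S.contMDiff_proj.continuous
    have h1 : ContinuousAt τ (c t) := hτ.continuousOn.continuousAt (hV.mem_nhds hm)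
    have h2 : ContinuousAt τ (c' t) :=
      hτ.continuousOn.continuousAt (hV.mem_nhds (by rw [mem_preimage, ← hp t ht]; exact hm))
    refine (((h1.comp_continuousWithinAt (hc t ht)).inv).mul
      (h2.comp_continuousWithinAt (hc' t ht))).congr_of_eventuallyEq ?_ (hgτ t ht hm)
    filter_upwards [(hc t ht).eventually (hV.mem_nhds hm), self_mem_nhdsWithin] with r h3 h4
    exact hgτ r h4 h3
  have hrd : ∀ t ∈ Ioo a b, HasRD g (0 : ℝ →L[ℝ] EG) t := by
    intro t ht
    obtain ⟨U, τ, hU, hm, hτ, hgτ⟩ := hloc t (Ioo_subset_Icc_self ht)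
    have hV : IsOpen (S.proj ⁻¹' U) := hU.preimage S.contMDiff_proj.continuous
    have h1 := (hτ.contMDiffAt (hV.mem_nhds hm)).mdifferentiableAt (by simp)
    have h2 := (hτ.contMDiffAt (hV.mem_nhds (x := c' t)
      (by rw [mem_preimage, ← hp t (Ioo_subset_Icc_self ht)]; exact hm))).mdifferentiableAt (by simp)
    obtain ⟨L₁, hL₁⟩ := (MDifferentiableAt.comp t h1 (hh t ht).1).exists_hasRD
    obtain ⟨L₂, hL₂⟩ := (MDifferentiableAt.comp t h2 (hh' t ht).1).exists_hasRD
    obtain ⟨L, hL⟩ : ∃ L, HasRD g L t := by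
      refine ⟨_, (hL₁.inv.mul hL₂).congr ?_⟩
      filter_upwards [(hh t ht).1.continuousAt.eventually (hV.mem_nhds hm),
        Ioo_mem_nhds ht.1 ht.2] with r h3 h4
      exact hgτ r (Ioo_subset_Icc_self h4) h3
    have h5 := A.pull_act (hh t ht).1 hL (1 : ℝ)
    rw [A.form.pull_congr (y' := c'), (hh t ht).2, (hh' t ht).2, zero_add] at h5
    · have h6 : L = 0 := by
        ext; exact (Adj_eq_zero_iff _).1 h5.symm
      rwa [h6] at hL
    · filter_upwards [Ioo_mem_nhds ht.1 ht.2] with r hr using hg r (Ioo_subset_Icc_self hr)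
  have hab' := HasRD.eq_of_zero hab hgc hrd
  have hone : ∀ t ∈ Icc a b, c t = c' t ↔ g t = 1 := by
    intro t ht
    rw [← hg t ht]
    refine ⟨fun h => PrincipalBundle.act_injective (S := S) (c t) ?_, fun h => ?_⟩
    · rw [S.act_one]; exact h.symm
    · rw [h, S.act_one]
  rw [hone a (left_mem_Icc.2 hab), hone b (right_mem_Icc.2 hab), hab']

lemma VForm.pull_slice {n : ℕ} {V : Type*} [NormedAddCommGroup V] [NormedSpace ℝ V]
    (α : VForm EP P V n) {F : Type*} [NormedAddCommGroup F] [NormedSpace ℝ F] {y : ℝ × F → P} {t : ℝ} {p : F}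
    (hy : MDifferentiableAt 𝓘(ℝ, ℝ × F) 𝓘(ℝ, EP) y (t, p)) :
    α.pull (fun t => y (t, p)) t =
      (α.pull y (t, p)).compContinuousLinearMap (ContinuousLinearMap.inl ℝ ℝ F) :=
  α.pull_comp (h := fun t => (t, p)) hy (hasFDerivAt_prodMk_left t p)

lemma VForm.pull_slice_one {V : Type*} [NormedAddCommGroup V] [NormedSpace ℝ V]
    (α : VForm EP P V 1) {F : Type*} [NormedAddCommGroup F] [NormedSpace ℝ F] {y : ℝ × F → P} {t : ℝ} {p : F}
    (hy : MDifferentiableAt 𝓘(ℝ, ℝ × F) 𝓘(ℝ, EP) y (t, p)) :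
    α.pull (fun t => y (t, p)) t ![1] = α.pull y (t, p) ![(1, 0)] := by
  rw [α.pull_slice hy]
  exact congrArg (α.pull y (t, p)) (by ext i : 1; fin_cases i; rfl)

/-- Scaling x - q by a bump function replaces a map defined only near q by one defined on the whole
plane and unchanged on a smaller ball. -/
lemma exists_contDiff_retraction (q : ℝ × ℝ) {r : ℝ} (hr : 0 < r) : ∃ ρ : ℝ × ℝ → ℝ × ℝ,
    ContDiff ℝ ∞ ρ ∧ (∀ x, ρ x ∈ Metric.ball q r) ∧ ∀ x ∈ Metric.ball q (r / 2), ρ x = x := by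
  let f : ContDiffBump q := ⟨r / 2, r, by positivity, by linarith⟩
  refine ⟨fun x => q + f x • (x - q), ?_, fun x => ?_, fun x hx => ?_⟩
  · exact contDiff_const.add (f.contDiff.smul (contDiff_id.sub contDiff_const))
  · rw [Metric.mem_ball, dist_eq_norm, add_sub_cancel_left, norm_smul, Real.norm_of_nonneg f.nonneg]
    by_cases hx : x ∈ Metric.ball q r
    · refine lt_of_le_of_lt (mul_le_of_le_one_left (norm_nonneg _) f.le_one) ?_
      rwa [← dist_eq_norm]
    · rw [f.zero_of_le_dist (by simpa using hx), zero_mul]; exact hr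
  · have h1 : f x = 1 := f.one_of_mem_closedBall (Metric.ball_subset_closedBall hx)
    simp [h1]

variable [FiniteDimensional ℝ EG] [LieGroup 𝓘(ℝ, EG) ∞ G] [T2Space G] [IsManifold 𝓘(ℝ, EP) ∞ P]

/-- A local section along X is corrected by the solution W of ∂W/∂σ = -A(∂y0/∂σ)W. Because of the
retraction the result is horizontal everywhere, but lies over X only near q. -/
lemma PrincipalConnection.exists_local_lift (A : PrincipalConnection S) {X : ℝ × ℝ → M}
    (hX : ContMDiff 𝓘(ℝ, ℝ × ℝ) 𝓘(ℝ, EM) ∞ X) (q : ℝ × ℝ) : ∃ r > 0, ∃ z : ℝ × ℝ → P,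
      ContMDiff 𝓘(ℝ, ℝ × ℝ) 𝓘(ℝ, EP) ∞ z ∧ (∀ x ∈ Metric.ball q r, S.proj (z x) = X x) ∧
      ∀ x, A.form.pull z x ![(1, 0)] = 0 := by
  obtain ⟨U, hU, hm, s, -, hs, hps, -, -, -⟩ := S.exists_trivialization (X q)
  obtain ⟨r, hr, hrU⟩ := Metric.isOpen_iff.1 (hU.preimage hX.continuous) q hm
  obtain ⟨ρ, hρ, hρb, hρe⟩ := exists_contDiff_retraction q hr
  have hy0 : ContMDiff 𝓘(ℝ, ℝ × ℝ) 𝓘(ℝ, EP) ∞ (fun x => s (X (ρ x))) := fun x =>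
    (hs.contMDiffAt (hU.mem_nhds (hrU (hρb x)))).comp x ((hX.comp hρ.contMDiff) x)
  set y0 := fun x => s (X (ρ x)) with hy0def
  obtain ⟨W, hW, -, hWrd⟩ := exists_group_solution (G := G) (a := fun x => -A.form.pull y0 x ![(1, 0)])
    (A.smooth.contDiff_pull hy0 _).neg
  refine ⟨r / 2, by positivity, fun x => S.act (y0 x) (W x), S.contMDiff_act.comp (hy0.prodMk hW), ?_, ?_⟩
  · intro x hx
    rw [S.proj_act, hy0def]
    simp only [hρe x hx]
    exact hps _ (hrU (Metric.ball_subset_ball (by linarith) hx))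
  · rintro ⟨t, p⟩
    have h1 : HasRD W (rd EG W (t, p)) (t, p) := (hW (t, p)).hasRD (by simp)
    have h2 : HasRD (fun t => W (t, p)) _ t :=
      HasRD.comp (c := fun t => (t, p)) h1 (hasFDerivAt_prodMk_left t p)
    have h3 := congrArg (fun L : ℝ →L[ℝ] EG => L 1) (h2.unique (hWrd p t))
    rw [A.pull_act (hy0.mdifferentiable (by simp) _) h1]
    have h4 : rd EG W (t, p) (1, 0) = -A.form.pull y0 (t, p) ![(1, 0)] := by simpa using h3
    rw [h4, add_neg_cancel, map_zero]

/-- Existence of horizontal lifts, with parameters. -/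
theorem PrincipalConnection.exists_lift (A : PrincipalConnection S) {X : ℝ × ℝ → M}
    (hX : ContMDiff 𝓘(ℝ, ℝ × ℝ) 𝓘(ℝ, EM) ∞ X) {d : ℝ → P} (hd : ContMDiff 𝓘(ℝ, ℝ) 𝓘(ℝ, EP) ∞ d)
    (hdX : ∀ p, S.proj (d p) = X (0, p)) :
    ∃ y : ℝ × ℝ → P, ContMDiff 𝓘(ℝ, ℝ × ℝ) 𝓘(ℝ, EP) ∞ y ∧ (∀ p, y (0, p) = d p) ∧
      (∀ q, S.proj (y q) = X q) ∧ ∀ q, A.form.pull y q ![(1, 0)] = 0 := by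
  suffices hex : ∃ y : ℝ × ℝ → P, ContMDiff 𝓘(ℝ, ℝ × ℝ) 𝓘(ℝ, EP) ∞ y ∧ ∀ p, y (0, p) = d p ∧
      ∀ t, (∀ᶠ t' in 𝓝 t, S.proj (y (t', p)) = X (t', p)) ∧ A.HorizontalAt (fun t => y (t, p)) t by
    obtain ⟨y, hy, h⟩ := hex
    refine ⟨y, hy, fun p => (h p).1, fun q => ((h q.2).2 q.1).1.self_of_nhds, fun q => ?_⟩
    rw [← A.form.pull_slice_one (hy.mdifferentiable (by simp) (q.1, q.2))]
    exact ((h q.2).2 q.1).2.2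
  refine exists_global_solution (n := ∞)
    (Q := fun t p c => (∀ᶠ t' in 𝓝 t, S.proj (c t') = X (t', p)) ∧ A.HorizontalAt c t)
    (Adm := fun t p z => S.proj z = X (t, p)) ?_ ?_ ?_ ?_ hd hdX
  · rintro t p c c' h ⟨h1, h2⟩
    refine ⟨?_, h2.congr h⟩
    filter_upwards [h, h1] with r h3 h4
    rw [← h3, h4]
  · intro p J hJ hJc c c' hc hc' t₀ ht₀ h t ht
    have key : ∀ a ∈ J, ∀ b ∈ J, a ≤ b → (c a = c' a ↔ c b = c' b) := by
      intro a ha b hb hab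
      have hJ' : Icc a b ⊆ J := hJc.out ha hb
      refine PrincipalConnection.HorizontalAt.eq_iff (A := A) hab
        (fun r hr => (hc r (hJ' hr)).2.1.continuousAt.continuousWithinAt)
        (fun r hr => (hc' r (hJ' hr)).2.1.continuousAt.continuousWithinAt) (fun r hr => ?_)
        (fun r hr => (hc r (hJ' (Ioo_subset_Icc_self hr))).2)
        (fun r hr => (hc' r (hJ' (Ioo_subset_Icc_self hr))).2)
      rw [(hc r (hJ' hr)).1.self_of_nhds, (hc' r (hJ' hr)).1.self_of_nhds]
    rcases le_total t₀ t with h' | h'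
    · exact (key t₀ ht₀ t ht h').1 h
    · exact (key t ht t₀ ht₀ h').2 h
  · intro t p c h
    exact h.1.self_of_nhds
  · intro t₁ p₁
    obtain ⟨U, hU, hm, -, τ, -, -, hτ, hpτ, hτ'⟩ := S.exists_trivialization (X (t₁, p₁))
    obtain ⟨r₀, hr₀, z, hz, hpz, hAz⟩ := A.exists_local_lift hX (t₁, p₁)
    obtain ⟨r₁, hr₁, hrU⟩ := Metric.isOpen_iff.1 (hU.preimage hX.continuous) (t₁, p₁) hm
    obtain ⟨r, hr, hrr₀, hrr₁⟩ : ∃ r > 0, r ≤ r₀ ∧ r ≤ r₁ := ⟨min r₀ r₁, lt_min hr₀ hr₁, min_le_left _ _, min_le_right _ _⟩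
    have hb : ∀ t ∈ Metric.ball t₁ r, ∀ p ∈ Metric.ball p₁ r, S.proj (z (t, p)) = X (t, p) ∧ X (t, p) ∈ U := by
      intro t ht p hp
      have hmem : (t, p) ∈ Metric.ball (t₁, p₁) r := by
        rw [← ball_prod_same]; exact ⟨ht, hp⟩
      exact ⟨hpz _ (Metric.ball_subset_ball hrr₀ hmem), hrU (Metric.ball_subset_ball hrr₁ hmem)⟩
    have hloc : ∀ s ∈ Metric.ball t₁ r, ∀ t ∈ Metric.ball t₁ r,
        SolvableBetween (EY := EP) ∞
          (fun t p (c : ℝ → P) => (∀ᶠ t' in 𝓝 t, S.proj (c t') = X (t', p)) ∧ A.HorizontalAt c t)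
          (fun t p z => S.proj z = X (t, p)) p₁ s t := by
      intro s hs t ht d U₀ hU₀ hp₁ hd hda
      have hJo : IsOpen (Metric.ball t₁ r) := Metric.isOpen_ball
      have hmap : ∀ p ∈ U₀ ∩ Metric.ball p₁ r, S.proj (z (s, p)) ∈ U ∧ S.proj (d p) ∈ U ∧
          S.proj (z (s, p)) = S.proj (d p) := fun p hp => by
        rw [(hb s hs p hp.2).1, hda p hp.1]; exact ⟨(hb s hs p hp.2).2, (hb s hs p hp.2).2, rfl⟩
      -- The factor does not depend on t, so horizontality survives the translation; τ reads off the
      -- element carrying z(s, p) to the datum d(p).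
      refine ⟨Metric.ball t₁ r, hJo, (convex_ball t₁ r).ordConnected, hs, ht,
        U₀ ∩ Metric.ball p₁ r, hU₀.inter Metric.isOpen_ball, ⟨hp₁, Metric.mem_ball_self hr⟩,
        fun q => S.act (z q) ((τ (z (s, q.2)))⁻¹ * τ (d q.2)), ?_, fun p hp => ⟨?_, fun t ht => ⟨?_, ?_⟩⟩⟩
      · have h1 : ContMDiff 𝓘(ℝ, ℝ × ℝ) 𝓘(ℝ, ℝ × ℝ) ∞ (fun q : ℝ × ℝ => (s, q.2)) :=
          (ContDiff.contMDiff (by fun_prop))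
        have h2 : ContMDiff 𝓘(ℝ, ℝ × ℝ) 𝓘(ℝ, ℝ) ∞ (fun q : ℝ × ℝ => q.2) :=
          (ContDiff.contMDiff (by fun_prop))
        refine S.contMDiff_act.comp_contMDiffOn (hz.contMDiffOn.prodMk (ContMDiffOn.mul (ContMDiffOn.inv ?_) ?_))
        · exact hτ.comp (hz.comp h1).contMDiffOn fun q hq => (hmap q.2 hq.2).1
        · exact hτ.comp (hd.comp h2.contMDiffOn fun q hq => hq.2.1) fun q hq => (hmap q.2 hq.2).2.1
      · obtain ⟨h1, h2, h3⟩ := hmap p hp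
        change S.act (z (s, p)) ((τ (z (s, p)))⁻¹ * τ (d p)) = d p
        obtain ⟨g, hg⟩ := PrincipalBundle.exists_act_eq (S := S) h3
        rw [← hg, hτ' _ h1, inv_mul_cancel_left]
      · filter_upwards [hJo.mem_nhds ht] with t' ht'
        rw [S.proj_act, (hb t' ht' p hp.2).1]
      · have hzt : MDifferentiableAt 𝓘(ℝ, ℝ) 𝓘(ℝ, EP) (fun t => z (t, p)) t :=
          MDifferentiableAt.comp (g := z) (f := fun t => (t, p)) t (hz.mdifferentiable (by simp) (t, p))
            (hasFDerivAt_prodMk_left t p).differentiableAt.mdifferentiableAt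
        change A.HorizontalAt (fun t' => S.act (z (t', p)) ((τ (z (s, p)))⁻¹ * τ (d p))) t
        refine ⟨MDifferentiableAt.comp (I' := 𝓘(ℝ, EP)) (g := fun q => S.act q ((τ (z (s, p)))⁻¹ * τ (d p))) (f := fun t => z (t, p)) t
          ((S.contMDiff_act_left _).mdifferentiable (by simp) _) hzt, ?_⟩
        rw [A.pull_act hzt (hasRD_const _ _), A.form.pull_slice_one (hz.mdifferentiable (by simp) (t, p)),
          hAz]
        simp
    filter_upwards [Metric.ball_mem_nhds t₁ hr] with t ht
    exact ⟨hloc t₁ (Metric.mem_ball_self hr) t ht, hloc t ht t₁ (Metric.mem_ball_self hr)⟩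

end HorizontalLifts

/-! ### Lifts of loops of loops; existence and uniqueness of the holonomy. -/

section Holonomy

variable {EG EM EP : Type*}
  [NormedAddCommGroup EG] [NormedSpace ℝ EG] [NormedAddCommGroup EM] [NormedSpace ℝ EM]
  [NormedAddCommGroup EP] [NormedSpace ℝ EP]
  {G M P : Type*} [TopologicalSpace G] [ChartedSpace EG G] [Group G]
  [TopologicalSpace M] [ChartedSpace EM M] [TopologicalSpace P] [ChartedSpace EP P]
  {S : PrincipalBundle EG EM EP G M P} {A : PrincipalConnection S} {B : AdjointTwoForm S} {p₀ : P}

lemma two_pi_pos' : (0 : ℝ) < 2 * Real.pi := by positivity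

/-- The open parameter square. -/
def openSquare : Set (ℝ × ℝ) := Ioo 0 (2 * Real.pi) ×ˢ Ioo 0 (2 * Real.pi)

lemma isOpen_openSquare : IsOpen openSquare := isOpen_Ioo.prod isOpen_Ioo

lemma openSquare_subset : openSquare ⊆ paramSquare :=
  prod_mono Ioo_subset_Icc_self Ioo_subset_Icc_self

lemma closure_openSquare : closure openSquare = paramSquare := by
  rw [openSquare, closure_prod_eq, closure_Ioo two_pi_pos'.ne, paramSquare]

lemma interior_paramSquare : interior paramSquare = openSquare := by
  rw [paramSquare, interior_prod_eq, interior_Icc, openSquare]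

lemma isClosed_paramSquare : IsClosed paramSquare := isClosed_Icc.prod isClosed_Icc

lemma mem_frontier_paramSquare {q : ℝ × ℝ} :
    q ∈ frontier paramSquare ↔ q ∈ paramSquare ∧ q ∉ openSquare := by
  rw [isClosed_paramSquare.frontier_eq, interior_paramSquare]; rfl

/-- Lifts are prescribed only on the square, so identities involving derivatives are proved in the
open square, where germs are determined, and extended to the boundary by continuity. -/
lemma eqOn_paramSquare {Y : Type*} [TopologicalSpace Y] [T2Space Y] {f g : ℝ × ℝ → Y}
    (hf : Continuous f) (hg : Continuous g) (h : EqOn f g openSquare) : EqOn f g paramSquare := by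
  rw [← closure_openSquare]; exact h.closure hf hg

lemma formW_eq_pull (B : AdjointTwoForm S) (y : ℝ × ℝ → P) (σ τ : ℝ) :
    formW B y σ τ = B.form.pull y (σ, τ) ![(1, 0), (0, 1)] :=
  (B.form.pull_two y (σ, τ) (1, 0) (0, 1)).symm

lemma form_dSigma_eq_pull (A : PrincipalConnection S) (y : ℝ × ℝ → P) (σ τ : ℝ) :
    A.form (y (σ, τ)) ![dSigma EP y σ τ] = A.form.pull y (σ, τ) ![(1, 0)] :=
  (A.form.pull_one y (σ, τ) (1, 0)).symm

/-- The integral of `B^W` over a loop. -/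
def totalW (B : AdjointTwoForm S) (y : ℝ × ℝ → P) (τ : ℝ) : EG :=
  ∫ σ in (0 : ℝ)..(2 * Real.pi), formW B y σ τ

lemma loopConnection_eq (B : AdjointTwoForm S) {y : ℝ × ℝ → P}
    (hy : ContMDiff 𝓘(ℝ, ℝ × ℝ) 𝓘(ℝ, EP) ∞ y) (τ : ℝ) :
    loopConnection B (fun σ => y (σ, τ)) (fun σ => dTau EP y σ τ) = totalW B y τ := by
  refine intervalIntegral.integral_congr fun σ _ => ?_
  have h1 : HasMFDerivAt 𝓘(ℝ, ℝ) 𝓘(ℝ, EP) (fun σ => y (σ, τ)) σ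
      ((mfderiv 𝓘(ℝ, ℝ × ℝ) 𝓘(ℝ, EP) y (σ, τ) : ℝ × ℝ →L[ℝ] EP).comp
        (ContinuousLinearMap.inl ℝ ℝ ℝ)) :=
    HasMFDerivAt.comp (g := y) (f := fun σ => (σ, τ)) σ
      (hy.mdifferentiable (by simp) (σ, τ)).hasMFDerivAt
      (hasFDerivAt_prodMk_left σ τ).hasMFDerivAt
  have h2 : (mfderiv 𝓘(ℝ, ℝ) 𝓘(ℝ, EP) (fun σ => y (σ, τ)) σ (1 : ℝ) : EP) = dSigma EP y σ τ :=
    congrArg (fun L : ℝ →L[ℝ] EP => L 1) h1.mfderiv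
  exact congrArg (fun X : EP => (B.form (y (σ, τ)) : EP [⋀^Fin 2]→L[ℝ] EG) ![X, dTau EP y σ τ]) h2

section Complete
variable [FiniteDimensional ℝ EG] [IsManifold 𝓘(ℝ, EP) ∞ P]

lemma contDiff_formW (B : AdjointTwoForm S) {y : ℝ × ℝ → P}
    (hy : ContMDiff 𝓘(ℝ, ℝ × ℝ) 𝓘(ℝ, EP) ∞ y) : ContDiff ℝ ∞ fun q : ℝ × ℝ => formW B y q.1 q.2 := by
  simp only [formW_eq_pull]
  have : CompleteSpace EG := FiniteDimensional.complete ℝ EG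
  exact B.smooth.contDiff_pull hy _

lemma contDiff_totalW (B : AdjointTwoForm S) {y : ℝ × ℝ → P}
    (hy : ContMDiff 𝓘(ℝ, ℝ × ℝ) 𝓘(ℝ, EP) ∞ y) : ContDiff ℝ ∞ (totalW B y) := by
  have : CompleteSpace EG := FiniteDimensional.complete ℝ EG
  exact contDiff_intervalIntegral (f := fun q : ℝ × ℝ => formW B y q.2 q.1)
    ((contDiff_formW B hy).comp (contDiff_snd.prodMk contDiff_fst)) 0 (2 * Real.pi)

end Complete

lemma IsHorizontalLift.congr {x x' : ℝ × ℝ → M} {y : ℝ × ℝ → P} (h : IsHorizontalLift A p₀ x y)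
    (hx : EqOn x x' paramSquare) : IsHorizontalLift A p₀ x' y :=
  ⟨h.1, fun q hq => (h.2.1 q hq).trans (hx hq), h.2.2⟩

lemma IsHorizontalLift.pull_eq_zero {x : ℝ × ℝ → M} {y : ℝ × ℝ → P} (h : IsHorizontalLift A p₀ x y)
    {q : ℝ × ℝ} (hq : q ∈ paramSquare) : A.form.pull y q ![(1, 0)] = 0 :=
  (form_dSigma_eq_pull A y q.1 q.2).symm.trans (h.2.2.2 q.1 hq.1 q.2 hq.2)

lemma HasHolonomy.congr {x x' : ℝ × ℝ → M} {g : G} (h : HasHolonomy A B p₀ x g)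
    (hx : EqOn x x' paramSquare) : HasHolonomy A B p₀ x' g := by
  obtain ⟨y, hy, hW⟩ := h
  exact ⟨y, hy.congr hx, hW⟩

variable [FiniteDimensional ℝ EG] [LieGroup 𝓘(ℝ, EG) ∞ G] [T2Space G] [IsManifold 𝓘(ℝ, EP) ∞ P]

omit [FiniteDimensional ℝ EG] [LieGroup 𝓘(ℝ, EG) ∞ G] [T2Space G] [IsManifold 𝓘(ℝ, EP) ∞ P] in
lemma horizontalAt_const (A : PrincipalConnection S) (p : P) (t : ℝ) :
    A.HorizontalAt (fun _ => p) t := by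
  refine ⟨mdifferentiableAt_const, ?_⟩
  rw [A.form.pull_one_of_hasMFDerivAt (hasMFDerivAt_const p t)]
  exact (A.form p : EP [⋀^Fin 1]→L[ℝ] EG).map_coord_zero 0 rfl

omit [FiniteDimensional ℝ EG] [LieGroup 𝓘(ℝ, EG) ∞ G] [T2Space G] [IsManifold 𝓘(ℝ, EP) ∞ P] in
lemma IsHorizontalLift.horizontalAt {x : ℝ × ℝ → M} {y : ℝ × ℝ → P} (h : IsHorizontalLift A p₀ x y)
    {q : ℝ × ℝ} (hq : q ∈ paramSquare) : A.HorizontalAt (fun σ => y (σ, q.2)) q.1 := by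
  have hm := h.1.mdifferentiable (by simp) (q.1, q.2)
  refine ⟨MDifferentiableAt.comp (g := y) (f := fun t => (t, q.2)) q.1 hm
            (hasFDerivAt_prodMk_left q.1 q.2).differentiableAt.mdifferentiableAt, ?_⟩
  rw [A.form.pull_slice_one hm]
  exact h.pull_eq_zero hq

theorem IsLoopOfLoops.exists_isHorizontalLift (A : PrincipalConnection S) {x : ℝ × ℝ → M}
    (hx : IsLoopOfLoops EM (S.proj p₀) x) : ∃ y, IsHorizontalLift A p₀ x y := by
  have h0 : (0 : ℝ) ∈ Icc 0 (2 * Real.pi) := ⟨le_rfl, two_pi_pos'.le⟩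
  -- Outside the square x(0, τ) need not be the basepoint, so the constant p₀ cannot serve as
  -- initial curve for all τ. The initial curve is a horizontal lift of τ ↦ x(0, τ) from p₀;
  -- uniqueness makes it constant on [0, 2π].
  obtain ⟨Y, hY, hY0, hYX, hYA⟩ := A.exists_lift (X := fun q => x (0, q.1)) (d := fun _ => p₀)
    (hx.1.comp (ContDiff.contMDiff (by fun_prop : ContDiff ℝ ∞ fun q : ℝ × ℝ => ((0 : ℝ), q.1))))
    contMDiff_const (fun _ => (hx.2.1 0 h0).1.symm)
  have hd : ContMDiff 𝓘(ℝ, ℝ) 𝓘(ℝ, EP) ∞ (fun t => Y (t, 0)) :=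
    hY.comp (ContDiff.contMDiff (by fun_prop : ContDiff ℝ ∞ fun t : ℝ => (t, (0 : ℝ))))
  obtain ⟨y, hy, hy0, hyX, hyA⟩ := A.exists_lift (X := x) hx.1 hd (fun t => hYX (t, 0))
  refine ⟨y, hy, fun q _ => hyX q, fun τ hτ => ?_, fun σ _ τ _ => ?_⟩
  · rw [hy0]
    refine ((PrincipalConnection.HorizontalAt.eq_iff (A := A) (c := fun t => Y (t, 0))
      (c' := fun _ => p₀) hτ.1 hd.continuous.continuousOn continuousOn_const (fun t ht => ?_)
      (fun t _ => ⟨hd.mdifferentiable (by simp) t, ?_⟩) (fun t _ => horizontalAt_const A p₀ t)).1 (hY0 0))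
    · rw [hYX]; exact (hx.2.1 t ⟨ht.1, ht.2.trans hτ.2⟩).1
    · rw [A.form.pull_slice_one (hY.mdifferentiable (by simp) (t, 0)), hYA]
  · exact (form_dSigma_eq_pull A y σ τ).trans (hyA (σ, τ))

omit [FiniteDimensional ℝ EG] [IsManifold 𝓘(ℝ, EP) ∞ P] in
theorem IsHorizontalLift.eqOn {x : ℝ × ℝ → M} {y y' : ℝ × ℝ → P} (h : IsHorizontalLift A p₀ x y)
    (h' : IsHorizontalLift A p₀ x y') : EqOn y y' paramSquare := by
  rintro ⟨σ, τ⟩ ⟨hσ, hτ⟩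
  have hmem : ∀ t ∈ Icc 0 σ, (t, τ) ∈ paramSquare := fun t ht => ⟨⟨ht.1, ht.2.trans hσ.2⟩, hτ⟩
  have hc : Continuous fun t : ℝ => (t, τ) := by fun_prop
  refine ((PrincipalConnection.HorizontalAt.eq_iff (A := A) (c := fun t => y (t, τ))
    (c' := fun t => y' (t, τ)) hσ.1 (h.1.continuous.comp hc).continuousOn
    (h'.1.continuous.comp hc).continuousOn (fun t ht => ?_)
    (fun t ht => h.horizontalAt (hmem t (Ioo_subset_Icc_self ht)))
    (fun t ht => h'.horizontalAt (hmem t (Ioo_subset_Icc_self ht)))).1 ?_)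
  · rw [h.2.1 _ (hmem t ht), h'.2.1 _ (hmem t ht)]
  · rw [h.2.2.1 τ hτ, h'.2.2.1 τ hτ]

lemma IsHorizontalLift.formW_eq {x : ℝ × ℝ → M} {y y' : ℝ × ℝ → P} (h : IsHorizontalLift A p₀ x y)
    (h' : IsHorizontalLift A p₀ x y') {q : ℝ × ℝ} (hq : q ∈ paramSquare) :
    formW B y q.1 q.2 = formW B y' q.1 q.2 := by
  refine eqOn_paramSquare (contDiff_formW B h.1).continuous (contDiff_formW B h'.1).continuous
    (fun q hq => ?_) hq
  simp only [formW_eq_pull]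
  rw [B.form.pull_congr (y' := y')]
  filter_upwards [isOpen_openSquare.mem_nhds hq] with q' hq' using h.eqOn h' (openSquare_subset hq')

lemma IsHorizontalLift.totalW_eq {x : ℝ × ℝ → M} {y y' : ℝ × ℝ → P} (h : IsHorizontalLift A p₀ x y)
    (h' : IsHorizontalLift A p₀ x y') {τ : ℝ} (hτ : τ ∈ Icc 0 (2 * Real.pi)) :
    totalW B y τ = totalW B y' τ := by
  refine intervalIntegral.integral_congr fun σ hσ => ?_
  rw [uIcc_of_le two_pi_pos'.le] at hσ
  exact h.formW_eq h' (q := (σ, τ)) ⟨hσ, hτ⟩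

lemma toSpanSingleton_comp' {E E' : Type*} [NormedAddCommGroup E] [NormedSpace ℝ E]
    [NormedAddCommGroup E'] [NormedSpace ℝ E'] (D : E →L[ℝ] E') (ξ : E) :
    D.comp (ContinuousLinearMap.toSpanSingleton ℝ ξ) = ContinuousLinearMap.toSpanSingleton ℝ (D ξ) := by
  ext; simp

omit [FiniteDimensional ℝ EG] [T2Space G] [IsManifold 𝓘(ℝ, EP) ∞ P] in
lemma IsHorizontalLift.hasHolonomy {x : ℝ × ℝ → M} {y : ℝ × ℝ → P} (h : IsHorizontalLift A p₀ x y)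
    {V : ℝ → G} (h1 : V 0 = 1) (hV : ∀ τ ∈ Icc 0 (2 * Real.pi),
      HasRD V (ContinuousLinearMap.toSpanSingleton ℝ (-totalW B y τ)) τ) :
    HasHolonomy A B p₀ x (V (2 * Real.pi)) := by
  refine ⟨y, h, V, h1, rfl, fun τ hτ => ?_⟩
  rw [loopConnection_eq B h.1]
  have h2 := (hV τ hτ).hasMFDerivAt
  exact (h2.congr_mfderiv (toSpanSingleton_comp' (E := EG) (E' := EG) _ _)).hasMFDerivWithinAt

/-- Both choices in the definition are immaterial: lifts agree on the square, hence have the same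
`totalW`, and solutions of the resulting equation with W(0) = 1 agree by uniqueness. -/
theorem HasHolonomy.eq {x : ℝ × ℝ → M} {y : ℝ × ℝ → P} {g : G} (hg : HasHolonomy A B p₀ x g)
    (h : IsHorizontalLift A p₀ x y) {V : ℝ → G} (h1 : V 0 = 1) (hV : ∀ τ ∈ Icc 0 (2 * Real.pi),
      HasRD V (ContinuousLinearMap.toSpanSingleton ℝ (-totalW B y τ)) τ) :
    g = V (2 * Real.pi) := by
  obtain ⟨y', hy', W, hW0, rfl, hW⟩ := hg
  have hT := topologicalGroup_of_smooth EG G inferInstance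
  have hWrd : ∀ τ ∈ Ioo 0 (2 * Real.pi),
      HasRD W (ContinuousLinearMap.toSpanSingleton ℝ (-totalW B y τ)) τ := by
    intro τ hτ
    obtain ⟨C, hC⟩ : ∃ C : EG →L[ℝ] EG, HasMFDerivAt 𝓘(ℝ, EG) 𝓘(ℝ, EG) (fun x => x * W τ) (1 : G) C :=
      ⟨_, hasMFDerivAt_mul_const _ _⟩
    refine hasRD_of_hasMFDerivAt hC ?_
    have h3 := (hW τ (Ioo_subset_Icc_self hτ)).hasMFDerivAt (Icc_mem_nhds hτ.1 hτ.2)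
    have h4 : (mfderiv 𝓘(ℝ, EG) 𝓘(ℝ, EG) (fun h : G => h * W τ) 1
            (-loopConnection B (fun σ => y' (σ, τ)) (fun σ => dTau EP y' σ τ) : EG) : EG) =
        C (-totalW B y τ) := by
      rw [loopConnection_eq B hy'.1, hy'.totalW_eq h (Ioo_subset_Icc_self hτ)]
      exact congrArg (fun D : EG →L[ℝ] EG => D (-totalW B y τ)) hC.mfderiv
    exact h3.congr_mfderiv ((congrArg (ContinuousLinearMap.toSpanSingleton ℝ : EG → ℝ →L[ℝ] EG) h4).trans
      (toSpanSingleton_comp' (E := EG) (E' := EG) _ _).symm)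
  have hVc : ContinuousOn V (Icc 0 (2 * Real.pi)) := fun τ hτ => (hV τ hτ).1.continuousWithinAt
  have hWc : ContinuousOn W (Icc 0 (2 * Real.pi)) := fun τ hτ => (hW τ hτ).1
  have h5 := HasRD.eq_of_zero (W := fun t => (W t)⁻¹ * V t) (EG := EG) two_pi_pos'.le (hWc.inv.mul hVc)
    fun τ hτ => by
      simpa using (hWrd τ hτ).inv.mul (hV τ (Ioo_subset_Icc_self hτ))
  simp only [hW0, h1, inv_one, mul_one] at h5
  exact inv_mul_eq_one.1 h5.symm

end Holonomy

/-! ### Variation of a parallel transport in the group with a parameter. -/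

section Variation

variable {EG : Type*} [NormedAddCommGroup EG] [NormedSpace ℝ EG]

/-- The primitive of `b(·, τ)` that vanishes at `σ = 0`. -/
def primitive (b : ℝ × ℝ → EG) (q : ℝ × ℝ) : EG := ∫ t in (0 : ℝ)..q.1, b (t, q.2)

/-- The substitution t ↦ σt fixes the interval of integration, so the variable endpoint becomes a
parameter. -/
lemma contDiff_primitive [FiniteDimensional ℝ EG] {b : ℝ × ℝ → EG} (hb : ContDiff ℝ ∞ b) : ContDiff ℝ ∞ (primitive b) := by
  have h : primitive b = fun q : ℝ × ℝ => q.1 • ∫ t in (0 : ℝ)..1, b (q.1 * t, q.2) := by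
    ext ⟨σ, τ⟩
    rw [intervalIntegral.smul_integral_comp_mul_left (f := fun t => b (t, τ))]
    simp [primitive]
  rw [h]
  exact contDiff_fst.smul (contDiff_intervalIntegral
    (f := fun q : (ℝ × ℝ) × ℝ => b (q.1.1 * q.2, q.1.2)) (by fun_prop) 0 1)

lemma fderiv_clm_apply_const' {E F F' : Type*} [NormedAddCommGroup E] [NormedSpace ℝ E]
    [NormedAddCommGroup F] [NormedSpace ℝ F] [NormedAddCommGroup F'] [NormedSpace ℝ F']
    {L : E → F →L[ℝ] F'} {q : E} (hL : DifferentiableAt ℝ L q) (v : F) :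
    HasFDerivAt (fun q => L q v) ((fderiv ℝ L q).flip v) q := by
  simpa using hL.hasFDerivAt.clm_apply (hasFDerivAt_const v q)

variable {G : Type*} [TopologicalSpace G] [ChartedSpace EG G] [Group G] [LieGroup 𝓘(ℝ, EG) ∞ G]

/-- The bracket term that has to vanish for the holonomy to be stationary. -/
def obstruction (G : Type*) [TopologicalSpace G] [ChartedSpace EG G] [Group G]
    [LieGroup 𝓘(ℝ, EG) ∞ G] (b f α : ℝ × ℝ → EG) (q : ℝ × ℝ) : EG :=
  brk G (α q) (b q) - brk G (f q) (primitive b (2 * Real.pi, q.2) - primitive b q) +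
    brk G (b q) (primitive b (2 * Real.pi, q.2))

lemma continuous_obstruction [FiniteDimensional ℝ EG] {b f α : ℝ × ℝ → EG} (hb : ContDiff ℝ ∞ b)
    (hf : Continuous f) (hα : Continuous α) : Continuous (obstruction G b f α) := by
  have : CompleteSpace EG := FiniteDimensional.complete ℝ EG
  have h1 : Continuous (primitive b) := (contDiff_primitive hb).continuous
  have h2 : Continuous b := hb.continuous
  have h3 : Continuous fun q : ℝ × ℝ => primitive b (2 * Real.pi, q.2) := h1.comp (by fun_prop)
  unfold obstruction
  fun_prop

lemma HasRD.continuousAt_Adj {F : Type*} [NormedAddCommGroup F] [NormedSpace ℝ F] {W : F → G}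
    {L : F →L[ℝ] EG} {q : F} (h : HasRD W L q) :
    ContinuousAt (fun q => (Adj (W q) : EG →L[ℝ] EG)) q :=
  h.hasFDerivAt_Adj.continuousAt

/-- Variation of constants: when V' = -aV, conjugation by V⁻¹ removes the term [Z, a] from Z' = [Z,
a] - k. -/
lemma integral_adjoint_equation [CompleteSpace EG] {V : ℝ → G} {Z a k : ℝ → EG} {r : ℝ} (hr : 0 ≤ r)
    (hV : ∀ t, HasRD V (ContinuousLinearMap.toSpanSingleton ℝ (-a t)) t) (hZc : Continuous Z)
    (hk : Continuous k) (hZ : ∀ t ∈ Ioo 0 r, HasDerivAt Z (brk G (Z t) (a t) - k t) t) :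
    Adj (V r)⁻¹ (Z r) - Adj (V 0)⁻¹ (Z 0) = -∫ t in (0 : ℝ)..r, Adj (V t)⁻¹ (k t) := by
  have hAc : Continuous fun t => (Adj (V t)⁻¹ : EG →L[ℝ] EG) :=
    continuous_iff_continuousAt.2 fun t => (hV t).inv.continuousAt_Adj
  have hd : ∀ t ∈ Ioo 0 r, HasDerivAt (fun t => Adj (V t)⁻¹ (Z t)) (-Adj (V t)⁻¹ (k t)) t := by
    intro t ht
    obtain ⟨ζ', hζ⟩ : ∃ ζ', HasDerivAt (fun t => Adj (V t)⁻¹ (Z t)) ζ' t :=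
      ⟨_, (((hV t).inv.hasFDerivAt_Adj.clm_apply (hZ t ht).hasFDerivAt).hasDerivAt)⟩
    -- The derivative of Ad(V⁻¹)Z is known to exist; it is computed by differentiating
    -- Ad(V)(Ad(V⁻¹)Z) = Z.
    have h1 := ((hV t).hasFDerivAt_Adj.clm_apply hζ.hasFDerivAt).hasDerivAt
    simp only [Adj_apply_Adj_inv] at h1
    have h2 := h1.unique (hZ t ht)
    simp at h2
    rw [show ζ' = -Adj (V t)⁻¹ (k t) by
      have h3 : Adj (V t) ζ' = - k t := by
        have := brk_antisymm (G := G) (Z t) (a t)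
        rw [this] at h2
        simpa [sub_eq_add_neg, add_comm] using h2
      rw [← Adj_inv_apply_Adj (V t) ζ', h3, map_neg]] at hζ
    exact hζ
  rw [← intervalIntegral.integral_neg]
  exact (intervalIntegral.integral_eq_sub_of_hasDerivAt_of_le hr (hAc.clm_apply hZc).continuousOn hd
    ((hAc.clm_apply hk).neg.intervalIntegrable _ _)).symm

lemma rd_apply_time {F : Type*} [NormedAddCommGroup F] [NormedSpace ℝ F] {W : ℝ × F → G}
    {a : EG} {t : ℝ} {p : F} (hW : ContMDiffAt 𝓘(ℝ, ℝ × F) 𝓘(ℝ, EG) ∞ W (t, p))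
    (h : HasRD (fun t => W (t, p)) (ContinuousLinearMap.toSpanSingleton ℝ a) t) :
    rd EG W (t, p) (1, 0) = a := by
  have h1 : HasRD W (rd EG W (t, p)) (t, p) := hW.hasRD (by simp)
  have h2 : HasRD (fun t => W (t, p)) _ t :=
    HasRD.comp (c := fun t => (t, p)) h1 (hasFDerivAt_prodMk_left t p)
  simpa using congrArg (fun L : ℝ →L[ℝ] EG => L 1) (h2.unique h)

lemma rd_apply_param_eq_zero {F : Type*} [NormedAddCommGroup F] [NormedSpace ℝ F] {W : ℝ × F → G}
    {t : ℝ} {p : F} (hW : ContMDiffAt 𝓘(ℝ, ℝ × F) 𝓘(ℝ, EG) ∞ W (t, p))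
    (h : ∀ p, W (t, p) = 1) (v : F) : rd EG W (t, p) (0, v) = 0 := by
  have h1 : HasRD W (rd EG W (t, p)) (t, p) := hW.hasRD (by simp)
  have h2 : HasRD (fun p => W (t, p)) _ p :=
    HasRD.comp (c := fun p => (t, p)) h1 (hasFDerivAt_prodMk_right t p)
  have h3 : HasRD (fun p : F => W (t, p)) (0 : F →L[ℝ] EG) p := by
    simp only [h]; exact hasRD_const _ _
  simpa using congrArg (fun L : F →L[ℝ] EG => L v) (h2.unique h3)

/-- The variation of the solution of `dW/dτ = -a W` with a parameter `s`. -/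
theorem variation_formula [FiniteDimensional ℝ EG] {a : ℝ × ℝ → EG} {W : ℝ × ℝ → G}
    (hW : ContMDiff 𝓘(ℝ, ℝ × ℝ) 𝓘(ℝ, EG) ∞ W) (hW0 : ∀ s, W (0, s) = 1)
    (ha : ContDiff ℝ ∞ a)
    (hWa : ∀ s τ, HasRD (fun τ => W (τ, s)) (ContinuousLinearMap.toSpanSingleton ℝ (-a (τ, s))) τ)
    {b f α : ℝ × ℝ → EG} (hb : ContDiff ℝ ∞ b) (hf : Continuous f) (hα : Continuous α)
    {v : ℝ × ℝ → ℝ} (hv : ContDiff ℝ ∞ v)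
    (hv0 : ∀ σ ∈ Icc 0 (2 * Real.pi), v (σ, 0) = 0 ∧ v (σ, 2 * Real.pi) = 0) {s : ℝ}
    (has : ∀ τ ∈ Ioo 0 (2 * Real.pi), a (τ, s) = primitive b (2 * Real.pi, τ))
    (hda : ∀ τ ∈ Ioo 0 (2 * Real.pi), fderiv ℝ a (τ, s) (0, 1) =
      deriv (fun τ => ∫ σ in (0 : ℝ)..(2 * Real.pi), v (σ, τ) • b (σ, τ)) τ +
      ∫ σ in (0 : ℝ)..(2 * Real.pi), v (σ, τ) • (brk G (α (σ, τ)) (b (σ, τ)) -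
        brk G (f (σ, τ)) (primitive b (2 * Real.pi, τ) - primitive b (σ, τ)))) :
    Adj (W (2 * Real.pi, s))⁻¹ (rd EG W (2 * Real.pi, s) (0, 1)) =
      -∫ τ in (0 : ℝ)..(2 * Real.pi), Adj (W (τ, s))⁻¹
        (∫ σ in (0 : ℝ)..(2 * Real.pi), v (σ, τ) • obstruction G b f α (σ, τ)) := by
  have : CompleteSpace EG := FiniteDimensional.complete ℝ EG
  set Y : ℝ → EG := fun τ => ∫ σ in (0 : ℝ)..(2 * Real.pi), v (σ, τ) • b (σ, τ) with hYdef
  have hY : ContDiff ℝ ∞ Y := contDiff_intervalIntegral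
    (f := fun q : ℝ × ℝ => v (q.2, q.1) • b (q.2, q.1)) (by fun_prop) _ _
  set k : ℝ → EG := fun τ => ∫ σ in (0 : ℝ)..(2 * Real.pi), v (σ, τ) • obstruction G b f α (σ, τ) with hk
  have hobs := continuous_obstruction (G := G) hb hf hα
  have hbc := hb.continuous
  have hpc := (contDiff_primitive hb).continuous
  have hvc := hv.continuous
  have hkc : Continuous k := by
    refine intervalIntegral.continuous_parametric_intervalIntegral_of_continuous' ?_ _ _
    simp only [Function.uncurry_def]
    fun_prop
  set ρ : ℝ → EG := fun τ => rd EG W (τ, s) (0, 1) with hρ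
  have hrd := hW.contDiff_rd
  have hρd : ∀ τ, HasDerivAt ρ (fderiv ℝ (rd EG W) (τ, s) (1, 0) (0, 1)) τ := by
    intro τ
    have h1 := fderiv_clm_apply_const' (hrd.differentiable (by simp) (τ, s)) ((0, 1) : ℝ × ℝ)
    have h2 := (h1.comp (f := fun τ => (τ, s)) τ (hasFDerivAt_prodMk_left τ s)).hasDerivAt
    exact h2.congr_deriv (by simp)
  have hrdt : ∀ q : ℝ × ℝ, rd EG W q (1, 0) = - a q := fun q => rd_apply_time (hW _) (hWa q.2 q.1)
  -- The Maurer-Cartan equation in the directions s and τ, with τ-component -a, is an ordinary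
  -- differential equation for the s-component ρ along τ.
  have hMC : ∀ τ, fderiv ℝ (rd EG W) (τ, s) (1, 0) (0, 1) =
      -fderiv ℝ a (τ, s) (0, 1) + brk G (ρ τ) (a (τ, s)) := by
    intro τ
    have h1 := (hW (τ, s)).fderiv_rd_sub ((0, 1) : ℝ × ℝ) (1, 0)
    have h2 := fderiv_clm_apply_const' (hrd.differentiable (by simp) (τ, s)) ((1, 0) : ℝ × ℝ)
    simp only [hrdt] at h2
    have h3 := congrArg (fun L : ℝ × ℝ →L[ℝ] EG => L (0, 1))
      (h2.unique (ha.differentiable (by simp) (τ, s)).hasFDerivAt.neg)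
    simp only [ContinuousLinearMap.flip_apply, neg_apply] at h3
    rw [h3, hrdt, map_neg] at h1
    rw [sub_eq_iff_eq_add] at h1
    rw [h1]
    simp only [hρ]
    abel
  -- Adding Y cancels the total derivative in ∂a/∂s, at the cost of [Y, a]; this is the third
  -- bracket of the obstruction.
  have hmain := integral_adjoint_equation (G := G) (V := fun τ => W (τ, s)) (Z := fun τ => ρ τ + Y τ)
    (a := fun τ => a (τ, s)) (k := k) two_pi_pos'.le (fun τ => hWa s τ)
    ((continuous_iff_continuousAt.2 fun τ => (hρd τ).continuousAt).add hY.continuous) hkc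
    (fun τ hτ => by
      refine ((hρd τ).add (hY.differentiable (by simp) τ).hasDerivAt).congr_deriv ?_
      have h1 : brk G (Y τ) (a (τ, s)) = ∫ σ in (0 : ℝ)..(2 * Real.pi),
          v (σ, τ) • brk G (b (σ, τ)) (primitive b (2 * Real.pi, τ)) := by
        have := ((brk G).flip (a (τ, s))).intervalIntegral_comp_comm (μ := volume) (a := 0) (b := 2 * Real.pi)
          (f := fun σ => v (σ, τ) • b (σ, τ))
          (Continuous.intervalIntegrable (by fun_prop) _ _)
        simp only [ContinuousLinearMap.flip_apply, map_smul, has τ hτ] at this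
        rw [has τ hτ, ← this]
      have h2 : k τ = (∫ σ in (0 : ℝ)..(2 * Real.pi), v (σ, τ) • (brk G (α (σ, τ)) (b (σ, τ)) -
          brk G (f (σ, τ)) (primitive b (2 * Real.pi, τ) - primitive b (σ, τ)))) +
          brk G (Y τ) (a (τ, s)) := by
        rw [h1, ← intervalIntegral.integral_add]
        · simp only [hk, obstruction, smul_add]
        · exact Continuous.intervalIntegrable (by fun_prop) _ _
        · exact Continuous.intervalIntegrable (by fun_prop) _ _
      rw [hMC, hda τ hτ, h2, map_add, add_apply]
      abel)
  have hY0 : Y 0 = 0 := by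
    refine (intervalIntegral.integral_congr (g := fun _ => 0) fun σ hσ => ?_).trans (by simp)
    rw [uIcc_of_le two_pi_pos'.le] at hσ
    simp [(hv0 σ hσ).1]
  have hY1 : Y (2 * Real.pi) = 0 := by
    refine (intervalIntegral.integral_congr (g := fun _ => 0) fun σ hσ => ?_).trans (by simp)
    rw [uIcc_of_le two_pi_pos'.le] at hσ
    simp [(hv0 σ hσ).2]
  have hρ0 : ρ 0 = 0 := rd_apply_param_eq_zero (hW _) hW0 1
  simpa [hY0, hY1, hρ0] using hmain

end Variation

/-! ### The gauge transformation restoring horizontality of a deformed surface. -/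

section GaugeVariation

variable {EG EM EP : Type*}
  [NormedAddCommGroup EG] [NormedSpace ℝ EG] [NormedAddCommGroup EM] [NormedSpace ℝ EM]
  [NormedAddCommGroup EP] [NormedSpace ℝ EP]
  {G M P : Type*} [TopologicalSpace G] [ChartedSpace EG G] [Group G]
  [TopologicalSpace M] [ChartedSpace EM M] [TopologicalSpace P] [ChartedSpace EP P]
  {S : PrincipalBundle EG EM EP G M P} {A : PrincipalConnection S} {B : AdjointTwoForm S} {p₀ : P}

lemma alternating_two_plane {V : Type*} [NormedAddCommGroup V] [NormedSpace ℝ V]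
    (f : (ℝ × ℝ) [⋀^Fin 2]→L[ℝ] V) (w w' : ℝ × ℝ) :
    f ![w, w'] = (w.1 * w'.2 - w.2 * w'.1) • f ![(1, 0), (0, 1)] := by
  have h1 : ∀ (w u : ℝ × ℝ), f ![w, u] = w.1 • f ![(1, 0), u] + w.2 • f ![(0, 1), u] := by
    intro w u
    rw [← alternating_two_smul, ← alternating_two_smul, ← alternating_two_add]
    simp
  rw [h1, alternating_two_swap f (1, 0), alternating_two_swap f (0, 1), h1 w', h1 w',
    alternating_two_self, alternating_two_self, alternating_two_swap f (0, 1) (1, 0)]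
  module

lemma alternating_one_plane {V : Type*} [NormedAddCommGroup V] [NormedSpace ℝ V]
    (f : (ℝ × ℝ) [⋀^Fin 1]→L[ℝ] V) (w : ℝ × ℝ) :
    f ![w] = w.1 • f ![(1, 0)] + w.2 • f ![(0, 1)] := by
  rw [← alternating_one_smul, ← alternating_one_smul, ← alternating_one_add]
  simp

lemma VForm.pull_comp_one {X E : Type*} [NormedAddCommGroup E] [NormedSpace ℝ E] [TopologicalSpace X]
    [ChartedSpace E X] {V : Type*} [NormedAddCommGroup V] [NormedSpace ℝ V] (α : VForm E X V 1)
    {F F' : Type*} [NormedAddCommGroup F] [NormedSpace ℝ F] [NormedAddCommGroup F'] [NormedSpace ℝ F']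
    {y : F → X} {h : F' → F} {q : F'} {H : F' →L[ℝ] F}
    (hy : MDifferentiableAt 𝓘(ℝ, F) 𝓘(ℝ, E) y (h q)) (hh : HasFDerivAt h H q) (u : F') :
    α.pull (fun q => y (h q)) q ![u] = α.pull y (h q) ![H u] := by
  rw [α.pull_comp hy hh]
  exact congrArg (α.pull y (h q)) (by ext i : 1; fin_cases i; rfl)

lemma VForm.pull_comp_two {X E : Type*} [NormedAddCommGroup E] [NormedSpace ℝ E] [TopologicalSpace X]
    [ChartedSpace E X] {V : Type*} [NormedAddCommGroup V] [NormedSpace ℝ V] (α : VForm E X V 2)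
    {F F' : Type*} [NormedAddCommGroup F] [NormedSpace ℝ F] [NormedAddCommGroup F'] [NormedSpace ℝ F']
    {y : F → X} {h : F' → F} {q : F'} {H : F' →L[ℝ] F}
    (hy : MDifferentiableAt 𝓘(ℝ, F) 𝓘(ℝ, E) y (h q)) (hh : HasFDerivAt h H q) (u v : F') :
    α.pull (fun q => y (h q)) q ![u, v] = α.pull y (h q) ![H u, H v] := by
  rw [α.pull_comp hy hh]
  exact congrArg (α.pull y (h q)) (by ext i : 1; fin_cases i <;> rfl)

section Reparametrization

variable {H : ℝ × (ℝ × ℝ) → ℝ × ℝ} {s : ℝ}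

/-- The velocity of a family of maps of the plane. -/
def velocity (H : ℝ × (ℝ × ℝ) → ℝ × ℝ) (s : ℝ) (p : ℝ × ℝ) : ℝ × ℝ := fderiv ℝ H (s, p) (1, 0)

lemma contDiff_velocity (hH : ContDiff ℝ ∞ H) (s : ℝ) : ContDiff ℝ ∞ (velocity H s) :=
  ((hH.fderiv_right (m := ∞) (by simp)).clm_apply contDiff_const).comp
    (contDiff_const.prodMk contDiff_id)

lemma velocity_eq_zero (hH : ContDiff ℝ ∞ H) {p : ℝ × ℝ} (h : ∀ᶠ r in 𝓝 s, H (r, p) = p) :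
    velocity H s p = 0 := by
  have h1 := ((hH.differentiable (by simp) (s, p)).hasFDerivAt.comp (f := fun r => (r, p)) s
    (hasFDerivAt_prodMk_left s p)).unique ((hasFDerivAt_const p s).congr_of_eventuallyEq h)
  simpa [velocity] using congrArg (fun L : ℝ →L[ℝ] ℝ × ℝ => L 1) h1

lemma fderiv_eq_id (hH : ContDiff ℝ ∞ H) (h : ∀ p ∈ paramSquare, H (s, p) = p) {p : ℝ × ℝ}
    (hp : p ∈ openSquare) (w : ℝ × ℝ) : fderiv ℝ H (s, p) (0, w) = w := by
  have h1 := ((hH.differentiable (by simp) (s, p)).hasFDerivAt.comp (f := fun p => (s, p)) p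
    (hasFDerivAt_prodMk_right s p)).unique ((hasFDerivAt_id p).congr_of_eventuallyEq (by
      filter_upwards [isOpen_openSquare.mem_nhds hp] with p' hp'
      exact h p' (openSquare_subset hp')))
  simpa using congrArg (fun L : ℝ × ℝ →L[ℝ] ℝ × ℝ => L w) h1

/-- Symmetry of the second derivative of H: differentiating the velocity in space equals
differentiating DH in s. -/
lemma fderiv_velocity (hH : ContDiff ℝ ∞ H) (s : ℝ) (p w : ℝ × ℝ) :
    fderiv ℝ (velocity H s) p w = fderiv ℝ (fderiv ℝ H) (s, p) (1, 0) (0, w) := by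
  have h1 : DifferentiableAt ℝ (fderiv ℝ H) (s, p) :=
    (hH.fderiv_right (m := ∞) (by simp)).differentiable (by simp) _
  have h2 := (fderiv_clm_apply_const' h1 ((1, 0) : ℝ × (ℝ × ℝ))).comp (f := fun p => (s, p)) p
    (hasFDerivAt_prodMk_right s p)
  have h3 : HasFDerivAt (velocity H s) _ p := h2
  rw [h3.fderiv]
  have h4 := (hH.contDiffAt (x := (s, p))).isSymmSndFDerivAt minSmoothness_two_le
  simpa using h4 (0, w) (1, 0)

end Reparametrization

variable [FiniteDimensional ℝ EG] [LieGroup 𝓘(ℝ, EG) ∞ G] [T2Space G] [IsManifold 𝓘(ℝ, EP) ∞ P]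

/-- By the gauge law, this equation for g says exactly that Y·g is horizontal in σ; g = 1 on the
edge σ = 0 keeps the starting points. -/
lemma PrincipalConnection.exists_gauge (A : PrincipalConnection S) {Y : ℝ × (ℝ × ℝ) → P}
    (hY : ContMDiff 𝓘(ℝ, ℝ × (ℝ × ℝ)) 𝓘(ℝ, EP) ∞ Y) : ∃ g : ℝ × (ℝ × ℝ) → G,
      ContMDiff 𝓘(ℝ, ℝ × (ℝ × ℝ)) 𝓘(ℝ, EG) ∞ g ∧ (∀ s τ, g (s, (0, τ)) = 1) ∧
      ∀ q, rd EG g q (0, (1, 0)) = -A.form.pull Y q ![(0, (1, 0))] := by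
  have : CompleteSpace EG := FiniteDimensional.complete ℝ EG
  -- The evolution variable of the group equation is σ, so it is exchanged with s.
  let L : ℝ × (ℝ × ℝ) → ℝ × (ℝ × ℝ) := fun q => (q.2.1, (q.1, q.2.2))
  have hL : ContDiff ℝ ∞ L := by fun_prop
  obtain ⟨g, hg, hg0, hgr⟩ := exists_group_solution (G := G) (F := ℝ × ℝ)
    (a := fun q => -A.form.pull Y (L q) ![(0, (1, 0))])
    ((A.smooth.contDiff_pull hY _).comp hL).neg
  refine ⟨fun q => g (L q), hg.comp hL.contMDiff, fun s τ => hg0 _, fun q => ?_⟩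
  have h1 : HasRD g (rd EG g (L q)) (L q) := (hg _).hasRD (by simp)
  have hLd : HasFDerivAt L (fderiv ℝ L q) q := (hL.differentiable (by simp) q).hasFDerivAt
  have hLe : fderiv ℝ L q (0, (1, 0)) = (1, 0) := by
    have h2 : HasFDerivAt L ((ContinuousLinearMap.fst ℝ ℝ ℝ ∘L ContinuousLinearMap.snd ℝ ℝ (ℝ × ℝ)).prod
      ((ContinuousLinearMap.fst ℝ ℝ (ℝ × ℝ)).prod
        (ContinuousLinearMap.snd ℝ ℝ ℝ ∘L ContinuousLinearMap.snd ℝ ℝ (ℝ × ℝ)))) q :=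
      ContinuousLinearMap.hasFDerivAt ((ContinuousLinearMap.fst ℝ ℝ ℝ ∘L ContinuousLinearMap.snd ℝ ℝ (ℝ × ℝ)).prod
      ((ContinuousLinearMap.fst ℝ ℝ (ℝ × ℝ)).prod
        (ContinuousLinearMap.snd ℝ ℝ ℝ ∘L ContinuousLinearMap.snd ℝ ℝ (ℝ × ℝ))))
    rw [h2.fderiv]; rfl
  rw [(h1.comp hLd).rd_eq, ContinuousLinearMap.comp_apply, hLe]
  exact rd_apply_time (hg _) (hgr (L q).2 (L q).1)

variable {y : ℝ × ℝ → P} {H : ℝ × (ℝ × ℝ) → ℝ × ℝ} {g : ℝ × (ℝ × ℝ) → G} {s : ℝ}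

omit [FiniteDimensional ℝ EG] [T2Space G] [LieGroup 𝓘(ℝ, EG) ∞ G] [IsManifold 𝓘(ℝ, EP) ∞ P] in
lemma gauge_pull (hy : ContMDiff 𝓘(ℝ, ℝ × ℝ) 𝓘(ℝ, EP) ∞ y) (hH : ContDiff ℝ ∞ H) (q u : ℝ × (ℝ × ℝ)) :
    A.form.pull (fun q => y (H q)) q ![u] = A.form.pull y (H q) ![fderiv ℝ H q u] :=
  A.form.pull_comp_one (hy.mdifferentiable (by simp) _) (hH.differentiable (by simp) q).hasFDerivAt u

omit [FiniteDimensional ℝ EG] [IsManifold 𝓘(ℝ, EP) ∞ P] in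
-- Where H_s is the identity the surface is already horizontal, so g is constant in σ and keeps its
-- value 1 from the edge.
lemma gauge_eq_one (hy : ContMDiff 𝓘(ℝ, ℝ × ℝ) 𝓘(ℝ, EP) ∞ y) (hH : ContDiff ℝ ∞ H)
    (hg : ContMDiff 𝓘(ℝ, ℝ × (ℝ × ℝ)) 𝓘(ℝ, EG) ∞ g) (hg0 : ∀ s τ, g (s, (0, τ)) = 1)
    (hgA : ∀ q, rd EG g q (0, (1, 0)) = -A.form.pull (fun q => y (H q)) q ![(0, (1, 0))])
    (hH0 : ∀ p ∈ paramSquare, H (s, p) = p)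
    (hyA : ∀ p ∈ paramSquare, A.form.pull y p ![(1, 0)] = 0) {p : ℝ × ℝ} (hp : p ∈ openSquare) :
    g (s, p) = 1 := by
  have hc : Continuous fun σ : ℝ => (s, (σ, p.2)) := by fun_prop
  have hd : ∀ σ : ℝ, HasFDerivAt (fun σ : ℝ => (s, (σ, p.2)))
      ((ContinuousLinearMap.inr ℝ ℝ (ℝ × ℝ)).comp (ContinuousLinearMap.inl ℝ ℝ ℝ)) σ := fun σ =>
    (hasFDerivAt_prodMk_right s (σ, p.2)).comp (f := fun σ => (σ, p.2)) σ (hasFDerivAt_prodMk_left σ p.2)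
  have h1 := HasRD.eq_of_zero (EG := EG) (W := fun σ => g (s, (σ, p.2))) hp.1.1.le
    (hg.continuous.comp hc).continuousOn (fun σ hσ => ?_)
  · rw [hg0] at h1; exact h1.symm
  · have hmem : (σ, p.2) ∈ openSquare := ⟨⟨hσ.1, hσ.2.trans hp.1.2⟩, hp.2⟩
    have h2 := ((hg (s, (σ, p.2))).hasRD (by simp)).comp (c := fun σ => (s, (σ, p.2))) (hd σ)
    refine (?_ : _ = (0 : ℝ →L[ℝ] EG)) ▸ h2
    ext
    have h3 := hgA (s, (σ, p.2))
    rw [gauge_pull hy hH, fderiv_eq_id hH hH0 hmem, hH0 _ (openSquare_subset hmem),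
      hyA _ (openSquare_subset hmem), neg_zero] at h3
    simpa using h3

/-- The variation of the gauge transformation, corrected by the connection. -/
def gaugeVelocity (A : PrincipalConnection S) (y : ℝ × ℝ → P) (H : ℝ × (ℝ × ℝ) → ℝ × ℝ)
    (g : ℝ × (ℝ × ℝ) → G) (s : ℝ) (p : ℝ × ℝ) : EG :=
  rd EG g (s, p) (1, 0) + A.form.pull (fun q => y (H q)) (s, p) ![(1, 0)]

/-- The curvature of the connection on a surface with horizontal lift `y`. -/
def curvPull (A : PrincipalConnection S) (y : ℝ × ℝ → P) (p : ℝ × ℝ) : EG :=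
  A.form.extDer.pull y p ![(1, 0), (0, 1)]

omit [T2Space G] in
lemma contDiff_gaugeVelocity (hy : ContMDiff 𝓘(ℝ, ℝ × ℝ) 𝓘(ℝ, EP) ∞ y) (hH : ContDiff ℝ ∞ H)
    (hg : ContMDiff 𝓘(ℝ, ℝ × (ℝ × ℝ)) 𝓘(ℝ, EG) ∞ g) :
    ContDiff ℝ ∞ (gaugeVelocity A y H g s) := by
  have : CompleteSpace EG := FiniteDimensional.complete ℝ EG
  have h1 : ContDiff ℝ ∞ fun p : ℝ × ℝ => (s, p) := by fun_prop
  exact ((hg.contDiff_rd.clm_apply contDiff_const).comp h1).add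
    ((A.smooth.contDiff_pull (hy.comp hH.contMDiff) _).comp h1)

omit [FiniteDimensional ℝ EG] [T2Space G] [IsManifold 𝓘(ℝ, EP) ∞ P] in
lemma gaugeVelocity_zero (hy : ContMDiff 𝓘(ℝ, ℝ × ℝ) 𝓘(ℝ, EP) ∞ y) (hH : ContDiff ℝ ∞ H)
    (hg : ContMDiff 𝓘(ℝ, ℝ × (ℝ × ℝ)) 𝓘(ℝ, EG) ∞ g) (hg0 : ∀ s τ, g (s, (0, τ)) = 1) {τ : ℝ}
    (hHf : ∀ᶠ r in 𝓝 s, H (r, (0, τ)) = (0, τ)) : gaugeVelocity A y H g s (0, τ) = 0 := by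
  have h1 : rd EG g (s, (0, τ)) (1, 0) = 0 := by
    have h2 := ((hg (s, (0, τ))).hasRD (by simp)).comp (c := fun r => (r, ((0 : ℝ), τ)))
      (hasFDerivAt_prodMk_left s ((0 : ℝ), τ))
    have h3 : HasRD (fun r => g (r, ((0 : ℝ), τ))) (0 : ℝ →L[ℝ] EG) s := by
      simp only [hg0]; exact hasRD_const _ _
    simpa using congrArg (fun L : ℝ →L[ℝ] EG => L 1) (h2.unique h3)
  rw [gaugeVelocity, h1, gauge_pull hy hH, zero_add]
  have h4 : fderiv ℝ H (s, (0, τ)) (1, 0) = 0 := velocity_eq_zero hH hHf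
  rw [h4, alternating_one_plane]
  simp

omit [T2Space G] in
-- U is the s-component of A on the corrected family, while the σ-component vanishes for all s.
-- Hence ∂U/∂σ is the curvature on the σ-direction and the velocity, which only sees v₂. Concretely,
-- the Maurer-Cartan equation for g and the formula for dA are added, and the derivatives in s
-- cancel.
lemma hasDerivAt_gaugeVelocity (hy : ContMDiff 𝓘(ℝ, ℝ × ℝ) 𝓘(ℝ, EP) ∞ y) (hH : ContDiff ℝ ∞ H)
    (hg : ContMDiff 𝓘(ℝ, ℝ × (ℝ × ℝ)) 𝓘(ℝ, EG) ∞ g)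
    (hgA : ∀ q, rd EG g q (0, (1, 0)) = -A.form.pull (fun q => y (H q)) q ![(0, (1, 0))])
    (hH0 : ∀ p ∈ paramSquare, H (s, p) = p)
    (hyA : ∀ p ∈ paramSquare, A.form.pull y p ![(1, 0)] = 0) {p : ℝ × ℝ} (hp : p ∈ openSquare) :
    HasDerivAt (fun σ => gaugeVelocity A y H g s (σ, p.2)) ((velocity H s p).2 • curvPull A y p) p.1 := by
  have : CompleteSpace EG := FiniteDimensional.complete ℝ EG
  have hYs : ContMDiff 𝓘(ℝ, ℝ × (ℝ × ℝ)) 𝓘(ℝ, EP) ∞ (fun q => y (H q)) := hy.comp hH.contMDiff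
  have hd : HasFDerivAt (fun σ : ℝ => (s, (σ, p.2)))
      ((ContinuousLinearMap.inr ℝ ℝ (ℝ × ℝ)).comp (ContinuousLinearMap.inl ℝ ℝ ℝ)) p.1 :=
    (hasFDerivAt_prodMk_right s (p.1, p.2)).comp (f := fun σ => (σ, p.2)) p.1
      (hasFDerivAt_prodMk_left p.1 p.2)
  have hps := openSquare_subset hp
  have hrd : DifferentiableAt ℝ (rd EG g) (s, p) := hg.contDiff_rd.differentiable (by simp) _
  have hpull : ∀ u, DifferentiableAt ℝ (fun q => A.form.pull (fun q => y (H q)) q ![u]) (s, p) :=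
    fun u => (A.smooth.contDiff_pull hYs _).differentiable (by simp) _
  have h1 := (fderiv_clm_apply_const' hrd ((1, 0) : ℝ × (ℝ × ℝ))).comp p.1 hd
  have h2 := (hpull (1, 0)).hasFDerivAt.comp p.1 hd
  have hMC := (hg (s, p)).fderiv_rd_sub ((1, 0) : ℝ × (ℝ × ℝ)) (0, (1, 0))
  have hz : rd EG g (s, p) (0, (1, 0)) = 0 := by
    rw [hgA, gauge_pull hy hH, fderiv_eq_id hH hH0 hp, hH0 p hps, hyA p hps, neg_zero]
  have h3 : fderiv ℝ (rd EG g) (s, p) (1, 0) (0, (1, 0)) =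
      -fderiv ℝ (fun q => A.form.pull (fun q => y (H q)) q ![(0, (1, 0))]) (s, p) (1, 0) := by
    have h4 := fderiv_clm_apply_const' hrd ((0, (1, 0)) : ℝ × (ℝ × ℝ))
    simp only [hgA] at h4
    have := congrArg (fun L : ℝ × (ℝ × ℝ) →L[ℝ] EG => L (1, 0))
      (h4.unique (hpull (0, (1, 0))).hasFDerivAt.neg)
    simpa only [ContinuousLinearMap.flip_apply, neg_apply] using this
  rw [hz, map_zero, h3] at hMC
  have hex := (A.form.extDer.pull_two (fun q => y (H q)) (s, p) (1, 0) (0, (1, 0))).trans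
    (A.smooth.extDer_pull (hYs (s, p)) (1, 0) (0, (1, 0)))
  rw [A.form.extDer.pull_comp_two (hy.mdifferentiable (by simp) _)
    (hH.differentiable (by simp) _).hasFDerivAt, fderiv_eq_id hH hH0 hp, hH0 p hps,
    alternating_two_plane] at hex
  refine (h1.add h2).hasDerivAt.congr_deriv ?_
  have h5 : fderiv ℝ (rd EG g) (s, p) (0, (1, 0)) (1, 0) +
      fderiv ℝ (fun q => A.form.pull (fun q => y (H q)) q ![(1, 0)]) (s, p) (0, (1, 0)) =
      (velocity H s p).2 • curvPull A y p := by
    rw [← sub_eq_zero.1 hMC.symm.symm]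
    have h6 : (velocity H s p).2 • curvPull A y p = -(((fderiv ℝ H (s, p) (1, 0)).1 * (0 : ℝ) -
      (fderiv ℝ H (s, p) (1, 0)).2 * 1) • A.form.extDer.pull y p ![(1, 0), (0, 1)]) := by
      simp only [velocity, curvPull]; module
    rw [h6]
    simp only at hex
    rw [hex]; abel
  simpa using h5

end GaugeVariation

/-! ### Pointwise variation of B on the corrected surfaces. -/

section HolonomyVariation

variable {EG EM EP : Type*}
  [NormedAddCommGroup EG] [NormedSpace ℝ EG] [NormedAddCommGroup EM] [NormedSpace ℝ EM]
  [NormedAddCommGroup EP] [NormedSpace ℝ EP]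
  {G M P : Type*} [TopologicalSpace G] [ChartedSpace EG G] [Group G]
  [TopologicalSpace M] [ChartedSpace EM M] [TopologicalSpace P] [ChartedSpace EP P]
  {S : PrincipalBundle EG EM EP G M P} {A : PrincipalConnection S} {B : AdjointTwoForm S} {p₀ : P}

lemma hasDerivAt_intervalIntegral {E : Type*} [NormedAddCommGroup E] [NormedSpace ℝ E]
    [CompleteSpace E] {f : ℝ × ℝ → E} (hf : ContDiff ℝ ∞ f) (a b s : ℝ) :
    HasDerivAt (fun s => ∫ t in a..b, f (s, t)) (∫ t in a..b, fderiv ℝ f (s, t) (1, 0)) s := by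
  have h := (hasFDerivAt_intervalIntegral (hf.of_le (by exact_mod_cast le_top)) a b s).hasDerivAt
  refine h.congr_deriv ?_
  have hc : Continuous fun t => (fderiv ℝ f (s, t)).comp (ContinuousLinearMap.inl ℝ ℝ ℝ) :=
    ((hf.continuous_fderiv (by simp)).comp (by fun_prop)).clm_comp continuous_const
  rw [ContinuousLinearMap.intervalIntegral_apply (hc.intervalIntegrable _ _)]
  simp

/-- The component of the connection in the `τ` direction. -/
def transverse (A : PrincipalConnection S) (y : ℝ × ℝ → P) (p : ℝ × ℝ) : EG :=
  A.form.pull y p ![(0, 1)]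

variable [FiniteDimensional ℝ EG] [LieGroup 𝓘(ℝ, EG) ∞ G] [IsManifold 𝓘(ℝ, EP) ∞ P]
  {y : ℝ × ℝ → P} {H : ℝ × (ℝ × ℝ) → ℝ × ℝ} {g : ℝ × (ℝ × ℝ) → G} {s : ℝ}

omit [LieGroup 𝓘(ℝ, EG) ∞ G] in
lemma contDiff_transverse (hy : ContMDiff 𝓘(ℝ, ℝ × ℝ) 𝓘(ℝ, EP) ∞ y) : ContDiff ℝ ∞ (transverse A y) :=
  have : CompleteSpace EG := FiniteDimensional.complete ℝ EG
  A.smooth.contDiff_pull hy _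

omit [FiniteDimensional ℝ EG] [LieGroup 𝓘(ℝ, EG) ∞ G] in
lemma curvPull_eq (hy : ContMDiff 𝓘(ℝ, ℝ × ℝ) 𝓘(ℝ, EP) ∞ y) (p : ℝ × ℝ) :
    curvPull A y p = fderiv ℝ (transverse A y) p (1, 0) -
      fderiv ℝ (fun p => A.form.pull y p ![(1, 0)]) p (0, 1) :=
  (A.form.extDer.pull_two y p (1, 0) (0, 1)).trans (A.smooth.extDer_pull (hy p) (1, 0) (0, 1))

omit [LieGroup 𝓘(ℝ, EG) ∞ G] in
lemma contDiff_curvPull (hy : ContMDiff 𝓘(ℝ, ℝ × ℝ) 𝓘(ℝ, EP) ∞ y) : ContDiff ℝ ∞ (curvPull A y) := by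
  have : CompleteSpace EG := FiniteDimensional.complete ℝ EG
  have h : curvPull A y = fun p => fderiv ℝ (transverse A y) p (1, 0) -
      fderiv ℝ (fun p => A.form.pull y p ![(1, 0)]) p (0, 1) := funext (curvPull_eq hy)
  rw [h]
  exact (((contDiff_transverse hy).fderiv_right (by simp)).clm_apply contDiff_const).sub
    (((A.smooth.contDiff_pull hy _).fderiv_right (by simp)).clm_apply contDiff_const)

/-- The form `B` on the family of gauge transformed surfaces. -/
def formFamily (B : AdjointTwoForm S) (y : ℝ × ℝ → P) (H : ℝ × (ℝ × ℝ) → ℝ × ℝ)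
    (g : ℝ × (ℝ × ℝ) → G) (q : ℝ × (ℝ × ℝ)) : EG :=
  B.form.pull (fun q => S.act (y (H q)) (g q)) q ![(0, (1, 0)), (0, (0, 1))]

omit [FiniteDimensional ℝ EG] [LieGroup 𝓘(ℝ, EG) ∞ G] [IsManifold 𝓘(ℝ, EP) ∞ P] in
lemma contMDiff_act_family (hy : ContMDiff 𝓘(ℝ, ℝ × ℝ) 𝓘(ℝ, EP) ∞ y) (hH : ContDiff ℝ ∞ H)
    (hg : ContMDiff 𝓘(ℝ, ℝ × (ℝ × ℝ)) 𝓘(ℝ, EG) ∞ g) :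
    ContMDiff 𝓘(ℝ, ℝ × (ℝ × ℝ)) 𝓘(ℝ, EP) ∞ fun q => S.act (y (H q)) (g q) :=
  S.contMDiff_act.comp ((hy.comp hH.contMDiff).prodMk hg)

omit [LieGroup 𝓘(ℝ, EG) ∞ G] in
lemma contDiff_formFamily (hy : ContMDiff 𝓘(ℝ, ℝ × ℝ) 𝓘(ℝ, EP) ∞ y) (hH : ContDiff ℝ ∞ H)
    (hg : ContMDiff 𝓘(ℝ, ℝ × (ℝ × ℝ)) 𝓘(ℝ, EG) ∞ g) : ContDiff ℝ ∞ (formFamily B y H g) :=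
  have : CompleteSpace EG := FiniteDimensional.complete ℝ EG
  B.smooth.contDiff_pull (contMDiff_act_family hy hH hg) _

omit [FiniteDimensional ℝ EG] [IsManifold 𝓘(ℝ, EP) ∞ P] in
-- Equivariance produces Ad(g⁻¹); pulling a two-form back along H within the plane produces det DH.
lemma formFamily_eq (hy : ContMDiff 𝓘(ℝ, ℝ × ℝ) 𝓘(ℝ, EP) ∞ y) (hH : ContDiff ℝ ∞ H)
    (hg : ContMDiff 𝓘(ℝ, ℝ × (ℝ × ℝ)) 𝓘(ℝ, EG) ∞ g) (q : ℝ × (ℝ × ℝ)) :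
    formFamily B y H g q = Adj (g q)⁻¹ (((fderiv ℝ H q (0, (1, 0))).1 * (fderiv ℝ H q (0, (0, 1))).2 -
      (fderiv ℝ H q (0, (1, 0))).2 * (fderiv ℝ H q (0, (0, 1))).1) • formW B y (H q).1 (H q).2) := by
  rw [formFamily, B.pull_act (y := fun q => y (H q)) ((hy.comp hH.contMDiff).mdifferentiable (by simp) q) ((hg q).hasRD (by simp)),
    B.form.pull_comp_two (hy.mdifferentiable (by simp) _) (hH.differentiable (by simp) q).hasFDerivAt,
    alternating_two_plane, formW_eq_pull]

/-- Product rule at g = 1 and H = id: the determinant contributes the divergence of v, b∘H its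
derivative along v, and Ad(g⁻¹) minus the bracket with the s-derivative of g, which is U - v₂α
because A(∂y/∂σ) = 0. -/
lemma fderiv_formFamily (hy : ContMDiff 𝓘(ℝ, ℝ × ℝ) 𝓘(ℝ, EP) ∞ y) (hH : ContDiff ℝ ∞ H)
    (hg : ContMDiff 𝓘(ℝ, ℝ × (ℝ × ℝ)) 𝓘(ℝ, EG) ∞ g)
    (hH0 : ∀ p ∈ paramSquare, H (s, p) = p)
    (hyA : ∀ p ∈ paramSquare, A.form.pull y p ![(1, 0)] = 0) {p : ℝ × ℝ} (hp : p ∈ openSquare)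
    (hg1 : g (s, p) = 1) :
    fderiv ℝ (formFamily B y H g) (s, p) (1, 0) =
      ((fderiv ℝ (velocity H s) p (1, 0)).1 + (fderiv ℝ (velocity H s) p (0, 1)).2) • formW B y p.1 p.2 +
      fderiv ℝ (fun p => formW B y p.1 p.2) p (velocity H s p) -
      brk G (gaugeVelocity A y H g s p - (velocity H s p).2 • transverse A y p) (formW B y p.1 p.2) := by
  have hps := openSquare_subset hp
  have hb := contDiff_formW B hy
  have hγ : rd EG g (s, p) (1, 0) = gaugeVelocity A y H g s p - (velocity H s p).2 • transverse A y p := by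
    rw [gaugeVelocity, gauge_pull hy hH, alternating_one_plane, hH0 p hps, hyA p hps]
    simp [velocity, transverse]
  have h2H : DifferentiableAt ℝ (fderiv ℝ H) (s, p) :=
    (hH.fderiv_right (m := ∞) (by simp)).differentiable (by simp) _
  have hD : ∀ u, HasFDerivAt (fun q => fderiv ℝ H q u) ((fderiv ℝ (fderiv ℝ H) (s, p)).flip u) (s, p) :=
    fderiv_clm_apply_const' h2H
  have hbH : HasFDerivAt (fun q => formW B y (H q).1 (H q).2)
      ((fderiv ℝ (fun p => formW B y p.1 p.2) p).comp (fderiv ℝ H (s, p))) (s, p) :=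
    HasFDerivAt.comp (g := fun p => formW B y p.1 p.2) (f := H) (s, p)
      (by rw [hH0 p hps]; exact (hb.differentiable (by simp) p).hasFDerivAt)
      (hH.differentiable (by simp) _).hasFDerivAt
  have hJ : HasFDerivAt (fun q => (fderiv ℝ H q (0, (1, 0))).1 * (fderiv ℝ H q (0, (0, 1))).2 -
      (fderiv ℝ H q (0, (1, 0))).2 * (fderiv ℝ H q (0, (0, 1))).1) _ (s, p) :=
    ((hD (0, (1, 0))).fst.mul (hD (0, (0, 1))).snd).sub ((hD (0, (1, 0))).snd.mul (hD (0, (0, 1))).fst)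
  have hJb : HasFDerivAt (fun q => ((fderiv ℝ H q (0, (1, 0))).1 * (fderiv ℝ H q (0, (0, 1))).2 -
      (fderiv ℝ H q (0, (1, 0))).2 * (fderiv ℝ H q (0, (0, 1))).1) • formW B y (H q).1 (H q).2) _ (s, p) :=
    hJ.smul hbH
  have hgr : HasRD g (rd EG g (s, p)) (s, p) := (hg (s, p)).hasRD (by simp)
  have hAd : HasFDerivAt (fun q => (Adj (g q)⁻¹ : EG →L[ℝ] EG)) _ (s, p) := hgr.inv.hasFDerivAt_Adj
  have hF := hAd.clm_apply hJb
  have h0 : formFamily B y H g = fun q => Adj (g q)⁻¹ (((fderiv ℝ H q (0, (1, 0))).1 *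
      (fderiv ℝ H q (0, (0, 1))).2 - (fderiv ℝ H q (0, (1, 0))).2 * (fderiv ℝ H q (0, (0, 1))).1) •
        formW B y (H q).1 (H q).2) := funext (formFamily_eq hy hH hg)
  rw [h0]
  refine (congrArg (fun L : ℝ × (ℝ × ℝ) →L[ℝ] EG => L (1, 0)) hF.fderiv).trans ?_
  have hv1 := fderiv_velocity hH s p (1, 0)
  have hv2 := fderiv_velocity hH s p (0, 1)
  simp [hg1, fderiv_eq_id hH hH0 hp, hH0 p hps, hγ]
  rw [hv1, hv2]
  simp only [velocity]
  module

end HolonomyVariation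

/-! ### Variation of the loop-space connection, integrated over a loop. -/

section HolonomyFamily

variable {EG EM EP : Type*}
  [NormedAddCommGroup EG] [NormedSpace ℝ EG] [NormedAddCommGroup EM] [NormedSpace ℝ EM]
  [NormedAddCommGroup EP] [NormedSpace ℝ EP]
  {G M P : Type*} [TopologicalSpace G] [ChartedSpace EG G] [Group G]
  [TopologicalSpace M] [ChartedSpace EM M] [TopologicalSpace P] [ChartedSpace EP P]
  {S : PrincipalBundle EG EM EP G M P} {A : PrincipalConnection S} {B : AdjointTwoForm S} {p₀ : P}
  [FiniteDimensional ℝ EG] [LieGroup 𝓘(ℝ, EG) ∞ G] [T2Space G] [IsManifold 𝓘(ℝ, EP) ∞ P]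
  {x : ℝ × ℝ → M} {y : ℝ × ℝ → P} {H : ℝ × (ℝ × ℝ) → ℝ × ℝ} {g : ℝ × (ℝ × ℝ) → G} {s : ℝ}

lemma mem_frontier_of_fst {σ τ : ℝ} (hσ : σ = 0 ∨ σ = 2 * Real.pi) (hτ : τ ∈ Icc 0 (2 * Real.pi)) :
    (σ, τ) ∈ frontier paramSquare := by
  refine mem_frontier_paramSquare.2 ⟨⟨?_, hτ⟩, fun h => ?_⟩
  · rcases hσ with rfl | rfl
    · exact ⟨le_rfl, two_pi_pos'.le⟩
    · exact ⟨two_pi_pos'.le, le_rfl⟩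
  · rcases hσ with rfl | rfl
    · exact lt_irrefl _ h.1.1
    · exact lt_irrefl _ h.1.2

lemma mem_frontier_of_snd {σ τ : ℝ} (hτ : τ = 0 ∨ τ = 2 * Real.pi) (hσ : σ ∈ Icc 0 (2 * Real.pi)) :
    (σ, τ) ∈ frontier paramSquare := by
  refine mem_frontier_paramSquare.2 ⟨⟨hσ, ?_⟩, fun h => ?_⟩
  · rcases hτ with rfl | rfl
    · exact ⟨le_rfl, two_pi_pos'.le⟩
    · exact ⟨two_pi_pos'.le, le_rfl⟩
  · rcases hτ with rfl | rfl
    · exact lt_irrefl _ h.2.1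
    · exact lt_irrefl _ h.2.2

lemma formFamily_eq_formW (hy : ContMDiff 𝓘(ℝ, ℝ × ℝ) 𝓘(ℝ, EP) ∞ y) (hH : ContDiff ℝ ∞ H)
    (hg : ContMDiff 𝓘(ℝ, ℝ × (ℝ × ℝ)) 𝓘(ℝ, EG) ∞ g) (hg0 : ∀ s τ, g (s, (0, τ)) = 1)
    (hgA : ∀ q, rd EG g q (0, (1, 0)) = -A.form.pull (fun q => y (H q)) q ![(0, (1, 0))])
    (hH0 : ∀ p ∈ paramSquare, H (s, p) = p)
    (hyA : ∀ p ∈ paramSquare, A.form.pull y p ![(1, 0)] = 0) {p : ℝ × ℝ} (hp : p ∈ paramSquare) :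
    formFamily B y H g (s, p) = formW B y p.1 p.2 := by
  have hc : Continuous fun p : ℝ × ℝ => (s, p) := by fun_prop
  refine eqOn_paramSquare (f := fun p => formFamily B y H g (s, p))
    ((contDiff_formFamily hy hH hg).continuous.comp hc) (contDiff_formW B hy).continuous
    (fun p hp => ?_) hp
  simp [formFamily_eq hy hH hg, gauge_eq_one hy hH hg hg0 hgA hH0 hyA hp, fderiv_eq_id hH hH0 hp,
    hH0 p (openSquare_subset hp)]

/-- Integration by parts for a bilinear map applied to an antiderivative. -/
lemma integral_bilinear_by_parts {E : Type*} [NormedAddCommGroup E] [NormedSpace ℝ E] [CompleteSpace E]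
    (L : E →L[ℝ] E →L[ℝ] E) {U b f : ℝ → E} {v : ℝ → ℝ} {c : ℝ} (hc : 0 ≤ c) (hb : Continuous b)
    (hf : Continuous f) (hv : Continuous v) (hUc : Continuous U) (hU0 : U 0 = 0)
    (hU : ∀ σ ∈ Ioo 0 c, HasDerivAt U (v σ • f σ) σ) :
    ∫ σ in (0 : ℝ)..c, L (U σ) (b σ) =
      ∫ σ in (0 : ℝ)..c, v σ • L (f σ) ((∫ t in (0 : ℝ)..c, b t) - ∫ t in (0 : ℝ)..σ, b t) := by
  have hβ : ∀ σ, HasDerivAt (fun σ => ∫ t in (0 : ℝ)..σ, b t) (b σ) σ := fun σ =>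
    intervalIntegral.integral_hasDerivAt_right (hb.intervalIntegrable _ _)
      (hb.stronglyMeasurableAtFilter _ _) hb.continuousAt
  have hβc : Continuous fun σ => ∫ t in (0 : ℝ)..σ, b t :=
    continuous_iff_continuousAt.2 fun σ => (hβ σ).continuousAt
  set β := fun σ => ∫ t in (0 : ℝ)..σ, b t with hβdef
  -- The primitive of b is normalized to vanish at c; as U vanishes at 0, no boundary term remains.
  have hd : ∀ σ ∈ Ioo 0 c, HasDerivAt (fun σ => L (U σ) (β σ - β c))
      (L (U σ) (b σ) - v σ • L (f σ) (β c - β σ)) σ := by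
    intro σ hσ
    have h0 : HasDerivAt (fun σ => L (U σ)) (L (v σ • f σ)) σ :=
      L.hasFDerivAt.comp_hasDerivAt σ (hU σ hσ)
    have h1 : HasDerivAt (fun σ => L (U σ) (β σ - β c))
        (L (v σ • f σ) (β σ - β c) + L (U σ) (b σ)) σ := h0.clm_apply ((hβ σ).sub_const (β c))
    refine h1.congr_deriv ?_
    simp only [map_sub, map_smul, smul_apply]
    module
  have hi1 : Continuous fun σ => L (U σ) (b σ) := by fun_prop
  have hi2 : Continuous fun σ => v σ • L (f σ) (β c - β σ) := by fun_prop
  have h := intervalIntegral.integral_eq_sub_of_hasDerivAt_of_le hc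
    (by fun_prop : Continuous fun σ => L (U σ) (β σ - β c)).continuousOn hd
    ((hi1.sub hi2).intervalIntegrable _ _)
  rw [intervalIntegral.integral_sub (hi1.intervalIntegrable _ _) (hi2.intervalIntegrable _ _)] at h
  rw [hU0] at h
  simpa [sub_eq_zero] using h

/-- The divergence part splits: the σ-derivative integrates to zero because v = 0 on the boundary,
and the τ-derivative comes out of the integral. Integration by parts replaces U by its derivative
v₂f, so only v₂ survives. -/
lemma integral_fderiv_formFamily (hy : ContMDiff 𝓘(ℝ, ℝ × ℝ) 𝓘(ℝ, EP) ∞ y) (hH : ContDiff ℝ ∞ H)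
    (hg : ContMDiff 𝓘(ℝ, ℝ × (ℝ × ℝ)) 𝓘(ℝ, EG) ∞ g) (hg0 : ∀ s τ, g (s, (0, τ)) = 1)
    (hgA : ∀ q, rd EG g q (0, (1, 0)) = -A.form.pull (fun q => y (H q)) q ![(0, (1, 0))])
    (hH0 : ∀ p ∈ paramSquare, H (s, p) = p)
    (hHf : ∀ᶠ r in 𝓝 s, ∀ p ∈ frontier paramSquare, H (r, p) = p)
    (hyA : ∀ p ∈ paramSquare, A.form.pull y p ![(1, 0)] = 0) {τ : ℝ} (hτ : τ ∈ Ioo 0 (2 * Real.pi)) :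
    ∫ σ in (0 : ℝ)..(2 * Real.pi), fderiv ℝ (formFamily B y H g) (s, (σ, τ)) (1, 0) =
      deriv (fun τ => ∫ σ in (0 : ℝ)..(2 * Real.pi), (velocity H s (σ, τ)).2 • formW B y σ τ) τ +
      ∫ σ in (0 : ℝ)..(2 * Real.pi), (velocity H s (σ, τ)).2 •
        (brk G (transverse A y (σ, τ)) (formW B y σ τ) - brk G (curvPull A y (σ, τ))
          (primitive (fun p => formW B y p.1 p.2) (2 * Real.pi, τ) -
            primitive (fun p => formW B y p.1 p.2) (σ, τ))) := by
  have : CompleteSpace EG := FiniteDimensional.complete ℝ EG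
  have hτ' : τ ∈ Icc 0 (2 * Real.pi) := Ioo_subset_Icc_self hτ
  set b : ℝ × ℝ → EG := fun p => formW B y p.1 p.2 with hbdef
  set v := velocity H s with hvdef
  have hb : ContDiff ℝ ∞ b := contDiff_formW B hy
  have hv : ContDiff ℝ ∞ v := contDiff_velocity hH s
  have hv1 : ContDiff ℝ ∞ fun p => (v p).1 := hv.fst
  have hv2 : ContDiff ℝ ∞ fun p => (v p).2 := hv.snd
  have hU : ContDiff ℝ ∞ (gaugeVelocity A y H g s) := contDiff_gaugeVelocity hy hH hg
  have hα : ContDiff ℝ ∞ (transverse A y) := contDiff_transverse hy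
  have hf : ContDiff ℝ ∞ (curvPull A y) := contDiff_curvPull hy
  have hF := contDiff_formFamily (B := B) hy hH hg
  have hfr : ∀ p ∈ frontier paramSquare, v p = 0 := fun p hp =>
    velocity_eq_zero hH (hHf.mono fun r hr => hr p hp)
  have hm1 : ∀ p, HasFDerivAt (fun p => (v p).1 • b p) _ p := fun p =>
    (hv.differentiable (by simp) p).hasFDerivAt.fst.smul (hb.differentiable (by simp) p).hasFDerivAt
  have hm2 : ∀ p, HasFDerivAt (fun p => (v p).2 • b p) _ p := fun p =>
    (hv.differentiable (by simp) p).hasFDerivAt.snd.smul (hb.differentiable (by simp) p).hasFDerivAt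
  have hs1 : ContDiff ℝ ∞ fun p => (v p).1 • b p := hv1.smul hb
  have hs2 : ContDiff ℝ ∞ fun p => (v p).2 • b p := hv2.smul hb
  have hvc := hv.continuous
  have hbc := hb.continuous
  have hUc := hU.continuous
  have hαc := hα.continuous
  have hfc := hf.continuous
  have hc1 : Continuous fun p => fderiv ℝ (fun p => (v p).1 • b p) p (1, 0) :=
    (hs1.continuous_fderiv (by simp)).clm_apply continuous_const
  have hc2 : Continuous fun p => fderiv ℝ (fun p => (v p).2 • b p) p (0, 1) :=
    (hs2.continuous_fderiv (by simp)).clm_apply continuous_const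
  have hpt : EqOn (fun p => fderiv ℝ (formFamily B y H g) (s, p) (1, 0))
      (fun p => fderiv ℝ (fun p => (v p).1 • b p) p (1, 0) + fderiv ℝ (fun p => (v p).2 • b p) p (0, 1) -
        brk G (gaugeVelocity A y H g s p) (b p) + (v p).2 • brk G (transverse A y p) (b p)) paramSquare := by
    refine eqOn_paramSquare ?_ (by fun_prop) fun p hp => ?_
    · exact ((hF.continuous_fderiv (by simp)).comp (by fun_prop)).clm_apply continuous_const
    · have h1 := fderiv_formFamily (B := B) hy hH hg hH0 hyA hp
        (gauge_eq_one hy hH hg hg0 hgA hH0 hyA hp)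
      have h2 : fderiv ℝ b p (v p) = (v p).1 • fderiv ℝ b p (1, 0) + (v p).2 • fderiv ℝ b p (0, 1) := by
        rw [← map_smul, ← map_smul, ← map_add]; simp
      simp only [h1, (hm1 p).fderiv, (hm2 p).fderiv]
      change _ • b p + fderiv ℝ b p (v p) - _ = _
      rw [h2]
      simp [hbdef]
      module
  have hl : Continuous fun σ : ℝ => (σ, τ) := by fun_prop
  have hint1 : ∫ σ in (0 : ℝ)..(2 * Real.pi), fderiv ℝ (fun p => (v p).1 • b p) (σ, τ) (1, 0) = 0 := by
    have hd : ∀ σ ∈ uIcc 0 (2 * Real.pi), HasDerivAt (fun σ => (v (σ, τ)).1 • b (σ, τ))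
        (fderiv ℝ (fun p => (v p).1 • b p) (σ, τ) (1, 0)) σ := fun σ _ => by
      have := ((hs1.differentiable (by simp) (σ, τ)).hasFDerivAt.comp (f := fun σ => (σ, τ)) σ
        (hasFDerivAt_prodMk_left σ τ)).hasDerivAt
      exact this.congr_deriv (by simp)
    rw [intervalIntegral.integral_eq_sub_of_hasDerivAt hd ((hc1.comp hl).intervalIntegrable _ _),
      hfr _ (mem_frontier_of_fst (Or.inl rfl) hτ'), hfr _ (mem_frontier_of_fst (Or.inr rfl) hτ')]
    simp
  have hint2 : ∫ σ in (0 : ℝ)..(2 * Real.pi), fderiv ℝ (fun p => (v p).2 • b p) (σ, τ) (0, 1) =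
      deriv (fun τ => ∫ σ in (0 : ℝ)..(2 * Real.pi), (v (σ, τ)).2 • formW B y σ τ) τ := by
    have hsw : ContDiff ℝ ∞ fun q : ℝ × ℝ => (v (q.2, q.1)).2 • b (q.2, q.1) :=
      hs2.comp (contDiff_snd.prodMk contDiff_fst)
    have h3 := hasDerivAt_intervalIntegral hsw 0 (2 * Real.pi) τ
    rw [show (fun τ => ∫ σ in (0 : ℝ)..(2 * Real.pi), (v (σ, τ)).2 • formW B y σ τ) = _ from rfl, h3.deriv]
    refine intervalIntegral.integral_congr fun σ _ => ?_
    have h4 : HasFDerivAt (fun q : ℝ × ℝ => (v (q.2, q.1)).2 • b (q.2, q.1)) _ (τ, σ) :=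
      HasFDerivAt.comp (g := fun p => (v p).2 • b p) (f := fun q : ℝ × ℝ => (q.2, q.1)) (τ, σ)
        (hs2.differentiable (by simp) (σ, τ)).hasFDerivAt
        (hasFDerivAt_snd.prodMk hasFDerivAt_fst)
    rw [h4.fderiv]; simp
  have hint3 := integral_bilinear_by_parts (brk G) (U := fun σ => gaugeVelocity A y H g s (σ, τ))
    (b := fun σ => b (σ, τ)) (f := fun σ => curvPull A y (σ, τ)) (v := fun σ => (v (σ, τ)).2) two_pi_pos'.le
    (by fun_prop) (by fun_prop) (by fun_prop) (by fun_prop)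
    (gaugeVelocity_zero hy hH hg hg0 (hHf.mono fun r hr => hr _ (mem_frontier_of_fst (Or.inl rfl) hτ')))
    (fun σ hσ => hasDerivAt_gaugeVelocity hy hH hg hgA hH0 hyA (p := (σ, τ)) ⟨hσ, hτ⟩)
  have hprim : Continuous (primitive b) := (contDiff_primitive hb).continuous
  calc ∫ σ in (0 : ℝ)..(2 * Real.pi), fderiv ℝ (formFamily B y H g) (s, (σ, τ)) (1, 0)
      = ∫ σ in (0 : ℝ)..(2 * Real.pi), (fderiv ℝ (fun p => (v p).1 • b p) (σ, τ) (1, 0) +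
          fderiv ℝ (fun p => (v p).2 • b p) (σ, τ) (0, 1) -
          brk G (gaugeVelocity A y H g s (σ, τ)) (b (σ, τ)) +
          (v (σ, τ)).2 • brk G (transverse A y (σ, τ)) (b (σ, τ))) := by
        refine intervalIntegral.integral_congr fun σ hσ => ?_
        rw [uIcc_of_le two_pi_pos'.le] at hσ
        exact hpt (show (σ, τ) ∈ paramSquare from ⟨hσ, hτ'⟩)
    _ = _ := by
        rw [intervalIntegral.integral_add, intervalIntegral.integral_sub, intervalIntegral.integral_add,
          hint1, hint2, hint3, zero_add, sub_add, ← intervalIntegral.integral_sub]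
        · rw [sub_eq_add_neg, ← intervalIntegral.integral_neg]
          congr 1
          refine intervalIntegral.integral_congr fun σ _ => ?_
          simp only [hbdef, primitive, smul_sub, neg_sub]
        all_goals exact Continuous.intervalIntegrable (by first | exact hc1.comp hl | exact hc2.comp hl | fun_prop) _ _

end HolonomyFamily

/-! ### Holonomies of a family of reparametrizations and their derivative. -/

section VariationOfHolonomy

variable {EG EM EP : Type*}
  [NormedAddCommGroup EG] [NormedSpace ℝ EG] [NormedAddCommGroup EM] [NormedSpace ℝ EM]
  [NormedAddCommGroup EP] [NormedSpace ℝ EP]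
  {G M P : Type*} [TopologicalSpace G] [ChartedSpace EG G] [Group G]
  [TopologicalSpace M] [ChartedSpace EM M] [TopologicalSpace P] [ChartedSpace EP P]
  {S : PrincipalBundle EG EM EP G M P} {A : PrincipalConnection S} {B : AdjointTwoForm S} {p₀ : P}
  [FiniteDimensional ℝ EG] [LieGroup 𝓘(ℝ, EG) ∞ G] [T2Space G] [IsManifold 𝓘(ℝ, EP) ∞ P]
  {x : ℝ × ℝ → M} {y : ℝ × ℝ → P} {H : ℝ × (ℝ × ℝ) → ℝ × ℝ} {g : ℝ × (ℝ × ℝ) → G} {s : ℝ}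

omit [FiniteDimensional ℝ EG] [T2Space G] [IsManifold 𝓘(ℝ, EP) ∞ P] in
-- The gauge equation makes the new curves horizontal; they start at p₀ since H fixes the edge σ = 0
-- and g = 1 there.
lemma IsHorizontalLift.act_family (h : IsHorizontalLift A p₀ x y) (hH : ContDiff ℝ ∞ H)
    (hg : ContMDiff 𝓘(ℝ, ℝ × (ℝ × ℝ)) 𝓘(ℝ, EG) ∞ g) (hg0 : ∀ s τ, g (s, (0, τ)) = 1)
    (hgA : ∀ q, rd EG g q (0, (1, 0)) = -A.form.pull (fun q => y (H q)) q ![(0, (1, 0))])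
    (hm : MapsTo (fun p => H (s, p)) paramSquare paramSquare)
    (hf : ∀ p ∈ frontier paramSquare, H (s, p) = p) :
    IsHorizontalLift A p₀ (x ∘ fun p => H (s, p)) (fun p => S.act (y (H (s, p))) (g (s, p))) := by
  have hz := contMDiff_act_family (S := S) h.1 hH hg
  have hi : ContDiff ℝ ∞ fun p : ℝ × ℝ => (s, p) := by fun_prop
  refine ⟨hz.comp hi.contMDiff, fun q hq => ?_, fun τ hτ => ?_, fun σ _ τ _ => ?_⟩
  · rw [S.proj_act]; exact h.2.1 _ (hm hq)
  · beta_reduce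
    rw [hg0, S.act_one, hf _ (mem_frontier_of_fst (Or.inl rfl) hτ)]
    exact h.2.2.1 τ hτ
  · refine (form_dSigma_eq_pull A (fun p => S.act (y (H (s, p))) (g (s, p))) σ τ).trans ?_
    rw [A.form.pull_comp_one (y := fun q => S.act (y (H q)) (g q)) (h := fun p => (s, p))
        (hz.mdifferentiable (by simp) _) (hasFDerivAt_prodMk_right s (σ, τ)),
      A.pull_act (y := fun q => y (H q)) ((h.1.comp hH.contMDiff).mdifferentiable (by simp) _)
        ((hg _).hasRD (by simp))]
    simp [hgA]

omit [FiniteDimensional ℝ EG] [T2Space G] [LieGroup 𝓘(ℝ, EG) ∞ G] [IsManifold 𝓘(ℝ, EP) ∞ P] in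
lemma formW_act_family (hy : ContMDiff 𝓘(ℝ, ℝ × ℝ) 𝓘(ℝ, EP) ∞ y) (hH : ContDiff ℝ ∞ H)
    (hg : ContMDiff 𝓘(ℝ, ℝ × (ℝ × ℝ)) 𝓘(ℝ, EG) ∞ g) (σ τ : ℝ) :
    formW B (fun p => S.act (y (H (s, p))) (g (s, p))) σ τ = formFamily B y H g (s, (σ, τ)) := by
  have hz := contMDiff_act_family (S := S) hy hH hg
  rw [formW_eq_pull,
    B.form.pull_comp_two (y := fun q => S.act (y (H q)) (g q)) (h := fun p => (s, p))
      (hz.mdifferentiable (by simp) _) (hasFDerivAt_prodMk_right s (σ, τ))]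
  rfl

/-- The holonomies of a smooth family of reparametrizations of a loop of loops, and their variation. -/
theorem IsHorizontalLift.exists_holonomy_family (h : IsHorizontalLift A p₀ x y) (hH : ContDiff ℝ ∞ H) :
    ∃ W : ℝ → G, ContMDiff 𝓘(ℝ, ℝ) 𝓘(ℝ, EG) ∞ W ∧
      (∀ s, MapsTo (fun p => H (s, p)) paramSquare paramSquare →
        (∀ p ∈ frontier paramSquare, H (s, p) = p) → ∀ w,
          HasHolonomy A B p₀ (x ∘ fun p => H (s, p)) w ↔ w = W s) ∧
      ∀ s, (∀ p ∈ paramSquare, H (s, p) = p) →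
        (∀ᶠ r in 𝓝 s, ∀ p ∈ frontier paramSquare, H (r, p) = p) → ∀ V : ℝ → G, V 0 = 1 →
        (∀ τ ∈ Icc 0 (2 * Real.pi),
          HasRD V (ContinuousLinearMap.toSpanSingleton ℝ (-totalW B y τ)) τ) →
        Adj (W s)⁻¹ (rd EG W s 1) = -∫ τ in (0 : ℝ)..(2 * Real.pi), Adj (V τ)⁻¹
          (∫ σ in (0 : ℝ)..(2 * Real.pi), (velocity H s (σ, τ)).2 •
            obstruction G (fun p => formW B y p.1 p.2) (curvPull A y) (transverse A y) (σ, τ)) := by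
  have : CompleteSpace EG := FiniteDimensional.complete ℝ EG
  have hy := h.1
  have hyA : ∀ p ∈ paramSquare, A.form.pull y p ![(1, 0)] = 0 := fun p hp => h.pull_eq_zero hp
  obtain ⟨g, hg, hg0, hgA⟩ := A.exists_gauge (Y := fun q => y (H q)) (hy.comp hH.contMDiff)
  set b : ℝ × ℝ → EG := fun p => formW B y p.1 p.2 with hbdef
  have hb : ContDiff ℝ ∞ b := contDiff_formW B hy
  have hF := contDiff_formFamily (B := B) hy hH hg
  -- Arguments are ordered (τ, s): τ is the evolution variable and s the parameter, and the
  -- holonomies are the values of the solution at τ = 2π.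
  let a : ℝ × ℝ → EG := fun q => ∫ σ in (0 : ℝ)..(2 * Real.pi), formFamily B y H g (q.2, (σ, q.1))
  have ha : ContDiff ℝ ∞ a := contDiff_intervalIntegral
    (f := fun q : (ℝ × ℝ) × ℝ => formFamily B y H g (q.1.2, (q.2, q.1.1)))
    (hF.comp (by fun_prop)) _ _
  obtain ⟨W, hW, hW0, hWa⟩ := exists_group_solution (G := G) (a := fun q => -a q) ha.neg
  refine ⟨fun s => W (2 * Real.pi, s), hW.comp (by fun_prop : ContDiff ℝ ∞ fun s : ℝ => (2 * Real.pi, s)).contMDiff, fun s hm hf w => ?_,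
    fun s hH0 hHf V hV0 hV => ?_⟩
  · have hl := h.act_family hH hg hg0 hgA hm hf
    have hV : ∀ τ ∈ Icc 0 (2 * Real.pi), HasRD (fun τ => W (τ, s))
        (ContinuousLinearMap.toSpanSingleton ℝ
          (-totalW B (fun p => S.act (y (H (s, p))) (g (s, p))) τ)) τ := by
      intro τ _
      have h1 : totalW B (fun p => S.act (y (H (s, p))) (g (s, p))) τ = a (τ, s) :=
        intervalIntegral.integral_congr fun σ _ => formW_act_family hy hH hg σ τ
      rw [h1]
      exact hWa s τ
    exact ⟨fun hw => hw.eq hl (hW0 s) hV, fun hw => hw ▸ hl.hasHolonomy (V := fun τ => W (τ, s)) (hW0 s) hV⟩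
  · have hFs : ∀ p ∈ paramSquare, formFamily B y H g (s, p) = b p := fun p hp =>
      formFamily_eq_formW hy hH hg hg0 hgA hH0 hyA hp
    have has : ∀ τ ∈ Icc 0 (2 * Real.pi), a (τ, s) = totalW B y τ := by
      intro τ hτ
      refine intervalIntegral.integral_congr fun σ hσ => ?_
      rw [uIcc_of_le two_pi_pos'.le] at hσ
      exact hFs (σ, τ) ⟨hσ, hτ⟩
    -- At H_s = id the loop-space connection is that of `y` on [0, 2π], so uniqueness identifies the
    -- transport with V there.
    have hWV : EqOn (fun τ => W (τ, s)) V (Icc 0 (2 * Real.pi)) := by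
      refine HasRD.eqOn_of_eq (a := fun τ => -totalW B y τ) ordConnected_Icc (fun τ hτ => ?_) hV
        (left_mem_Icc.2 two_pi_pos'.le) ((hW0 s).trans hV0.symm)
      have h1 := hWa s τ
      simp only [has τ hτ] at h1
      exact h1
    have hda : ∀ τ ∈ Ioo 0 (2 * Real.pi), fderiv ℝ a (τ, s) (0, 1) =
        deriv (fun τ => ∫ σ in (0 : ℝ)..(2 * Real.pi), (velocity H s (σ, τ)).2 • b (σ, τ)) τ +
        ∫ σ in (0 : ℝ)..(2 * Real.pi), (velocity H s (σ, τ)).2 •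
          (brk G (transverse A y (σ, τ)) (b (σ, τ)) - brk G (curvPull A y (σ, τ))
            (primitive b (2 * Real.pi, τ) - primitive b (σ, τ))) := by
      intro τ hτ
      rw [← integral_fderiv_formFamily hy hH hg hg0 hgA hH0 hHf hyA hτ]
      let f : ℝ × ℝ → EG := fun q => formFamily B y H g (q.1, (q.2, τ))
      have hf : ContDiff ℝ ∞ f := hF.comp (by fun_prop)
      have h1 : HasDerivAt (fun s => a (τ, s)) (∫ σ in (0 : ℝ)..(2 * Real.pi), fderiv ℝ f (s, σ) (1, 0)) s :=
        hasDerivAt_intervalIntegral hf 0 (2 * Real.pi) s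
      have h2 : HasDerivAt (fun s => a (τ, s)) (fderiv ℝ a (τ, s) (0, 1)) s := by
        have := ((ha.differentiable (by simp) (τ, s)).hasFDerivAt.comp (f := fun s => (τ, s)) s
          (hasFDerivAt_prodMk_right τ s)).hasDerivAt
        exact this.congr_deriv (by simp)
      rw [h2.unique h1]
      refine intervalIntegral.integral_congr fun σ _ => ?_
      have h2' : HasFDerivAt (fun q : ℝ × ℝ => (q.2, τ)) ((ContinuousLinearMap.snd ℝ ℝ ℝ).prod 0) (s, σ) :=
        hasFDerivAt_snd.prodMk (hasFDerivAt_const τ (s, σ))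
      have h3 : HasFDerivAt (fun q : ℝ × ℝ => (q.1, (q.2, τ)))
          ((ContinuousLinearMap.fst ℝ ℝ ℝ).prod ((ContinuousLinearMap.snd ℝ ℝ ℝ).prod 0)) (s, σ) :=
        hasFDerivAt_fst.prodMk h2'
      have h4 : HasFDerivAt f _ (s, σ) :=
        HasFDerivAt.comp (g := formFamily B y H g) (f := fun q : ℝ × ℝ => (q.1, (q.2, τ))) (s, σ)
          (hF.differentiable (by simp) (s, (σ, τ))).hasFDerivAt h3
      refine (congrArg (fun L : ℝ × ℝ →L[ℝ] EG => L (1, 0)) h4.fderiv).trans ?_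
      simp
      rfl
    have hv0 : ∀ p ∈ frontier paramSquare, velocity H s p = 0 := fun p hp =>
      velocity_eq_zero hH (hHf.mono fun r hr => hr p hp)
    have hvar := variation_formula hW hW0 ha hWa hb (contDiff_curvPull hy).continuous
      (contDiff_transverse hy).continuous (v := fun p => (velocity H s p).2) (contDiff_velocity hH s).snd
      (fun σ hσ => ⟨by rw [hv0 _ (mem_frontier_of_snd (Or.inl rfl) hσ)]; rfl,
        by rw [hv0 _ (mem_frontier_of_snd (Or.inr rfl) hσ)]; rfl⟩)
      (fun τ hτ => has τ (Ioo_subset_Icc_self hτ)) hda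
    have hrd : rd EG (fun s => W (2 * Real.pi, s)) s 1 = rd EG W (2 * Real.pi, s) (0, 1) := by
      have h1 := ((hW (2 * Real.pi, s)).hasRD (by simp)).comp (c := fun s => (2 * Real.pi, s))
        (hasFDerivAt_prodMk_right (2 * Real.pi) s)
      rw [h1.rd_eq]; simp
    rw [hrd, hvar]
    congr 1
    refine intervalIntegral.integral_congr fun τ hτ => ?_
    rw [uIcc_of_le two_pi_pos'.le] at hτ
    simp only [show W (τ, s) = V τ from hWV hτ]

/-- The holonomy of a loop of loops with horizontal lift `y` as the end point of a smooth curve. -/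
lemma exists_transport (B : AdjointTwoForm S) (hy : ContMDiff 𝓘(ℝ, ℝ × ℝ) 𝓘(ℝ, EP) ∞ y) :
    ∃ V : ℝ → G, ContMDiff 𝓘(ℝ, ℝ) 𝓘(ℝ, EG) ∞ V ∧ V 0 = 1 ∧ ∀ τ,
      HasRD V (ContinuousLinearMap.toSpanSingleton ℝ (-totalW B y τ)) τ := by
  have : CompleteSpace EG := FiniteDimensional.complete ℝ EG
  obtain ⟨W, hW, hW0, hWa⟩ := exists_group_solution (G := G) (F := ℝ) (a := fun q => -totalW B y q.1)
    ((contDiff_totalW B hy).comp contDiff_fst).neg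
  exact ⟨fun τ => W (τ, 0), hW.comp (by fun_prop : ContDiff ℝ ∞ fun τ : ℝ => (τ, (0 : ℝ))).contMDiff,
    hW0 0, fun τ => hWa 0 τ⟩

end VariationOfHolonomy

/-! ### The θ-integral of the theorem as the obstruction. -/

section ObstructionIntegral

variable {EG EM EP : Type*}
  [NormedAddCommGroup EG] [NormedSpace ℝ EG] [NormedAddCommGroup EM] [NormedSpace ℝ EM]
  [NormedAddCommGroup EP] [NormedSpace ℝ EP]
  {G M P : Type*} [TopologicalSpace G] [ChartedSpace EG G] [Group G]
  [TopologicalSpace M] [ChartedSpace EM M] [TopologicalSpace P] [ChartedSpace EP P]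
  {S : PrincipalBundle EG EM EP G M P} {A : PrincipalConnection S} {B : AdjointTwoForm S} {p₀ : P}
  {x : ℝ × ℝ → M} {y : ℝ × ℝ → P}

/-- An antisymmetric bracket, integrated against step functions. -/
lemma integral_stepFn_bracket {E : Type*} [NormedAddCommGroup E] [NormedSpace ℝ E] [CompleteSpace E]
    (L : E →L[ℝ] E →L[ℝ] E) (hL : ∀ ξ η, L ξ η = -L η ξ) {b f : ℝ → E} {c σ : ℝ} (hσ : σ ∈ Icc 0 c)
    (hb : Continuous b) (hf : Continuous f) :
    ∫ t in (0 : ℝ)..c, (stepFn (σ - t) • L (f t - b t) (b σ) - stepFn (t - σ) • L (f σ - b σ) (b t)) =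
      L (∫ t in (0 : ℝ)..σ, f t) (b σ) - L (f σ) ((∫ t in (0 : ℝ)..c, b t) - ∫ t in (0 : ℝ)..σ, b t) +
        L (b σ) (∫ t in (0 : ℝ)..c, b t) := by
  -- On either side of t = σ only one step function survives; open intervals suffice, so its value
  -- at 0 is irrelevant.
  have e1 : EqOn (fun t => L (f t - b t) (b σ)) (fun t => stepFn (σ - t) • L (f t - b t) (b σ) -
      stepFn (t - σ) • L (f σ - b σ) (b t)) (uIoo 0 σ) := by
    intro t ht
    rw [uIoo_of_le hσ.1] at ht
    simp [stepFn, ht.2, ht.2.not_gt]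
  have e2 : EqOn (fun t => -L (f σ - b σ) (b t)) (fun t => stepFn (σ - t) • L (f t - b t) (b σ) -
      stepFn (t - σ) • L (f σ - b σ) (b t)) (uIoo σ c) := by
    intro t ht
    rw [uIoo_of_le hσ.2] at ht
    simp [stepFn, ht.1, ht.1.not_gt]
  have c1 : Continuous fun t => L (f t - b t) (b σ) := by fun_prop
  have c2 : Continuous fun t => -L (f σ - b σ) (b t) := by fun_prop
  have hbi : ∀ r s, IntervalIntegrable b volume r s := fun r s => hb.intervalIntegrable r s
  have hfi : ∀ r s, IntervalIntegrable f volume r s := fun r s => hf.intervalIntegrable r s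
  rw [← intervalIntegral.integral_add_adjacent_intervals
    ((c1.intervalIntegrable 0 σ).congr_uIoo e1) ((c2.intervalIntegrable σ c).congr_uIoo e2),
    ← intervalIntegral.integral_congr_uIoo e1, ← intervalIntegral.integral_congr_uIoo e2,
    intervalIntegral.integral_neg,
    (L (f σ - b σ)).intervalIntegral_comp_comm (hbi σ c)]
  have h1 := (L.flip (b σ)).intervalIntegral_comp_comm ((hfi 0 σ).sub (hbi 0 σ))
  simp only [ContinuousLinearMap.flip_apply] at h1
  rw [h1, intervalIntegral.integral_sub (hfi 0 σ) (hbi 0 σ),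
    ← intervalIntegral.integral_add_adjacent_intervals (hbi 0 σ) (hbi σ c)]
  simp only [map_sub, map_add, sub_apply, hL (∫ t in (0 : ℝ)..σ, b t) (b σ)]
  abel

lemma transverse_zero (h : IsHorizontalLift A p₀ x y) {τ : ℝ} (hτ : τ ∈ Ioo 0 (2 * Real.pi)) :
    transverse A y (0, τ) = 0 := by
  have h1 := A.form.pull_comp_one (h := fun t : ℝ => ((0 : ℝ), t)) (h.1.mdifferentiable (by simp) _)
    (hasFDerivAt_prodMk_right (0 : ℝ) τ) 1
  have h2 : A.form.pull (fun t => y (0, t)) τ = A.form.pull (fun _ => p₀) τ := by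
    refine A.form.pull_congr ?_
    filter_upwards [Ioo_mem_nhds hτ.1 hτ.2] with t ht using h.2.2.1 t (Ioo_subset_Icc_self ht)
  rw [h2] at h1
  exact (by simpa [transverse] using h1.symm.trans (horizontalAt_const A p₀ τ).2)

variable [FiniteDimensional ℝ EG] [LieGroup 𝓘(ℝ, EG) ∞ G] [IsManifold 𝓘(ℝ, EP) ∞ P]

omit [LieGroup 𝓘(ℝ, EG) ∞ G] in
-- As A(∂y/∂σ) vanishes on the open square, dA(∂y/∂σ, ∂y/∂τ) reduces there to ∂α/∂σ; and α vanishes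
-- on σ = 0, where y is constant.
lemma transverse_eq_primitive (h : IsHorizontalLift A p₀ x y) :
    EqOn (transverse A y) (primitive (curvPull A y)) paramSquare := by
  have : CompleteSpace EG := FiniteDimensional.complete ℝ EG
  have hα := contDiff_transverse (A := A) h.1
  have hf := contDiff_curvPull (A := A) h.1
  refine eqOn_paramSquare hα.continuous (contDiff_primitive hf).continuous ?_
  rintro ⟨σ, τ⟩ ⟨hσ, hτ⟩
  have hl : Continuous fun t : ℝ => (t, τ) := by fun_prop
  have hd : ∀ t ∈ Ioo 0 σ, HasDerivAt (fun t => transverse A y (t, τ)) (curvPull A y (t, τ)) t := by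
    intro t ht
    have hp : (t, τ) ∈ openSquare := ⟨⟨ht.1, ht.2.trans hσ.2⟩, hτ⟩
    have h0 : (fun p => A.form.pull y p ![(1, 0)]) =ᶠ[𝓝 (t, τ)] fun _ => 0 := by
      filter_upwards [isOpen_openSquare.mem_nhds hp] with p hp using h.pull_eq_zero (openSquare_subset hp)
    have h1 := ((hα.differentiable (by simp) (t, τ)).hasFDerivAt.comp (f := fun t => (t, τ)) t
      (hasFDerivAt_prodMk_left t τ)).hasDerivAt
    refine h1.congr_deriv ?_
    rw [curvPull_eq h.1, h0.fderiv_eq]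
    simp
  have h2 := intervalIntegral.integral_eq_sub_of_hasDerivAt_of_le hσ.1.le (hα.continuous.comp hl).continuousOn hd
    ((hf.continuous.comp hl).intervalIntegrable _ _)
  simp only [primitive, h2, transverse_zero h hτ, sub_zero, Function.comp_def]

omit [FiniteDimensional ℝ EG] [IsManifold 𝓘(ℝ, EP) ∞ P] in
-- Horizontality in σ kills the quadratic term of the curvature, leaving dA.
lemma curvW_eq_curvPull (h : IsHorizontalLift A p₀ x y) {p : ℝ × ℝ} (hp : p ∈ paramSquare) :
    curvW A y p.1 p.2 = curvPull A y p := by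
  have h1 : A.form (y (p.1, p.2)) ![dSigma EP y p.1 p.2] = 0 := h.2.2.2 p.1 hp.1 p.2 hp.2
  unfold curvW PrincipalConnection.curvature
  rw [h1, lieBr_eq_brk, map_zero, zero_apply, add_zero]
  exact (A.form.extDer.pull_two y p (1, 0) (0, 1)).symm

/-- The double bracket integral is the obstruction to the stationarity of the holonomy. -/
theorem integral_stepFn_lieBr_eq_obstruction (h : IsHorizontalLift A p₀ x y) {σ τ : ℝ}
    (hσ : σ ∈ Icc 0 (2 * Real.pi)) (hτ : τ ∈ Icc 0 (2 * Real.pi)) :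
    ∫ σ' in (0 : ℝ)..(2 * Real.pi),
        (stepFn (σ - σ') • lieBr G (curvW A y σ' τ - formW B y σ' τ) (formW B y σ τ)
          - stepFn (σ' - σ) • lieBr G (curvW A y σ τ - formW B y σ τ) (formW B y σ' τ)) =
      obstruction G (fun p => formW B y p.1 p.2) (curvPull A y) (transverse A y) (σ, τ) := by
  have : CompleteSpace EG := FiniteDimensional.complete ℝ EG
  have hl : Continuous fun t : ℝ => (t, τ) := by fun_prop
  have h1 := integral_stepFn_bracket (brk G) brk_antisymm (b := fun t => formW B y t τ)
    (f := fun t => curvPull A y (t, τ)) hσ ((contDiff_formW B h.1).continuous.comp hl)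
    ((contDiff_curvPull h.1).continuous.comp hl)
  rw [obstruction, transverse_eq_primitive h ⟨hσ, hτ⟩]
  refine Eq.trans (intervalIntegral.integral_congr fun t ht => ?_) h1
  rw [uIcc_of_le two_pi_pos'.le] at ht
  simp only [lieBr_eq_brk, curvW_eq_curvPull h (p := (σ, τ)) ⟨hσ, hτ⟩,
    curvW_eq_curvPull h (p := (t, τ)) ⟨ht, hτ⟩]

end ObstructionIntegral

/-! ### Diffeomorphisms of the square near the identity, and test functions. -/

section SquareDiffeos

/-- A perturbation of the identity with a small Lipschitz constant is a diffeomorphism. -/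
lemma exists_contDiff_inverse {E : Type*} [NormedAddCommGroup E] [NormedSpace ℝ E] [CompleteSpace E]
    {u : E → E} (hu : ContDiff ℝ ∞ u) {c : NNReal} (hc : c < 1) (hl : LipschitzWith c u) :
    ∃ k : E → E, ContDiff ℝ ∞ k ∧ (∀ p, k (p + u p) = p) ∧ ∀ p, k p + u (k p) = p := by
  rcases subsingleton_or_nontrivial E with hE | hE
  · exact ⟨id, contDiff_id, fun _ => Subsingleton.elim _ _, fun _ => Subsingleton.elim _ _⟩
  have h1 : ApproximatesLinearOn (fun p => p + u p) ((ContinuousLinearEquiv.refl ℝ E : E ≃L[ℝ] E) : E →L[ℝ] E)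
      univ c := by
    refine LipschitzOnWith.approximatesLinearOn ?_
    rw [lipschitzOnWith_univ]
    convert hl using 1
    ext p; simp
  have h2 : c < ‖((ContinuousLinearEquiv.refl ℝ E).symm : E →L[ℝ] E)‖₊⁻¹ := by
    have : ‖((ContinuousLinearEquiv.refl ℝ E).symm : E →L[ℝ] E)‖₊ = 1 := by
      ext
      exact ContinuousLinearMap.norm_id
    rw [this, inv_one]
    exact hc
  let f : E ≃ₜ E := h1.toHomeomorph _ (Or.inr h2)
  have hf : ∀ p, f p = p + u p := fun _ => rfl
  have hd : ∀ p, ∃ L : E ≃L[ℝ] E, HasFDerivAt f (L : E →L[ℝ] E) p := by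
    intro p
    have h3 : ‖-fderiv ℝ u p‖ < 1 := by
      rw [norm_neg]
      exact (norm_fderiv_le_of_lipschitz ℝ hl).trans_lt (by exact_mod_cast hc)
    refine ⟨ContinuousLinearEquiv.unitsEquiv ℝ E (Units.oneSub _ h3), ?_⟩
    have h4 : HasFDerivAt (fun p => p + u p) (ContinuousLinearMap.id ℝ E + fderiv ℝ u p) p :=
      (hasFDerivAt_id p).add (hu.differentiable (by simp) p).hasFDerivAt
    refine h4.congr_fderiv ?_
    ext v
    simp
  choose L hL using hd
  refine ⟨f.symm, f.contDiff_symm hL (contDiff_id.add hu), fun p => f.symm_apply_apply p,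
    fun p => f.apply_symm_apply p⟩

lemma exists_isSquareDiffeo {φ : ℝ × ℝ → ℝ} (hφ : ContDiff ℝ ∞ φ) (hφc : HasCompactSupport φ)
    (hφs : ∀ p, p ∉ openSquare → φ p = 0) :
    ∃ c : ℝ, 0 < c ∧ ∀ t : ℝ, |t| ≤ c → IsSquareDiffeo fun p => p + (t * φ p) • ((0, 1) : ℝ × ℝ) := by
  obtain ⟨C, hC⟩ := hφ.lipschitzWith_of_hasCompactSupport hφc (by simp)
  -- With C a Lipschitz constant of φ, the displacement has Lipschitz constant at most C/(C + 2) <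
  -- 1, also when C = 0.
  refine ⟨(C + 2 : ℝ)⁻¹, by positivity, fun t ht => ?_⟩
  have hu : ContDiff ℝ ∞ fun p => (t * φ p) • ((0, 1) : ℝ × ℝ) := by fun_prop
  have hl : LipschitzWith (C / (C + 2)) fun p => (t * φ p) • ((0, 1) : ℝ × ℝ) := by
    refine LipschitzWith.of_dist_le_mul fun p q => ?_
    rw [dist_eq_norm, ← sub_smul, norm_smul, ← mul_sub, norm_mul, Real.norm_eq_abs t, ← dist_eq_norm]
    have h1 : ‖((0, 1) : ℝ × ℝ)‖ = 1 := by simp [Prod.norm_def]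
    rw [h1, mul_one]
    calc |t| * dist (φ p) (φ q) ≤ (C + 2 : ℝ)⁻¹ * (C * dist p q) := by
          gcongr
          exact hC.dist_le_mul p q
      _ = _ := by push_cast; ring
  obtain ⟨k, hk, hk1, hk2⟩ := exists_contDiff_inverse hu
    (by rw [div_lt_one (by positivity)]; exact lt_add_of_pos_right _ (by norm_num)) hl
  have hfix : ∀ p, p ∉ openSquare → p + (t * φ p) • ((0, 1) : ℝ × ℝ) = p := fun p hp => by
    rw [hφs p hp]; simp
  have hkfix : ∀ p, p ∉ openSquare → k p = p := fun p hp => by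
    conv_lhs => rw [← hfix p hp]
    exact hk1 p
  refine ⟨contDiff_id.add hu, fun p hp => ?_, ⟨k, hk, fun p hp => ?_, fun p _ => hk1 p, fun p _ => hk2 p⟩,
    fun p hp => hfix p (mem_frontier_paramSquare.1 hp).2⟩
  -- The map and its inverse fix every point outside the open square; a point of the square sent
  -- outside would be fixed, a contradiction.
  · by_contra h
    have h1 := hkfix _ fun h' => h (openSquare_subset h')
    rw [hk1] at h1
    exact h (h1 ▸ hp)
  · by_contra h
    have h1 := hfix _ fun h' => h (openSquare_subset h')
    rw [hk2] at h1
    exact h (h1 ▸ hp)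

lemma IsSquareDiffeo.inverse_eq {h k : ℝ × ℝ → ℝ × ℝ} (hh : IsSquareDiffeo h)
    (hk : InvOn k h paramSquare paramSquare) {p : ℝ × ℝ} (hp : p ∈ frontier paramSquare) : k p = p := by
  conv_lhs => rw [← hh.2.2.2 p hp]
  exact hk.1 (mem_frontier_paramSquare.1 hp).1

lemma IsLoopOfLoops.comp {EM M : Type*} [NormedAddCommGroup EM] [NormedSpace ℝ EM] [TopologicalSpace M]
    [ChartedSpace EM M] {x₀ : M} {x : ℝ × ℝ → M} (hx : IsLoopOfLoops EM x₀ x) {h : ℝ × ℝ → ℝ × ℝ}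
    (hh : IsSquareDiffeo h) : IsLoopOfLoops EM x₀ (x ∘ h) := by
  refine ⟨hx.1.comp hh.1.contMDiff, fun τ hτ => ⟨?_, ?_⟩, fun σ hσ => ?_⟩
  · rw [Function.comp_apply, hh.2.2.2 _ (mem_frontier_of_fst (Or.inl rfl) hτ)]
    exact (hx.2.1 τ hτ).1
  · rw [Function.comp_apply, hh.2.2.2 _ (mem_frontier_of_fst (Or.inr rfl) hτ)]
    exact (hx.2.1 τ hτ).2
  · rw [Function.comp_apply, Function.comp_apply, hh.2.2.2 _ (mem_frontier_of_snd (Or.inl rfl) hσ),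
      hh.2.2.2 _ (mem_frontier_of_snd (Or.inr rfl) hσ)]
    exact hx.2.2 σ hσ

/-- A continuous function on the square is zero if its integrals against bump functions are. -/
lemma eq_zero_of_integral_smul_eq_zero {E : Type*} [NormedAddCommGroup E] [NormedSpace ℝ E]
    [CompleteSpace E] {Φ : ℝ × ℝ → E} (hΦ : ContinuousOn Φ openSquare)
    (h : ∀ φ : ℝ × ℝ → ℝ, ContDiff ℝ ∞ φ → HasCompactSupport φ → tsupport φ ⊆ openSquare →
      ∫ τ in (0 : ℝ)..(2 * Real.pi), ∫ σ in (0 : ℝ)..(2 * Real.pi), φ (σ, τ) • Φ (σ, τ) = 0) :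
    EqOn Φ 0 openSquare := by
  have h1 : ∀ᵐ p ∂(volume : Measure (ℝ × ℝ)), p ∈ openSquare → Φ p = 0 := by
    refine isOpen_openSquare.ae_eq_zero_of_integral_contDiff_smul_eq_zero
      (hΦ.locallyIntegrableOn isOpen_openSquare.measurableSet) fun φ hφ hφc hφs => ?_
    have hz : ∀ p, p ∉ openSquare → φ p • Φ p = 0 := fun p hp => by
      rw [image_eq_zero_of_notMem_tsupport fun hp' => hp (hφs hp'), zero_smul]
    have hcont : Continuous fun p => φ p • Φ p := by
      rw [continuous_iff_continuousAt]
      intro p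
      by_cases hp : p ∈ tsupport φ
      · exact hφ.continuous.continuousAt.smul (hΦ.continuousAt (isOpen_openSquare.mem_nhds (hφs hp)))
      · refine ContinuousAt.congr (f := fun _ => 0) continuousAt_const ?_
        filter_upwards [(isClosed_tsupport φ).isOpen_compl.mem_nhds hp] with q hq
        rw [image_eq_zero_of_notMem_tsupport hq, zero_smul]
    have hint : Integrable (fun p => φ p • Φ p) volume :=
      hcont.integrable_of_hasCompactSupport hφc.smul_right
    rw [← h φ hφ hφc hφs]
    rw [Measure.volume_eq_prod, ← integral_prod_swap, integral_prod _ (by exact hint.swap)]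
    have hin : ∀ τ, ∫ σ, φ (σ, τ) • Φ (σ, τ) = ∫ σ in (0 : ℝ)..(2 * Real.pi), φ (σ, τ) • Φ (σ, τ) := by
      intro τ
      rw [intervalIntegral.integral_of_le two_pi_pos'.le, setIntegral_eq_integral_of_forall_compl_eq_zero]
      exact fun σ hσ => hz _ fun hp => hσ ⟨hp.1.1, hp.1.2.le⟩
    rw [intervalIntegral.integral_of_le two_pi_pos'.le, setIntegral_eq_integral_of_forall_compl_eq_zero]
    · exact integral_congr_ae (.of_forall fun τ => hin τ)
    · intro τ hτ
      rw [← hin]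
      have : ∀ σ, φ (σ, τ) • Φ (σ, τ) = 0 := fun σ => hz _ fun hp => hτ ⟨hp.2.1, hp.2.2.le⟩
      simp [this]
  exact Measure.eqOn_open_of_ae_eq ((ae_restrict_iff' isOpen_openSquare.measurableSet).2 h1)
    isOpen_openSquare hΦ continuousOn_const

end SquareDiffeos

/-! ### Equivalence of r-flatness with the vanishing of the obstruction. -/

section Flatness

variable {EG EM EP : Type*}
  [NormedAddCommGroup EG] [NormedSpace ℝ EG] [NormedAddCommGroup EM] [NormedSpace ℝ EM]
  [NormedAddCommGroup EP] [NormedSpace ℝ EP]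
  {G M P : Type*} [TopologicalSpace G] [ChartedSpace EG G] [Group G]
  [TopologicalSpace M] [ChartedSpace EM M] [TopologicalSpace P] [ChartedSpace EP P]
  {S : PrincipalBundle EG EM EP G M P} {A : PrincipalConnection S} {B : AdjointTwoForm S} {p₀ : P}
  [FiniteDimensional ℝ EG] [LieGroup 𝓘(ℝ, EG) ∞ G] [T2Space G] [IsManifold 𝓘(ℝ, EP) ∞ P]
  {x : ℝ × ℝ → M} {y : ℝ × ℝ → P}

/-- If the obstruction vanishes along a reparametrized loop of loops, then the holonomy is
stationary there. -/
lemma rd_holonomy_eq_zero {H : ℝ × (ℝ × ℝ) → ℝ × ℝ} (hH : ContDiff ℝ ∞ H)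
    (hHd : ∀ s ∈ Icc (0 : ℝ) 1, IsSquareDiffeo fun p => H (s, p)) {W : ℝ → G}
    (hW : ∀ s ∈ Icc (0 : ℝ) 1, HasHolonomy A B p₀ (x ∘ fun p => H (s, p)) (W s))
    {s : ℝ} (hs : s ∈ Ioo (0 : ℝ) 1) (hy : IsHorizontalLift A p₀ (x ∘ fun p => H (s, p)) y)
    (h0 : ∀ p ∈ paramSquare, obstruction G (fun p => formW B y p.1 p.2) (curvPull A y) (transverse A y) p = 0) :
    HasRD W (0 : ℝ →L[ℝ] EG) s := by
  have hss := Ioo_subset_Icc_self hs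
  obtain ⟨k, hk, hkm, hki⟩ := (hHd s hss).2.2.1
  have hkf : ∀ r ∈ Icc (0 : ℝ) 1, ∀ p ∈ frontier paramSquare, k (H (r, p)) = p := fun r hr p hp => by
    exact (congrArg k ((hHd r hr).2.2.2 p hp)).trans ((hHd s hss).inverse_eq hki hp)
  -- With k inverse to H_s, x∘H_r = (x∘H_s)∘(k∘H_r) on the square. The family k∘H is the identity at
  -- r = s, where the variation formula for the loop of loops x∘H_s applies.
  obtain ⟨W', hW', hWi, hWv⟩ := hy.exists_holonomy_family (B := B) (H := fun q => k (H q)) (hk.comp hH)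
  have hnhds : Icc (0 : ℝ) 1 ∈ 𝓝 s := Icc_mem_nhds hs.1 hs.2
  have heq : ∀ r ∈ Icc (0 : ℝ) 1, W r = W' r := fun r hr => by
    refine (hWi r (fun p hp => hkm ((hHd r hr).2.1 hp)) (hkf r hr) _).1 ((hW r hr).congr fun p hp => ?_)
    exact congrArg x (hki.2 ((hHd r hr).2.1 hp)).symm
  obtain ⟨V, -, hV0, hV⟩ := exists_transport B hy.1
  have hv := hWv s (fun p hp => hki.1 hp) (Filter.eventually_of_mem hnhds hkf) V hV0 fun τ _ => hV τ
  have hz : rd EG W' s 1 = 0 := by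
    rw [← Adj_eq_zero_iff (W' s)⁻¹, hv, neg_eq_zero]
    refine (intervalIntegral.integral_congr (g := fun _ => 0) fun τ hτ => ?_).trans (by simp)
    rw [uIcc_of_le two_pi_pos'.le] at hτ
    have h1 : ∫ σ in (0 : ℝ)..(2 * Real.pi), (velocity (fun q => k (H q)) s (σ, τ)).2 •
        obstruction G (fun p => formW B y p.1 p.2) (curvPull A y) (transverse A y) (σ, τ) = 0 := by
      refine (intervalIntegral.integral_congr (g := fun _ => 0) fun σ hσ => ?_).trans (by simp)
      rw [uIcc_of_le two_pi_pos'.le] at hσ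
      simp only [h0 (σ, τ) ⟨hσ, hτ⟩, smul_zero]
    simp only [h1, map_zero]
  have hrd : rd EG W' s = 0 := by ext; exact hz
  refine HasRD.congr (hrd ▸ (hW' s).hasRD (by simp)) ?_
  filter_upwards [hnhds] with r hr using heq r hr

/-- Each stage of an isotopy gives a loop of loops to which the hypothesis applies, so the holonomy
is stationary at every interior time and hence constant. -/
theorem isRFlat_of_obstruction_eq_zero
    (h0 : ∀ x : ℝ × ℝ → M, IsLoopOfLoops EM (S.proj p₀) x → ∃ y, IsHorizontalLift A p₀ x y ∧
      ∀ p ∈ paramSquare, obstruction G (fun p => formW B y p.1 p.2) (curvPull A y) (transverse A y) p = 0) :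
    IsRFlat A B p₀ := by
  rintro x hx h ⟨-, H, hH, hHd, hH0, hH1⟩
  obtain ⟨y, hy, -⟩ := h0 x hx
  obtain ⟨W, hWc, hWi, -⟩ := hy.exists_holonomy_family (B := B) hH
  have hW : ∀ s ∈ Icc (0 : ℝ) 1, HasHolonomy A B p₀ (x ∘ fun p => H (s, p)) (W s) := fun s hs =>
    (hWi s (hHd s hs).2.1 (hHd s hs).2.2.2 _).2 rfl
  have hconst : W 0 = W 1 := by
    refine HasRD.eq_of_zero (EG := EG) zero_le_one hWc.continuous.continuousOn fun s hs => ?_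
    obtain ⟨y', hy', hobs⟩ := h0 _ (hx.comp (hHd s (Ioo_subset_Icc_self hs)))
    exact rd_holonomy_eq_zero hH hHd hW hs hy' hobs
  refine ⟨W 0, (hW 0 (by simp)).congr fun p hp => congrArg x (hH0 p hp), ?_⟩
  rw [hconst]
  exact (hW 1 (by simp)).congr fun p hp => congrArg x (hH1 p hp)

/-- Moving points by a small multiple of φ in the τ-direction gives reparametrizations. Their
holonomies are constant, and the derivative at the identity is the integral in question up to a
nonzero factor. -/
lemma IsRFlat.integral_eq_zero (h : IsRFlat A B p₀) (hx : IsLoopOfLoops EM (S.proj p₀) x)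
    (hy : IsHorizontalLift A p₀ x y) {V : ℝ → G} (hV0 : V 0 = 1) (hV : ∀ τ ∈ Icc 0 (2 * Real.pi),
      HasRD V (ContinuousLinearMap.toSpanSingleton ℝ (-totalW B y τ)) τ) {φ : ℝ × ℝ → ℝ}
    (hφ : ContDiff ℝ ∞ φ) (hφc : HasCompactSupport φ) (hφs : ∀ p, p ∉ openSquare → φ p = 0) :
    ∫ τ in (0 : ℝ)..(2 * Real.pi), Adj (V τ)⁻¹ (∫ σ in (0 : ℝ)..(2 * Real.pi), φ (σ, τ) •
      obstruction G (fun p => formW B y p.1 p.2) (curvPull A y) (transverse A y) (σ, τ)) = 0 := by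
  obtain ⟨c, hc, hdiff⟩ := exists_isSquareDiffeo hφ hφc hφs
  -- The factor 2s - 1 places the identity at the interior time 1/2, so that a two-sided derivative
  -- in s is available while s stays in [0, 1].
  set H : ℝ × (ℝ × ℝ) → ℝ × ℝ := fun q => q.2 + (((2 * q.1 - 1) * c) * φ q.2) • ((0, 1) : ℝ × ℝ) with hHdef
  have hH : ContDiff ℝ ∞ H := by fun_prop
  have habs : ∀ s ∈ Icc (0 : ℝ) 1, |(2 * s - 1) * c| ≤ c := fun s hs => by
    rw [abs_mul, abs_of_pos hc]
    exact mul_le_of_le_one_left hc.le (abs_le.2 ⟨by linarith [hs.1], by linarith [hs.2]⟩)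
  have hHd : ∀ s ∈ Icc (0 : ℝ) 1, IsSquareDiffeo fun p => H (s, p) := fun s hs => hdiff _ (habs s hs)
  have hrep : ∀ s ∈ Icc (0 : ℝ) 1, IsReparametrization fun p => H (s, p) := by
    -- The isotopy to the identity rescales the displacement by a factor r in [0, 1].
    refine fun s hs => ⟨hHd s hs, fun q => q.2 + ((q.1 * ((2 * s - 1) * c)) * φ q.2) • ((0, 1) : ℝ × ℝ),
      by fun_prop, fun r hr => hdiff (r * ((2 * s - 1) * c)) ?_, fun q _ => by simp, fun q _ => by simp [hHdef]⟩
    rw [abs_mul, abs_of_nonneg hr.1]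
    exact (mul_le_of_le_one_left (abs_nonneg _) hr.2).trans (habs s hs)
  have hHh : ∀ p, H (1 / 2, p) = p := fun p => by simp [hHdef]
  obtain ⟨W, hWc, hWi, hWv⟩ := hy.exists_holonomy_family (B := B) hH
  have hmem : (1 / 2 : ℝ) ∈ Icc (0 : ℝ) 1 := by norm_num
  have hWs : ∀ s ∈ Icc (0 : ℝ) 1, W s = W (1 / 2) := fun s hs => by
    obtain ⟨g, hg, hg'⟩ := h x hx _ (hrep s hs)
    rw [← (hWi s (hHd s hs).2.1 (hHd s hs).2.2.2 g).1 hg']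
    refine (hWi _ (hHd _ hmem).2.1 (hHd _ hmem).2.2.2 g).1 (hg.congr fun p _ => ?_)
    exact congrArg x (hHh p).symm
  have hnhds : Icc (0 : ℝ) 1 ∈ 𝓝 (1 / 2 : ℝ) := Icc_mem_nhds (by norm_num) (by norm_num)
  have hrd : rd EG W (1 / 2) = 0 := by
    refine HasRD.rd_eq ((hasRD_const (W (1 / 2)) (1 / 2)).congr ?_)
    filter_upwards [hnhds] with s hs using hWs s hs
  have hvel : ∀ p, (velocity H (1 / 2) p).2 = 2 * c * φ p := by
    intro p
    have h1 : HasDerivAt (fun s => H (s, p)) ((2 * c * φ p) • ((0, 1) : ℝ × ℝ)) (1 / 2) := by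
      have h2 : HasDerivAt (fun s : ℝ => ((2 * s - 1) * c) * φ p) (2 * c * φ p) (1 / 2) := by
        have := ((((hasDerivAt_id (1 / 2 : ℝ)).const_mul 2).sub_const 1).mul_const c).mul_const (φ p)
        simpa using this
      exact (h2.smul_const ((0, 1) : ℝ × ℝ)).const_add p
    have h3 : HasDerivAt (fun s => H (s, p)) (velocity H (1 / 2) p) (1 / 2) := by
      have := ((hH.differentiable (by simp) (1 / 2, p)).hasFDerivAt.comp (f := fun s => (s, p)) (1 / 2)
        (hasFDerivAt_prodMk_left (1 / 2 : ℝ) p)).hasDerivAt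
      exact this.congr_deriv (by simp [velocity])
    rw [h3.unique h1]
    simp
  have hv := hWv (1 / 2) (fun p _ => hHh p) (Filter.eventually_of_mem hnhds fun s hs => (hHd s hs).2.2.2)
    V hV0 hV
  rw [hrd] at hv
  simp only [hvel, mul_smul, intervalIntegral.integral_smul, map_smul, zero_apply, map_zero,
    zero_eq_neg] at hv
  simpa [hc.ne'] using hv

/-- Ad(V⁻¹) moves inside the σ-integral, so the fundamental lemma applies to Ad(V⁻¹)K; invertibility
of Ad and continuity give K = 0 on the closed square. -/
theorem IsRFlat.obstruction_eq_zero (h : IsRFlat A B p₀) (hx : IsLoopOfLoops EM (S.proj p₀) x)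
    (hy : IsHorizontalLift A p₀ x y) {p : ℝ × ℝ} (hp : p ∈ paramSquare) :
    obstruction G (fun p => formW B y p.1 p.2) (curvPull A y) (transverse A y) p = 0 := by
  have : CompleteSpace EG := FiniteDimensional.complete ℝ EG
  obtain ⟨V, hVs, hV0, hV⟩ := exists_transport B hy.1
  set K := obstruction G (fun p => formW B y p.1 p.2) (curvPull A y) (transverse A y) with hKdef
  have hK : Continuous K := continuous_obstruction (contDiff_formW B hy.1) (contDiff_curvPull hy.1).continuous
    (contDiff_transverse hy.1).continuous
  have hAd : Continuous fun τ => (Adj (V τ)⁻¹ : EG →L[ℝ] EG) :=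
    continuous_iff_continuousAt.2 fun τ => (hV τ).inv.continuousAt_Adj
  have hz : EqOn (fun p : ℝ × ℝ => (Adj (V p.2)⁻¹ : EG →L[ℝ] EG) (K p)) 0 openSquare := by
    refine eq_zero_of_integral_smul_eq_zero ((hAd.comp continuous_snd).clm_apply hK).continuousOn
      fun φ hφ hφc hφs => ?_
    rw [← h.integral_eq_zero hx hy hV0 (fun τ _ => hV τ) hφ hφc
      fun p hp => image_eq_zero_of_notMem_tsupport fun hp' => hp (hφs hp')]
    refine intervalIntegral.integral_congr fun τ _ => ?_
    have hφt := hφ.continuous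
    have hc : Continuous fun σ => φ (σ, τ) • K (σ, τ) := by fun_prop
    simp only [← hKdef]
    rw [← (Adj (V τ)⁻¹ : EG →L[ℝ] EG).intervalIntegral_comp_comm (hc.intervalIntegrable _ _)]
    simp only [map_smul]
  exact eqOn_paramSquare (g := fun _ => (0 : EG)) hK continuous_const
    (fun p hp => (Adj_eq_zero_iff _).1 (hz hp)) hp

end Flatness

end

theorem mainTheorem3
    {EG EM EP : Type*}
    [NormedAddCommGroup EG] [NormedSpace ℝ EG] [FiniteDimensional ℝ EG]
    [NormedAddCommGroup EM] [NormedSpace ℝ EM] [FiniteDimensional ℝ EM]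
    [NormedAddCommGroup EP] [NormedSpace ℝ EP] [FiniteDimensional ℝ EP]
    {G M P : Type*}
    [TopologicalSpace G] [ChartedSpace EG G] [Group G] [LieGroup 𝓘(ℝ, EG) ∞ G] [T2Space G]
    [TopologicalSpace M] [ChartedSpace EM M] [IsManifold 𝓘(ℝ, EM) ∞ M] [T2Space M]
    [TopologicalSpace P] [ChartedSpace EP P] [IsManifold 𝓘(ℝ, EP) ∞ P]
    (S : PrincipalBundle EG EM EP G M P) (A : PrincipalConnection S) (B : AdjointTwoForm S)
    (p₀ : P) :
    IsRFlat A B p₀ ↔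
      ∀ x : ℝ × ℝ → M, IsLoopOfLoops EM (S.proj p₀) x →
        ∃ y : ℝ × ℝ → P, IsHorizontalLift A p₀ x y ∧
          ∀ σ ∈ Icc 0 (2 * Real.pi), ∀ τ ∈ Icc 0 (2 * Real.pi),
            ∫ σ' in (0 : ℝ)..(2 * Real.pi),
              (stepFn (σ - σ') • lieBr G (curvW A y σ' τ - formW B y σ' τ) (formW B y σ τ)
                - stepFn (σ' - σ) • lieBr G (curvW A y σ τ - formW B y σ τ) (formW B y σ' τ))
              = 0 := by
  constructor
  · intro h x hx
    obtain ⟨y, hy⟩ := hx.exists_isHorizontalLift A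
    refine ⟨y, hy, fun σ hσ τ hτ => ?_⟩
    rw [integral_stepFn_lieBr_eq_obstruction hy hσ hτ]
    exact h.obstruction_eq_zero hx hy ⟨hσ, hτ⟩
  · intro h
    refine isRFlat_of_obstruction_eq_zero fun x hx => ?_
    obtain ⟨y, hy, h0⟩ := h x hx
    refine ⟨y, hy, fun p hp => ?_⟩
    rw [← h0 p.1 hp.1 p.2 hp.2, integral_stepFn_lieBr_eq_obstruction hy hp.1 hp.2]
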